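/- Let $0<a<b$, let $k\ge 1$ be an integer, let $c>1$, put $\alpha_c=\sqrt{(c^2-1)/(bc^2-a)}$, and let $\alpha\in(0,\alpha_c)$. Let $$q_c(z)=\frac{c^2-1}{c}\,\mathrm{sech}^2\Bigl(\frac{\alpha_c z}{2}\Bigr),\qquad r_c=-c\,q_c .$$ For $\beta\in\mathbb R$ let $L^2_\beta=L^2(\mathbb R;e^{2\beta z}dz)$ (complex-valued functions), and let $H^k_\beta$ be the Hilbert space of $u\in L^2_\beta$ with $\partial_z^ku\in L^2_\beta$, with norm $(\|\partial_z^ku\|_{L^2_\beta}^2+\|u\|_{L^2_\beta}^2)^{1/2}$. For $\eta\in\mathbb R$ let $A(\eta)=1+a\eta^2-a\partial_z^2$, $B(\eta)=1+b\eta^2-b\partial_z^2$, $A_0=A(0)$, $B_0=B(0)$, and let $\mathcal L(\eta)$ be the operator with domain $H^2_\alpha\times H^1_\alpha$ in $H^1_\alpha\times L^2_\alpha$ given by $$\mathcal L(\eta)=\begin{pmatrix} c\partial_z & 1\\ B(\eta)^{-1}A(\eta)(\partial_z^2-\eta^2) & c\partial_z\end{pmatrix}-B(\eta)^{-1}\begin{pmatrix}0&0\\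 2r_c'\partial_z+r_c(\partial_z^2-\eta^2) & 2q_c\partial_z+q_c'\end{pmatrix}.$$ (This is $e^{-iy\eta}\mathcal L e^{iy\eta}$, where $\mathcal L$ is the linearization of the two-dimensional Benney–Luke equation around its line solitary wave of speed $c$.) Let $\mathcal L(\eta)^*$ be its adjoint with respect to the pairing $\langle f,g\rangle=\sum_{j=1}^2\int_{\mathbb R}f_j\overline{g_j}\,dz$ of $L^2_\alpha\times L^2_\alpha$ with $L^2_{-\alpha}\times L^2_{-\alpha}$. Put $$\zeta_1=\begin{pmatrix}q_c\\ r_c'\end{pmatrix},\quad \zeta_2=\begin{pmatrix}\int_z^\infty\partial_cq_c\\ -\partial_cr_c\end{pmatrix},\quad \zeta_1^*=c\begin{pmatrix}-B_0\partial_cr_c-2q_c\partial_cq_c-q_c'\int_{-\infty}^z\partial_cq_c\\ B_0\int_{-\infty}^z\partial_cq_c\end{pmatrix},\quad \zeta_2^*=\begin{pmatrix}A_0q_c'\\ -B_0r_c\end{pmatrix}.$$ Then there exist $\eta_0>0$, positive constants $\lambda_1,\lambda_2$, a function $\lambda\in C^\infty([-\eta_0,\eta_0];\mathbb C)$ and maps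 $$\zeta\in C^\infty([-\eta_0,\eta_0];H^k_\alpha\times H^{k-1}_\alpha),\qquad \zeta^*\in C^\infty([-\eta_0,\eta_0];H^k_{-\alpha}\times H^{k-1}_{-\alpha})$$ such that, for all $\eta\in[-\eta_0,\eta_0]$, $\zeta(\eta)\neq0$, $\zeta^*(\eta)\ne0$, $$\mathcal L(\eta)\zeta(\pm\eta)=\lambda(\pm\eta)\zeta(\pm\eta),\qquad \mathcal L(\eta)^*\zeta^*(\pm\eta)=\lambda(\mp\eta)\zeta^*(\pm\eta),$$ (in particular $\zeta(\pm\eta)$ and $\zeta^*(\pm\eta)$ lie in the domains of $\mathcal L(\eta)$ and $\mathcal L(\eta)^*$), $$\overline{\lambda(\eta)}=\lambda(-\eta),\qquad \overline{\zeta(z,\eta)}=\zeta(z,-\eta),\qquad \overline{\zeta^*(z,\eta)}=\zeta^*(z,-\eta)\quad\text{for almost every }z\in\mathbb R,$$ and, on $[-\eta_0,\eta_0]$, $$\lambda(\eta)=i\lambda_1\eta-\lambda_2\eta^2+O(\eta^3),$$ $$\zeta(\eta)=\zeta_1+i\lambda_1\eta\,\zeta_2+O(\eta^2)\ \text{ in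 }H^k_\alpha\times H^{k-1}_\alpha,\qquad \zeta^*(\eta)=\zeta_2^*-i\lambda_1\eta\,\zeta_1^*+O(\eta^2)\ \text{ in }H^k_{-\alpha}\times H^{k-1}_{-\alpha},$$ where $\zeta_1,\zeta_2$ belong to $H^k_\alpha\times H^{k-1}_\alpha$ and $\zeta_1^*,\zeta_2^*$ to $H^k_{-\alpha}\times H^{k-1}_{-\alpha}$. -/

import Mathlib

open MeasureTheory Set
open scoped ContDiff ENNReal ComplexConjugate

noncomputable section

namespace BenneyLuke

/-! ### The line solitary wave -/

/-- The decay rate `α_c = √((c² - 1)/(bc² - a))` of the solitary wave. -/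
def alphaC (a b c : ℝ) : ℝ := Real.sqrt ((c ^ 2 - 1) / (b * c ^ 2 - a))

/-- `q_c(z) = ((c² - 1)/c) sech²(α_c z/2)`. -/
def qc (a b c z : ℝ) : ℝ := (c ^ 2 - 1) / c * (1 / Real.cosh (alphaC a b c * z / 2)) ^ 2

/-- `r_c = -c q_c`. -/
def rc (a b c z : ℝ) : ℝ := -c * qc a b c z

/-- `∂_z q_c`. -/
def qcz (a b c z : ℝ) : ℝ := deriv (fun x => qc a b c x) z

/-- `∂_z r_c`. -/
def rcz (a b c z : ℝ) : ℝ := deriv (fun x => rc a b c x) z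

/-- `∂_c q_c`. -/
def dcqc (a b c z : ℝ) : ℝ := deriv (fun s => qc a b s z) c

/-- `∂_c r_c`. -/
def dcrc (a b c z : ℝ) : ℝ := deriv (fun s => rc a b s z) c

/-- The operator `1 - d ∂_z²` acting on smooth functions; `A₀` is the case `d = a`, and `B₀` the
case `d = b`. -/
def helm (d : ℝ) (f : ℝ → ℝ) (z : ℝ) : ℝ := f z - d * deriv (deriv f) z

/-- `∫_{-∞}^z ∂_c q_c`. -/
def intLeft (a b c z : ℝ) : ℝ := ∫ s in Iic z, dcqc a b c s

/-- `∫_z^∞ ∂_c q_c`. -/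
def intRight (a b c z : ℝ) : ℝ := ∫ s in Ioi z, dcqc a b c s

/-- `ζ₁ = (q_c, r_c')`. -/
def zeta1 (a b c z : ℝ) : ℝ × ℝ := (qc a b c z, rcz a b c z)

/-- `ζ₂ = (∫_z^∞ ∂_c q_c, -∂_c r_c)`. -/
def zeta2 (a b c z : ℝ) : ℝ × ℝ := (intRight a b c z, -dcrc a b c z)

/-- `ζ₁* = c (-B₀ ∂_c r_c - 2 q_c ∂_c q_c - q_c' ∫_{-∞}^z ∂_c q_c, B₀ ∫_{-∞}^z ∂_c q_c)`. -/
def zeta1Star (a b c z : ℝ) : ℝ × ℝ :=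
  (c * (-helm b (dcrc a b c) z - 2 * qc a b c z * dcqc a b c z - qcz a b c z * intLeft a b c z),
    c * helm b (intLeft a b c) z)

/-- `ζ₂* = (A₀ q_c', -B₀ r_c)`. -/
def zeta2Star (a b c z : ℝ) : ℝ × ℝ := (helm a (qcz a b c) z, -helm b (rc a b c) z)

/-! ### Weighted Lebesgue and Sobolev spaces on the line -/

/-- The measure `e^{2αz} dz` on `ℝ`. -/
def wMeasure (α : ℝ) : Measure ℝ :=
  volume.withDensity fun z => ENNReal.ofReal (Real.exp (2 * α * z))

/-- The space `L²_α(ℝ) = L²(ℝ; e^{2αz} dz)` of complex-valued functions. -/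
abbrev WL2 (α : ℝ) : Type := Lp ℂ 2 (wMeasure α)

/-- Test functions: smooth and compactly supported. -/
def IsTest (φ : ℝ → ℂ) : Prop := ContDiff ℝ ∞ φ ∧ HasCompactSupport φ

/-- `w` is the `n`-th weak derivative of `u`. -/
def WeakDeriv (n : ℕ) (u w : ℝ → ℂ) : Prop :=
  ∀ φ : ℝ → ℂ, IsTest φ → ∫ z, u z * iteratedDeriv n φ z = (-1) ^ n * ∫ z, w z * φ z

theorem volume_ac (α : ℝ) : (volume : Measure ℝ) ≪ wMeasure α := by
  refine withDensity_absolutelyContinuous' (by fun_prop) (Filter.Eventually.of_forall fun z => ?_)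
  simp [Real.exp_pos]

instance (α : ℝ) : IsLocallyFiniteMeasure (wMeasure α) :=
  IsLocallyFiniteMeasure.withDensity_ofReal (by fun_prop)

theorem WL2.integrable_mul {α : ℝ} (u : WL2 α) {φ : ℝ → ℂ} (hc : Continuous φ)
    (hs : HasCompactSupport φ) : Integrable (fun z => u z * φ z) := by
  have h1 : MemLp (fun z => φ z * (Real.exp (-(2 * α * z)) : ℂ)) 2 (wMeasure α) :=
    Continuous.memLp_of_hasCompactSupport (by fun_prop) hs.mul_right
  have h2 : Integrable (fun z => u z * (φ z * (Real.exp (-(2 * α * z)) : ℂ))) (wMeasure α) :=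
    MemLp.integrable_mul (Lp.memLp u) h1
  have h3 := (integrable_withDensity_iff_integrable_smul₀' (by fun_prop) (by simp)).1 h2
  refine h3.congr (Filter.Eventually.of_forall fun z => ?_)
  simp only [ENNReal.toReal_ofReal (Real.exp_pos _).le, Complex.real_smul, Real.exp_neg]
  have : (Real.exp (2 * α * z) : ℂ) ≠ 0 := by exact_mod_cast (Real.exp_pos _).ne'
  push_cast at this ⊢
  field_simp

theorem IsTest.iteratedDeriv {φ : ℝ → ℂ} (h : IsTest φ) (n : ℕ) :
    Continuous (iteratedDeriv n φ) ∧ HasCompactSupport (iteratedDeriv n φ) := by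
  refine ⟨h.1.continuous_iteratedDeriv n (by exact_mod_cast le_top), ?_⟩
  induction n with
  | zero => simpa using h.2
  | succ n ih => rw [iteratedDeriv_succ]; exact ih.deriv

/-- The Sobolev space `H^k_α(ℝ)` as the graph of the `k`-th weak derivative: the pairs `(u, ∂^k u)`
with `u, ∂^k u ∈ L²_α(ℝ)`. The norm inherited from the Hilbert space `L²_α × L²_α` is
`(‖∂^k u‖² + ‖u‖²)^{1/2}`. -/
def sobolevGraph (α : ℝ) (k : ℕ) : Submodule ℂ (WithLp 2 (WL2 α × WL2 α)) where
  carrier := {p | WeakDeriv k p.fst p.snd}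
  zero_mem' := by
    intro φ _
    have h : ⇑(0 : WL2 α) =ᵐ[volume] 0 := (volume_ac α).ae_le (Lp.coeFn_zero ℂ 2 (wMeasure α))
    have h1 : ∀ ψ : ℝ → ℂ, ∫ z, (0 : WL2 α) z * ψ z = 0 := fun ψ =>
      integral_eq_zero_of_ae (by filter_upwards [h] with z hz; rw [hz]; simp)
    simp only [WithLp.zero_fst, WithLp.zero_snd, h1, mul_zero]
  add_mem' := by
    intro p p' hp hp' φ hφ
    have h : ∀ (u v : WL2 α) (n : ℕ), ∫ z, (u + v) z * iteratedDeriv n φ z =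
        (∫ z, u z * iteratedDeriv n φ z) + ∫ z, v z * iteratedDeriv n φ z := by
      intro u v n
      have hn := hφ.iteratedDeriv n
      rw [← integral_add (u.integrable_mul hn.1 hn.2) (v.integrable_mul hn.1 hn.2)]
      refine integral_congr_ae ?_
      filter_upwards [(volume_ac α).ae_le (Lp.coeFn_add u v)] with z hz
      rw [hz, Pi.add_apply, add_mul]
    have h0 := h p.snd p'.snd 0
    simp only [iteratedDeriv_zero] at h0
    rw [WithLp.add_fst, WithLp.add_snd, h, h0, hp φ hφ, hp' φ hφ, mul_add]
  smul_mem' := by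
    intro s p hp φ hφ
    have h : ∀ (u : WL2 α) (ψ : ℝ → ℂ), ∫ z, (s • u) z * ψ z = s * ∫ z, u z * ψ z := by
      intro u ψ
      rw [← integral_const_mul]
      refine integral_congr_ae ?_
      filter_upwards [(volume_ac α).ae_le (Lp.coeFn_smul s u)] with z hz
      rw [hz, Pi.smul_apply, smul_eq_mul, mul_assoc]
    rw [WithLp.smul_fst, WithLp.smul_snd, h, h, hp φ hφ]
    ring

/-- The Hilbert space `H^k_α(ℝ)`. -/
abbrev WSob (α : ℝ) (k : ℕ) : Type := sobolevGraph α k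

/-- The product `H^k_α(ℝ) × H^{k-1}_α(ℝ)` (used for `k ≥ 1`). -/
abbrev XSpace (α : ℝ) (k : ℕ) : Type := WSob α k × WSob α (k - 1)

/-- The pair of `L²_α` functions underlying an element of `H^k_α × H^{k-1}_α`. -/
def XSpace.toL2 {α : ℝ} {k : ℕ} (u : XSpace α k) : WL2 α × WL2 α :=
  ((u.1 : WithLp 2 (WL2 α × WL2 α)).fst, (u.2 : WithLp 2 (WL2 α × WL2 α)).fst)

/-- The element `u` of `L²_α × L²_α` is (the class of) the real vector function `f`. -/
def Represents {α : ℝ} (u : WL2 α × WL2 α) (f : ℝ → ℝ × ℝ) : Prop :=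
  ∀ᵐ z : ℝ, u.1 z = ((f z).1 : ℂ) ∧ u.2 z = ((f z).2 : ℂ)

/-- `v` is the complex conjugate of `u`. -/
def IsConjOf {α : ℝ} (u v : WL2 α × WL2 α) : Prop :=
  ∀ᵐ z : ℝ, conj (u.1 z) = v.1 z ∧ conj (u.2 z) = v.2 z

/-! ### The linearized operator at transverse frequency `η` -/

/-- `1 + dη² - d∂_z²` acting on test functions: `A(η)` for `d = a`, and `B(η)` for `d = b`.
This operator is its own transpose. -/
def helmEta (d η : ℝ) (φ : ℝ → ℂ) (z : ℝ) : ℂ :=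
  (1 + d * η ^ 2) * φ z - d * iteratedDeriv 2 φ z

/-- `MemGraph a b c α η u w` says that `u` lies in the domain `H²_α × H¹_α` of
```
𝓛(η) = ( c∂_z                                          1    )
       ( B(η)⁻¹A(η)(∂_z² - η²)                         c∂_z ) - B(η)⁻¹ (0 0; v₁(η) v₂(η)),
v₁(η) = 2r_c'∂_z + r_c(∂_z² - η²),    v₂(η) = 2q_c∂_z + q_c',
```
and that `w = 𝓛(η)u`. Here `du₁ = ∂_z u₁`, `ddu₁ = ∂_z² u₁`, `du₂ = ∂_z u₂`, and
`g = B(η)⁻¹{A(η)(∂_z² - η²)u₁ - v₁(η)u₁ - v₂(η)u₂}` is the element of `L²_α` for which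
`B(η)g = A(η)(∂_z² - η²)u₁ - v₁(η)u₁ - v₂(η)u₂` in the sense of distributions. -/
def MemGraph (a b c α η : ℝ) (u w : WL2 α × WL2 α) : Prop :=
  ∃ du₁ ddu₁ du₂ g : WL2 α,
    WeakDeriv 1 u.1 du₁ ∧ WeakDeriv 2 u.1 ddu₁ ∧ WeakDeriv 1 u.2 du₂ ∧
    (∀ φ : ℝ → ℂ, IsTest φ →
      ∫ z, g z * helmEta b η φ z =
        (∫ z, (ddu₁ z - η ^ 2 * u.1 z) * helmEta a η φ z)
        - (∫ z, (2 * rcz a b c z * du₁ z + rc a b c z * (ddu₁ z - η ^ 2 * u.1 z)) * φ z)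
        - ∫ z, (2 * qc a b c z * du₂ z + qcz a b c z * u.2 z) * φ z) ∧
    w = ((c : ℂ) • du₁ + u.2, g + (c : ℂ) • du₂)

/-- The pairing `⟨f, g⟩ = ∑ⱼ ∫ fⱼ conj(gⱼ) dz` between `L²_α` and `L²_{-α}`. -/
def pairing {α : ℝ} (f : WL2 α × WL2 α) (g : WL2 (-α) × WL2 (-α)) : ℂ :=
  (∫ z, f.1 z * conj (g.1 z)) + ∫ z, f.2 z * conj (g.2 z)

/-- `MemAdjointGraph a b c α η v w` says that `v` lies in the domain of the adjoint `𝓛(η)*` with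
respect to the pairing, and that `w = 𝓛(η)* v`. -/
def MemAdjointGraph (a b c α η : ℝ) (v w : WL2 (-α) × WL2 (-α)) : Prop :=
  ∀ f h : WL2 α × WL2 α, MemGraph a b c α η f h → pairing h v = pairing f w

end BenneyLuke

end

/-!
Writing the eigenfunction as `(v, λv - c∂v)` eliminates the second component: `𝓛(η)ζ = λζ` becomes a
scalar fourth-order equation for `v`, the `pencil` in `λ` and `η²`. At `λ = η = 0` the pencil is
`P₀ = ∂ ((c² - 1) - (bc² - a)∂² - 3c q_c) ∂`. With `q = q_c` and `u = ∫_z^∞ ∂_c q_c`, differentiation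
of the equation of the solitary wave gives `P₀ q = 0`, and differentiation of that equation in `c`
shows that `q + λu` solves the pencil at `η = 0` up to `λ²χ + O(λ³)`, for an explicit function `χ`
(`Admissible.soliton_eq`, `Admissible.primitive_eq`).

In the weight `e^{αz}`, `0 < α < α_c`, the operator `P₀` is inverted explicitly. The second-order
operator in its middle is a Pöschl–Teller operator with homogeneous solutions `tanh θz sech² θz`
(`psi`) and `psiGrow`, so that it has an explicit Green's function, and the two outer derivatives are
inverted by integration from `+∞`. The only condition is orthogonality to `q`
(`exists_solutionOperator`); subtracting a multiple of `χ`, which is not orthogonal to `q`, gives a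
bounded right inverse on the whole space (`exists_correctionOperator`). All this takes place in a
space of continuous functions bounded by `e^{-αz - δ|z|}`, in which the bounds are pointwise.

Put `s = iη`, `λ = sμ` and `v = q + λu + s²w`. The eigenvalue problem becomes
`P₀ w = -Q₀ q - μ²χ - s R(s, μ, w)`, where `Q₀` is the coefficient of `-η²` in the pencil. With
`w = Kf` this is the system `f = -Q₀ q - s R(s, μ, Kf)`, `ℓ(f) = μ²`, with `ℓ = ⟨·, q⟩ / ⟨χ, q⟩`. At
`s = 0` it has a solution with `μ(0)² = -⟨Q₀q, q⟩ / ⟨χ, q⟩`, which is positive, and the implicit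
function theorem gives an analytic branch (`exists_analytic_branch`), real for real `s` by
uniqueness. Hence `λ₁ = μ(0)` and `λ₂ = μ'(0)`. The second is found by pairing the equation with `q`;
the unknown part of `⟨R, q⟩` is made explicit with the help of the reflection `u(-z)`, which solves the
adjoint equation (`pairQ_opP1`). Both signs then follow from integrals of powers of `sech²`
(`Admissible.hasInt_chiFun`, `Admissible.hasInt_forceFun`, `Admissible.hasInt_secondFun`,
`second_pos`), and `exists_branch` collects the result. The equation itself expresses the
fourth derivative of `w` through the lower ones, so that the branch is smooth with values in every weighted Sobolev
space (`Reg.of_equation`, `Reg.exists_lift`).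

The adjoint of the pencil is its conjugate by the reflection `z ↦ -z`. The adjoint eigenfunctions are
therefore obtained from `p(z) = c v(-z)` by the differential operators `adjFst` and `adjSnd`; that
they lie in the domain of the adjoint is verified by integration by parts against the weak
derivatives (`memAdjointGraph_of_pencil`), after extending the distributional identity in the
definition of the operator from test functions to functions in the dual weight by cutoff
(`integral_eq_zero_of_test`).
-/

open Filter Topology
open scoped BoundedContinuousFunction

noncomputable section

namespace BenneyLuke
/-! ### Exponentially weighted continuous functions -/

/-- The pointwise weight `e^{-αz - δ|z|}`. For `δ > 0` it is square integrable against
`e^{2αz} dz`. -/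
def weight (α δ z : ℝ) : ℝ := Real.exp (-(α * z) - δ * |z|)

theorem weight_pos (α δ z : ℝ) : 0 < weight α δ z := Real.exp_pos _

theorem continuous_weight (α δ : ℝ) : Continuous (weight α δ) := by
  unfold weight; fun_prop

theorem weight_neg (α δ z : ℝ) : weight (-α) δ z = weight α δ (-z) := by
  simp [weight]

/-- The function `e^{-αz - δ|z|} F(z)` represented by a bounded continuous function `F`. The space
of these functions, normed by `‖F‖`, is the Banach space in which the eigenvalue problem is
solved. -/
def ev (α δ : ℝ) (F : ℝ →ᵇ ℂ) (z : ℝ) : ℂ := weight α δ z * F z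

section ev

variable {α δ : ℝ}

theorem ev_add (F G : ℝ →ᵇ ℂ) (z : ℝ) : ev α δ (F + G) z = ev α δ F z + ev α δ G z := by
  simp [ev, mul_add]

theorem ev_sub (F G : ℝ →ᵇ ℂ) (z : ℝ) : ev α δ (F - G) z = ev α δ F z - ev α δ G z := by
  simp [ev, mul_sub]

theorem ev_neg (F : ℝ →ᵇ ℂ) (z : ℝ) : ev α δ (-F) z = -ev α δ F z := by
  simp [ev]

theorem ev_smul (r : ℂ) (F : ℝ →ᵇ ℂ) (z : ℝ) : ev α δ (r • F) z = r * ev α δ F z := by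
  simp [ev]; ring

theorem ev_mul (g F : ℝ →ᵇ ℂ) (z : ℝ) : ev α δ (g * F) z = g z * ev α δ F z := by
  simp [ev]; ring

theorem ev_star (F : ℝ →ᵇ ℂ) (z : ℝ) : ev α δ (star F) z = conj (ev α δ F z) := by
  simp [ev]

theorem continuous_ev (F : ℝ →ᵇ ℂ) : Continuous (ev α δ F) := by
  have := continuous_weight α δ
  unfold ev; fun_prop

theorem norm_ev_le (F : ℝ →ᵇ ℂ) (z : ℝ) : ‖ev α δ F z‖ ≤ ‖F‖ * weight α δ z := by
  rw [ev, norm_mul, Complex.norm_real, Real.norm_of_nonneg (weight_pos α δ z).le, mul_comm]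
  exact mul_le_mul_of_nonneg_right (F.norm_coe_le_norm z) (weight_pos α δ z).le

theorem ev_injective {F G : ℝ →ᵇ ℂ} (h : ∀ z, ev α δ F z = ev α δ G z) : F = G := by
  ext z
  have hz : (weight α δ z : ℂ) ≠ 0 := by exact_mod_cast (weight_pos α δ z).ne'
  exact mul_left_cancel₀ hz (h z)

variable (α δ) in
/-- The bounded continuous function representing a continuous function dominated by the weight. -/
def ofBound (f : ℝ → ℂ) (hf : Continuous f) (C : ℝ) (h : ∀ z, ‖f z‖ ≤ C * weight α δ z) :
    ℝ →ᵇ ℂ :=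
  BoundedContinuousFunction.ofNormedAddCommGroup (fun z => f z / weight α δ z)
    (hf.div (Complex.continuous_ofReal.comp (continuous_weight α δ))
      fun z => by exact_mod_cast (weight_pos α δ z).ne') C
    fun z => by
      rw [norm_div, Complex.norm_real, Real.norm_of_nonneg (weight_pos α δ z).le,
        div_le_iff₀ (weight_pos α δ z)]
      exact h z

theorem ev_ofBound (f : ℝ → ℂ) (hf : Continuous f) (C : ℝ) (h : ∀ z, ‖f z‖ ≤ C * weight α δ z)
    (z : ℝ) : ev α δ (ofBound α δ f hf C h) z = f z := by
  have hz : (weight α δ z : ℂ) ≠ 0 := by exact_mod_cast (weight_pos α δ z).ne'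
  simp only [ev, ofBound, BoundedContinuousFunction.coe_ofNormedAddCommGroup]
  field_simp

theorem norm_ofBound_le (f : ℝ → ℂ) (hf : Continuous f) {C : ℝ} (hC : 0 ≤ C)
    (h : ∀ z, ‖f z‖ ≤ C * weight α δ z) : ‖ofBound α δ f hf C h‖ ≤ C :=
  BoundedContinuousFunction.norm_ofNormedAddCommGroup_le _ hC _

variable (α δ) in
/-- The bounded operator with values in the weighted space given by a linear family of continuous
functions that obeys a weighted bound. -/
def clmOfBound {E : Type*} [NormedAddCommGroup E] [NormedSpace ℂ E] (Φ : E →ₗ[ℂ] (ℝ → ℂ)) (C : ℝ)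
    (hC : 0 ≤ C) (hc : ∀ x, Continuous (Φ x)) (hb : ∀ x z, ‖Φ x z‖ ≤ C * ‖x‖ * weight α δ z) :
    E →L[ℂ] (ℝ →ᵇ ℂ) :=
  LinearMap.mkContinuous
    { toFun := fun x => ofBound α δ (Φ x) (hc x) (C * ‖x‖) (hb x)
      map_add' := fun x y => ev_injective (α := α) (δ := δ) fun z => by
        simp only [ev_ofBound, ev_add, map_add, Pi.add_apply]
      map_smul' := fun r x => ev_injective (α := α) (δ := δ) fun z => by
        simp only [ev_ofBound, ev_smul, map_smul, Pi.smul_apply, smul_eq_mul, RingHom.id_apply] }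
    C fun x => norm_ofBound_le _ (hc x) (by positivity) (hb x)

theorem ev_clmOfBound {E : Type*} [NormedAddCommGroup E] [NormedSpace ℂ E] (Φ : E →ₗ[ℂ] (ℝ → ℂ))
    (C : ℝ) (hC : 0 ≤ C) (hc : ∀ x, Continuous (Φ x))
    (hb : ∀ x z, ‖Φ x z‖ ≤ C * ‖x‖ * weight α δ z) (x : E) (z : ℝ) :
    ev α δ (clmOfBound α δ Φ C hC hc hb x) z = Φ x z :=
  ev_ofBound _ (hc x) (C * ‖x‖) (hb x) z

end ev

/-- Reflection `z ↦ -z`. It exchanges the weights for `α` and `-α`. -/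
def reflect (F : ℝ →ᵇ ℂ) : ℝ →ᵇ ℂ := F.compContinuous ⟨fun z => -z, continuous_neg⟩

theorem ev_reflect (α δ : ℝ) (F : ℝ →ᵇ ℂ) (z : ℝ) : ev (-α) δ (reflect F) z = ev α δ F (-z) := by
  simp [ev, reflect, weight_neg]

/-- Reflection as a bounded operator. -/
def reflectCLM : (ℝ →ᵇ ℂ) →L[ℂ] (ℝ →ᵇ ℂ) :=
  LinearMap.mkContinuous
    { toFun := reflect
      map_add' := fun _ _ => rfl
      map_smul' := fun _ _ => rfl } 1 fun F => by
    rw [one_mul]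
    exact (BoundedContinuousFunction.norm_le (norm_nonneg F)).2 fun z => F.norm_coe_le_norm _

theorem reflect_star (F : ℝ →ᵇ ℂ) : reflect (star F) = star (reflect F) := rfl

/-! ### Embedding into the weighted Lebesgue spaces -/

theorem integrable_exp_neg_abs {δ : ℝ} (hδ : 0 < δ) : Integrable fun z : ℝ => Real.exp (-δ * |z|) := by
  rw [← integrableOn_univ, ← Iic_union_Ioi (a := (0 : ℝ))]
  refine IntegrableOn.union ?_ ?_
  · refine (integrableOn_exp_mul_Iic hδ 0).congr_fun (fun z hz => ?_) measurableSet_Iic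
    simp only [abs_of_nonpos (mem_Iic.1 hz)]; ring_nf
  · refine (integrableOn_exp_mul_Ioi (neg_lt_zero.2 hδ) 0).congr_fun (fun z hz => ?_)
      measurableSet_Ioi
    simp only [abs_of_pos (mem_Ioi.1 hz)]

theorem memLp_weight (α : ℝ) {δ : ℝ} (hδ : 0 < δ) :
    MemLp (fun z => (weight α δ z : ℂ)) 2 (wMeasure α) := by
  have hc : Continuous fun z => (weight α δ z : ℂ) :=
    Complex.continuous_ofReal.comp (continuous_weight α δ)
  rw [memLp_two_iff_integrable_sq_norm hc.aestronglyMeasurable, wMeasure,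
    integrable_withDensity_iff_integrable_smul' (by fun_prop) (by simp)]
  refine (integrable_exp_neg_abs (by positivity : 0 < 2 * δ)).congr (Eventually.of_forall fun z => ?_)
  simp only [ENNReal.toReal_ofReal (Real.exp_pos _).le, smul_eq_mul, Complex.norm_real,
    Real.norm_eq_abs, sq_abs, weight, ← Real.exp_nat_mul, ← Real.exp_add]
  congr 1; push_cast; ring

theorem memLp_ev (α : ℝ) {δ : ℝ} (hδ : 0 < δ) (F : ℝ →ᵇ ℂ) :
    MemLp (ev α δ F) 2 (wMeasure α) :=
  (memLp_weight α hδ).of_le_mul (continuous_ev F).aestronglyMeasurable (c := ‖F‖)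
    (Eventually.of_forall fun z => by
      rw [Complex.norm_real, Real.norm_of_nonneg (weight_pos α δ z).le]; exact norm_ev_le F z)

/-- The weighted space embeds into `L²_α`. -/
def toWL2 (α : ℝ) {δ : ℝ} (hδ : 0 < δ) : (ℝ →ᵇ ℂ) →L[ℂ] WL2 α :=
  LinearMap.mkContinuous
    { toFun := fun F => (memLp_ev α hδ F).toLp
      map_add' := fun F G => by
        rw [← MemLp.toLp_add]; congr 1; funext z; exact ev_add F G z
      map_smul' := fun r F => by
        rw [RingHom.id_apply, ← MemLp.toLp_const_smul]; congr 1; funext z; exact ev_smul r F z }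
    ‖(memLp_weight α hδ).toLp‖ fun F => by
      rw [mul_comm]
      refine Lp.norm_le_mul_norm_of_ae_le_mul ?_
      filter_upwards [(memLp_ev α hδ F).coeFn_toLp, (memLp_weight α hδ).coeFn_toLp] with z h1 h2
      simp only [LinearMap.coe_mk, AddHom.coe_mk]
      rw [h1, h2, Complex.norm_real, Real.norm_of_nonneg (weight_pos α δ z).le]
      exact norm_ev_le F z

theorem coeFn_toWL2 (α : ℝ) {δ : ℝ} (hδ : 0 < δ) (F : ℝ →ᵇ ℂ) :
    (toWL2 α hδ F : ℝ → ℂ) =ᵐ[volume] ev α δ F :=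
  (volume_ac α).ae_le (memLp_ev α hδ F).coeFn_toLp

/-- Elements of `L²_α` may be paired with functions that are small in the dual weight. -/
theorem WL2.integrable_mul_ev {α δ : ℝ} (hδ : 0 < δ) (u : WL2 α) (F : ℝ →ᵇ ℂ) :
    Integrable fun z => u z * ev (-α) δ F z := by
  have h1 : MemLp (fun z => ev (-α) δ F z * (Real.exp (-(2 * α * z)) : ℂ)) 2 (wMeasure α) := by
    refine (memLp_weight α hδ).of_le_mul (c := ‖F‖) ?_ (Eventually.of_forall fun z => ?_)
    · have := continuous_ev (α := -α) (δ := δ) F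
      exact Continuous.aestronglyMeasurable (by fun_prop)
    · rw [Complex.norm_real, Real.norm_of_nonneg (weight_pos α δ z).le, norm_mul]
      refine (mul_le_mul_of_nonneg_right (norm_ev_le F z) (norm_nonneg _)).trans_eq ?_
      rw [Complex.norm_real, Real.norm_of_nonneg (Real.exp_pos _).le, mul_assoc, weight, weight,
        ← Real.exp_add]
      congr 2; ring
  have h2 := MemLp.integrable_mul (Lp.memLp u) h1
  have h3 := (integrable_withDensity_iff_integrable_smul₀' (by fun_prop) (by simp)).1 h2
  refine h3.congr (Eventually.of_forall fun z => ?_)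
  simp only [ENNReal.toReal_ofReal (Real.exp_pos _).le, Complex.real_smul, Real.exp_neg,
    Pi.mul_apply]
  have : (Real.exp (2 * α * z) : ℂ) ≠ 0 := by exact_mod_cast (Real.exp_pos _).ne'
  push_cast at this ⊢
  field_simp

theorem norm_ev_mul_ev_le {α δ : ℝ} (F G : ℝ →ᵇ ℂ) (z : ℝ) :
    ‖ev α δ F z * ev (-α) δ G z‖ ≤ ‖F‖ * ‖G‖ * Real.exp (-(2 * δ) * |z|) := by
  rw [norm_mul]
  refine (mul_le_mul (norm_ev_le F z) (norm_ev_le G z) (norm_nonneg _)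
    (mul_nonneg (norm_nonneg _) (weight_pos _ _ _).le)).trans_eq ?_
  have : weight α δ z * weight (-α) δ z = Real.exp (-(2 * δ) * |z|) := by
    rw [weight, weight, ← Real.exp_add]; congr 1; ring
  rw [← this]; ring

theorem integrable_ev_mul_ev {α δ : ℝ} (hδ : 0 < δ) (F G : ℝ →ᵇ ℂ) :
    Integrable fun z => ev α δ F z * ev (-α) δ G z := by
  refine ((integrable_exp_neg_abs (by positivity : 0 < 2 * δ)).const_mul (‖F‖ * ‖G‖)).mono'
    ((continuous_ev F).mul (continuous_ev G)).aestronglyMeasurable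
    (Eventually.of_forall fun z => norm_ev_mul_ev_le F G z)

/-- The bilinear pairing of the weighted space with its dual counterpart. -/
def dualPair (α : ℝ) {δ : ℝ} (hδ : 0 < δ) (G : ℝ →ᵇ ℂ) : (ℝ →ᵇ ℂ) →L[ℂ] ℂ :=
  LinearMap.mkContinuous
    { toFun := fun F => ∫ z, ev α δ F z * ev (-α) δ G z
      map_add' := fun F F' => by
        rw [← integral_add (integrable_ev_mul_ev hδ F G) (integrable_ev_mul_ev hδ F' G)]
        simp only [ev_add, add_mul]
      map_smul' := fun r F => by
        rw [RingHom.id_apply, smul_eq_mul, ← integral_const_mul]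
        simp only [ev_smul, mul_assoc] }
    (‖G‖ * ∫ z, Real.exp (-(2 * δ) * |z|)) fun F => by
      refine (norm_integral_le_of_norm_le ((integrable_exp_neg_abs (by positivity :
        0 < 2 * δ)).const_mul (‖F‖ * ‖G‖)) (Eventually.of_forall fun z =>
          norm_ev_mul_ev_le F G z)).trans_eq ?_
      rw [integral_const_mul]; ring

theorem dualPair_apply (α : ℝ) {δ : ℝ} (hδ : 0 < δ) (F G : ℝ →ᵇ ℂ) :
    dualPair α hδ G F = ∫ z, ev α δ F z * ev (-α) δ G z := rfl

theorem dualPair_star (α : ℝ) {δ : ℝ} (hδ : 0 < δ) (F G : ℝ →ᵇ ℂ) (hG : star G = G) :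
    dualPair α hδ G (star F) = conj (dualPair α hδ G F) := by
  rw [dualPair_apply, dualPair_apply, ← integral_conj]
  congr 1; funext z
  rw [map_mul, ← ev_star, ← ev_star, hG]

/-- Integration by parts; the boundary terms vanish because the weights are dual. -/
theorem dualPair_deriv (α : ℝ) {δ : ℝ} (hδ : 0 < δ) {F F' G G' : ℝ →ᵇ ℂ}
    (hF : ∀ z, HasDerivAt (ev α δ F) (ev α δ F' z) z)
    (hG : ∀ z, HasDerivAt (ev (-α) δ G) (ev (-α) δ G' z) z) :
    dualPair α hδ G F' = -dualPair α hδ G' F := by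
  rw [dualPair_apply, dualPair_apply, eq_neg_iff_add_eq_zero, add_comm, ← eq_neg_iff_add_eq_zero]
  exact integral_mul_deriv_eq_deriv_mul_of_integrable (fun z _ => hF z) (fun z _ => hG z)
    (integrable_ev_mul_ev hδ F G') (integrable_ev_mul_ev hδ F' G) (integrable_ev_mul_ev hδ F G)

/-! ### Smooth families of smooth functions -/

/-- `Reg α δ I m U` says that `U` is a family of elements of the weighted space, smooth in the
parameter `η ∈ I`, whose first `m` derivatives in `z` are families of the same kind. -/
def Reg (α δ : ℝ) (I : Set ℝ) : ℕ → (ℝ → ℝ →ᵇ ℂ) → Prop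
  | 0, U => ContDiffOn ℝ ∞ U I
  | m + 1, U => ContDiffOn ℝ ∞ U I ∧ ∃ V : ℝ → ℝ →ᵇ ℂ,
      (∀ η ∈ I, ∀ z, HasDerivAt (ev α δ (U η)) (ev α δ (V η) z) z) ∧ Reg α δ I m V

namespace Reg

variable {α δ : ℝ} {I : Set ℝ} {m : ℕ} {U V : ℝ → ℝ →ᵇ ℂ}

theorem contDiffOn (h : Reg α δ I m U) : ContDiffOn ℝ ∞ U I := by
  cases m with
  | zero => exact h
  | succ m => exact h.1

theorem of_succ (h : Reg α δ I (m + 1) U) : Reg α δ I m U := by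
  induction m generalizing U with
  | zero => exact h.contDiffOn
  | succ m ih =>
    obtain ⟨V, hV, hr⟩ := h.2
    exact ⟨h.1, V, hV, ih hr⟩

theorem congr (h : Reg α δ I m U) (hUV : ∀ η ∈ I, V η = U η) : Reg α δ I m V := by
  cases m with
  | zero => exact ContDiffOn.congr h hUV
  | succ m =>
    obtain ⟨W, hW, hr⟩ := h.2
    exact ⟨h.1.congr hUV, W, fun η hη => by rw [hUV η hη]; exact hW η hη, hr⟩

theorem succ (hU : ContDiffOn ℝ ∞ U I)
    (hUV : ∀ η ∈ I, ∀ z, HasDerivAt (ev α δ (U η)) (ev α δ (V η) z) z) (hV : Reg α δ I m V) :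
    Reg α δ I (m + 1) U :=
  ⟨hU, V, hUV, hV⟩

theorem add (hU : Reg α δ I m U) (hV : Reg α δ I m V) : Reg α δ I m fun η => U η + V η := by
  induction m generalizing U V with
  | zero => exact ContDiffOn.add hU hV
  | succ m ih =>
    obtain ⟨U', hU', hrU⟩ := hU.2
    obtain ⟨V', hV', hrV⟩ := hV.2
    refine succ (hU.1.add hV.1) (fun η hη z => ?_) (ih hrU hrV)
    simp only [ev_add, funext (ev_add (α := α) (δ := δ) (U η) (V η))]
    exact (hU' η hη z).add (hV' η hη z)

theorem smul {r : ℝ → ℂ} (hr : ContDiffOn ℝ ∞ r I) (hU : Reg α δ I m U) :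
    Reg α δ I m fun η => r η • U η := by
  induction m generalizing U with
  | zero => exact ContDiffOn.smul hr hU
  | succ m ih =>
    obtain ⟨U', hU', hrU⟩ := hU.2
    refine succ (hr.smul hU.1) (fun η hη z => ?_) (ih hrU)
    simp only [ev_smul, funext (ev_smul (α := α) (δ := δ) (r η) (U η))]
    exact (hU' η hη z).const_mul _

theorem const_smul (r : ℂ) (hU : Reg α δ I m U) : Reg α δ I m fun η => r • U η :=
  smul contDiffOn_const hU

theorem neg (hU : Reg α δ I m U) : Reg α δ I m fun η => -U η :=
  (const_smul (-1) hU).congr fun η _ => by simp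

theorem sub (hU : Reg α δ I m U) (hV : Reg α δ I m V) : Reg α δ I m fun η => U η - V η := by
  simpa only [sub_eq_add_neg] using hU.add hV.neg

theorem comp_neg (hI : ∀ η ∈ I, -η ∈ I) (hU : Reg α δ I m U) : Reg α δ I m fun η => U (-η) := by
  induction m generalizing U with
  | zero => exact ContDiffOn.comp hU contDiffOn_id.neg hI
  | succ m ih =>
    obtain ⟨U', hU', hrU⟩ := hU.2
    exact succ (ContDiffOn.comp hU.1 contDiffOn_id.neg hI) (fun η hη => hU' (-η) (hI η hη))
      (ih hrU)

theorem reflect (hU : Reg α δ I m U) : Reg (-α) δ I m fun η => reflect (U η) := by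
  induction m generalizing U with
  | zero => exact (reflectCLM.restrictScalars ℝ).contDiff.comp_contDiffOn hU
  | succ m ih =>
    obtain ⟨U', hU', hrU⟩ := hU.2
    refine succ ((reflectCLM.restrictScalars ℝ).contDiff.comp_contDiffOn hU.1) (fun η hη z => ?_)
      (ih hrU).neg
    rw [ev_neg, ev_reflect, funext (ev_reflect α δ (U η))]
    simpa [Function.comp_def] using (hU' η hη (-z)).scomp z (hasDerivAt_neg z)

theorem contDiff_ev (hU : Reg α δ I m U) {η : ℝ} (hη : η ∈ I) :
    ContDiff ℝ m (ev α δ (U η)) := by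
  induction m generalizing U with
  | zero => exact contDiff_zero.2 (continuous_ev _)
  | succ m ih =>
    obtain ⟨V, hV, hr⟩ := hU.2
    push_cast
    rw [contDiff_succ_iff_deriv]
    refine ⟨fun z => (hV η hη z).differentiableAt, by simp, ?_⟩
    rw [funext fun z => (hV η hη z).deriv]
    exact ih hr

end Reg

/-! ### Weak derivatives and Sobolev lifts -/

theorem IsTest.deriv {φ : ℝ → ℂ} (h : IsTest φ) : IsTest (deriv φ) :=
  ⟨((contDiff_infty_iff_deriv).1 h.1).2, h.2.deriv⟩

theorem IsTest.isTest_iteratedDeriv {φ : ℝ → ℂ} (h : IsTest φ) (n : ℕ) :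
    IsTest (_root_.iteratedDeriv n φ) := by
  induction n with
  | zero => simpa using h
  | succ n ih => rw [iteratedDeriv_succ]; exact ih.deriv

/-- Integration by parts against a compactly supported function. -/
theorem integral_mul_deriv_of_hasCompactSupport {f f' φ φ' : ℝ → ℂ} (hf : ∀ z, HasDerivAt f (f' z) z)
    (hf' : Continuous f') (hφ : ∀ z, HasDerivAt φ (φ' z) z) (hφ' : Continuous φ')
    (hs : HasCompactSupport φ) : ∫ z, f z * φ' z = -∫ z, f' z * φ z := by
  have hfc : Continuous f := continuous_iff_continuousAt.2 fun z => (hf z).continuousAt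
  have hφc : Continuous φ := continuous_iff_continuousAt.2 fun z => (hφ z).continuousAt
  have hs' : HasCompactSupport φ' := by
    have := hs.deriv
    rwa [funext fun z => (hφ z).deriv] at this
  exact integral_mul_deriv_eq_deriv_mul_of_integrable (fun z _ => hf z) (fun z _ => hφ z)
    ((hfc.mul hφ').integrable_of_hasCompactSupport hs'.mul_left)
    ((hf'.mul hφc).integrable_of_hasCompactSupport hs.mul_left)
    ((hfc.mul hφc).integrable_of_hasCompactSupport hs.mul_left)

theorem weakDeriv_congr {n : ℕ} {u u' w w' : ℝ → ℂ} (hu : u =ᵐ[volume] u') (hw : w =ᵐ[volume] w')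
    (h : WeakDeriv n u' w') : WeakDeriv n u w := by
  intro φ hφ
  have h1 : ∫ z, u z * iteratedDeriv n φ z = ∫ z, u' z * iteratedDeriv n φ z :=
    integral_congr_ae (by filter_upwards [hu] with z hz; rw [hz])
  have h2 : ∫ z, w z * φ z = ∫ z, w' z * φ z :=
    integral_congr_ae (by filter_upwards [hw] with z hz; rw [hz])
  rw [h1, h2, h φ hφ]

theorem weakDeriv_zero (u : ℝ → ℂ) : WeakDeriv 0 u u := by
  intro φ _; simp

/-- A classical derivative may be peeled off a weak derivative. -/
theorem WeakDeriv.of_hasDerivAt {n : ℕ} {f f' w : ℝ → ℂ} (hf : ∀ z, HasDerivAt f (f' z) z)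
    (hf' : Continuous f') (h : WeakDeriv n f' w) : WeakDeriv (n + 1) f w := by
  intro φ hφ
  have hd : ∀ z, HasDerivAt (iteratedDeriv n φ) (iteratedDeriv (n + 1) φ z) z := fun z => by
    rw [iteratedDeriv_succ]
    exact ((hφ.isTest_iteratedDeriv n).1.differentiable (by simp) z).hasDerivAt
  rw [integral_mul_deriv_of_hasCompactSupport hf hf' hd (hφ.iteratedDeriv (n + 1)).1
    (hφ.iteratedDeriv n).2, h φ hφ]
  ring

theorem Reg.exists_weakDeriv {α δ : ℝ} {I : Set ℝ} {m : ℕ} {U : ℝ → ℝ →ᵇ ℂ} (h : Reg α δ I m U) :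
    ∃ V : ℝ → ℝ →ᵇ ℂ, ContDiffOn ℝ ∞ V I ∧
      ∀ η ∈ I, WeakDeriv m (ev α δ (U η)) (ev α δ (V η)) := by
  induction m generalizing U with
  | zero => exact ⟨U, h, fun η _ => weakDeriv_zero _⟩
  | succ m ih =>
    obtain ⟨U', hU', hr⟩ := h.2
    obtain ⟨V, hV, hw⟩ := ih hr
    exact ⟨V, hV, fun η hη => (hw η hη).of_hasDerivAt (hU' η hη) (continuous_ev _)⟩

theorem integral_wMeasure (α : ℝ) (f : ℝ → ℂ) :
    ∫ z, f z ∂(wMeasure α) = ∫ z, (Real.exp (2 * α * z) : ℂ) * f z := by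
  refine (integral_withDensity_eq_integral_toReal_smul (by fun_prop) (by simp) f).trans ?_
  simp only [ENNReal.toReal_ofReal (Real.exp_pos _).le, Complex.real_smul]

theorem WL2.continuous_integral_mul (α : ℝ) {φ : ℝ → ℂ} (hc : Continuous φ)
    (hs : HasCompactSupport φ) : Continuous fun u : WL2 α => ∫ z, u z * φ z := by
  have h1 : MemLp (fun z => conj (φ z * (Real.exp (-(2 * α * z)) : ℂ))) 2 (wMeasure α) :=
    Continuous.memLp_of_hasCompactSupport (by fun_prop) (hs.mul_right.comp_left (map_zero _))
  have h2 : (fun u : WL2 α => ∫ z, u z * φ z) = fun u => inner ℂ h1.toLp u := by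
    funext u
    rw [L2.inner_def, integral_wMeasure]
    refine integral_congr_ae ?_
    filter_upwards [(volume_ac α).ae_le h1.coeFn_toLp] with z hz
    have : (Real.exp (2 * α * z) : ℂ) ≠ 0 := by exact_mod_cast (Real.exp_pos _).ne'
    rw [hz]
    simp only [Real.exp_neg, RCLike.inner_apply, Complex.conj_conj]
    push_cast at this ⊢
    field_simp
  rw [h2]
  exact continuous_const.inner continuous_id

theorem isClosed_sobolevGraph (α : ℝ) (k : ℕ) :
    IsClosed (sobolevGraph α k : Set (WithLp 2 (WL2 α × WL2 α))) := by
  have : (sobolevGraph α k : Set (WithLp 2 (WL2 α × WL2 α))) =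
      ⋂ (φ : ℝ → ℂ) (_ : IsTest φ), {p | ∫ z, p.fst z * iteratedDeriv k φ z =
        (-1) ^ k * ∫ z, p.snd z * φ z} := by
    ext p; simp only [mem_iInter, mem_ofPred_eq]; rfl
  rw [this]
  refine isClosed_iInter fun φ => isClosed_iInter fun hφ => isClosed_eq ?_ ?_
  · exact (WL2.continuous_integral_mul α (hφ.iteratedDeriv k).1 (hφ.iteratedDeriv k).2).comp
      (continuous_fst.comp (WithLp.prodContinuousLinearEquiv 2 ℂ _ _).continuous)
  · exact continuous_const.mul ((WL2.continuous_integral_mul α hφ.1.continuous hφ.2).comp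
      (continuous_snd.comp (WithLp.prodContinuousLinearEquiv 2 ℂ _ _).continuous))

/-- A smooth family of functions with `k` derivatives defines a smooth map into `H^k_α`. The graph
of the weak derivative is a closed subspace of a Hilbert space, so that smoothness in the ambient
space passes to the graph through the orthogonal projection. -/
theorem Reg.exists_lift {α δ : ℝ} (hδ : 0 < δ) {I : Set ℝ} {k : ℕ} {U : ℝ → ℝ →ᵇ ℂ}
    (h : Reg α δ I k U) :
    ∃ Z : ℝ → WSob α k, ContDiffOn ℝ ∞ Z I ∧
      ∀ η ∈ I, (Z η : WithLp 2 (WL2 α × WL2 α)).fst = toWL2 α hδ (U η) := by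
  obtain ⟨V, hV, hw⟩ := h.exists_weakDeriv
  have : CompleteSpace (sobolevGraph α k) := (isClosed_sobolevGraph α k).completeSpace_coe
  let p : ℝ → WithLp 2 (WL2 α × WL2 α) := fun η =>
    (WithLp.prodContinuousLinearEquiv 2 ℂ (WL2 α) (WL2 α)).symm
      (toWL2 α hδ (U η), toWL2 α hδ (V η))
  have hp : ContDiffOn ℝ ∞ p I := by
    refine ((WithLp.prodContinuousLinearEquiv 2 ℂ (WL2 α) (WL2 α)).symm.toContinuousLinearMap.restrictScalars
      ℝ).contDiff.comp_contDiffOn ?_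
    exact (((toWL2 α hδ).restrictScalars ℝ).contDiff.comp_contDiffOn h.contDiffOn).prodMk
      (((toWL2 α hδ).restrictScalars ℝ).contDiff.comp_contDiffOn hV)
  have hmem : ∀ η ∈ I, p η ∈ sobolevGraph α k := fun η hη =>
    weakDeriv_congr (coeFn_toWL2 α hδ (U η)) (coeFn_toWL2 α hδ (V η)) (hw η hη)
  refine ⟨fun η => (sobolevGraph α k).orthogonalProjectionOnto (p η),
    ((sobolevGraph α k).orthogonalProjectionOnto.restrictScalars ℝ).contDiff.comp_contDiffOn hp,
    fun η hη => ?_⟩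
  have := Submodule.orthogonalProjectionOnto_mem_subspace_eq_self (⟨p η, hmem η hη⟩ : sobolevGraph α k)
  beta_reduce
  rw [show p η = ((⟨p η, hmem η hη⟩ : sobolevGraph α k) : WithLp 2 (WL2 α × WL2 α)) from rfl, this]
  rfl

/-! ### Soliton profiles -/

open Polynomial

theorem hasDerivAt_tanh_mul (θ z : ℝ) :
    HasDerivAt (fun x => Real.tanh (θ * x)) (θ * (1 - Real.tanh (θ * z) ^ 2)) z := by
  have h1 : HasDerivAt (fun x : ℝ => θ * x) θ z := by simpa using (hasDerivAt_id z).const_mul θ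
  have hc : Real.cosh (θ * z) ≠ 0 := (Real.cosh_pos _).ne'
  have h2 := h1.sinh.div h1.cosh hc
  have h3 : (fun x => Real.tanh (θ * x)) = (fun x => Real.sinh (θ * x)) / fun x => Real.cosh (θ * x) := by
    funext x; simp [Real.tanh_eq_sinh_div_cosh]
  rw [h3]
  convert! h2 using 1
  rw [Real.tanh_eq_sinh_div_cosh]
  field_simp

theorem one_sub_tanh_sq (y : ℝ) : 1 - Real.tanh y ^ 2 = 1 / Real.cosh y ^ 2 := by
  have hc : Real.cosh y ≠ 0 := (Real.cosh_pos _).ne'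
  rw [Real.tanh_eq_sinh_div_cosh]
  field_simp
  rw [Real.cosh_sq]; ring

theorem one_sub_tanh (y : ℝ) : 1 - Real.tanh y = 2 / (1 + Real.exp (2 * y)) := by
  rw [Real.tanh_eq, Real.exp_neg, two_mul, Real.exp_add]
  have := Real.exp_pos y
  field_simp; ring

/-- `1 - tanh y` decays at `+∞` and stays bounded at `-∞`. -/
theorem one_sub_tanh_le (y : ℝ) : 1 - Real.tanh y ≤ 2 * Real.exp (-(y + |y|)) := by
  rw [one_sub_tanh, div_le_iff₀ (by positivity), mul_assoc]
  have h : 1 ≤ Real.exp (-(y + |y|)) * (1 + Real.exp (2 * y)) := by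
    rw [mul_add, mul_one, ← Real.exp_add]
    rcases le_total 0 y with hy | hy
    · rw [abs_of_nonneg hy, show -(y + y) + 2 * y = 0 by ring, Real.exp_zero]
      linarith [Real.exp_pos (-(y + y))]
    · rw [abs_of_nonpos hy]; simp; positivity
  linarith

theorem one_sub_tanh_sq_le (y : ℝ) : 1 - Real.tanh y ^ 2 ≤ 4 * Real.exp (-(2 * |y|)) := by
  rw [one_sub_tanh_sq, div_le_iff₀ (by positivity)]
  have h : Real.exp |y| ≤ 2 * Real.cosh y := by
    rw [← Real.cosh_abs, Real.cosh_eq]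
    linarith [Real.exp_pos (-|y|)]
  calc (1 : ℝ) = Real.exp (-(2 * |y|)) * Real.exp |y| ^ 2 := by
        rw [← Real.exp_nat_mul, ← Real.exp_add]; simp
    _ ≤ Real.exp (-(2 * |y|)) * (2 * Real.cosh y) ^ 2 := by gcongr
    _ = 4 * Real.exp (-(2 * |y|)) * Real.cosh y ^ 2 := by ring

theorem one_sub_tanh_sq_pos (y : ℝ) : 0 < 1 - Real.tanh y ^ 2 := by
  rw [one_sub_tanh_sq]; positivity

theorem exists_bound_eval_tanh (p : ℝ[X]) : ∃ C, 0 ≤ C ∧ ∀ y, |p.eval (Real.tanh y)| ≤ C := by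
  obtain ⟨C, hC⟩ := (isCompact_Icc (a := (-1 : ℝ)) (b := 1)).exists_bound_of_continuousOn
    p.continuous.continuousOn
  refine ⟨C, ?_, fun y => hC _ ⟨(Real.neg_one_lt_tanh y).le, (Real.tanh_lt_one y).le⟩⟩
  exact (norm_nonneg _).trans (hC 0 (by norm_num))

theorem mul_exp_neg_le {ε : ℝ} (hε : 0 < ε) (x : ℝ) : x ≤ 1 / ε * Real.exp (ε * x) := by
  rw [one_div, inv_mul_eq_div, le_div_iff₀ hε, mul_comm]
  linarith [Real.add_one_le_exp (ε * x)]

/-- The function `(1 - T) p(T) + z (1 - T²) r(T)` with `T = tanh θz`, for `P = (p, r)`. The solitary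
wave, its `c`-derivative and the primitive of the latter are of this form, and the class is stable
under differentiation. -/
def profile (θ : ℝ) (P : ℝ[X] × ℝ[X]) (z : ℝ) : ℝ :=
  (1 - Real.tanh (θ * z)) * P.1.eval (Real.tanh (θ * z)) +
    z * (1 - Real.tanh (θ * z) ^ 2) * P.2.eval (Real.tanh (θ * z))

/-- Differentiation of profiles. -/
def profileDeriv (θ : ℝ) (P : ℝ[X] × ℝ[X]) : ℝ[X] × ℝ[X] :=
  ((1 + X) * (C θ * (-P.1 + (1 - X) * derivative P.1) + P.2),
    C θ * (-2 * X * P.2 + (1 - X ^ 2) * derivative P.2))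

theorem hasDerivAt_profile (θ : ℝ) (P : ℝ[X] × ℝ[X]) (z : ℝ) :
    HasDerivAt (profile θ P) (profile θ (profileDeriv θ P) z) z := by
  have hT := hasDerivAt_tanh_mul θ z
  have h1 := (P.1.hasDerivAt (Real.tanh (θ * z))).comp z hT
  have h2 := (P.2.hasDerivAt (Real.tanh (θ * z))).comp z hT
  have h3 := ((hT.const_sub 1).mul h1).add
    (((hasDerivAt_id z).mul ((hT.pow 2).const_sub 1)).mul h2)
  convert! h3 using 1
  simp only [profile, profileDeriv, eval_add, eval_mul, eval_sub, eval_neg, eval_one, eval_X, eval_C,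
    eval_pow, Function.comp_apply, id, Pi.mul_apply, Pi.pow_apply, eval_ofNat]
  push_cast
  ring

theorem continuous_profile (θ : ℝ) (P : ℝ[X] × ℝ[X]) : Continuous (profile θ P) :=
  continuous_iff_continuousAt.2 fun z => (hasDerivAt_profile θ P z).continuousAt

/-- The standing conditions on the weights: `δ` is small compared with `α > 0` and with the gap
between `α` and the decay rate `2θ` of the solitary wave. -/
structure WeightCond (θ α δ : ℝ) : Prop where
  pos : 0 < δ
  lt : δ < α
  add_lt : α + δ < 2 * θ

namespace WeightCond

variable {θ α δ : ℝ}

theorem theta_pos (h : WeightCond θ α δ) : 0 < θ := by linarith [h.pos, h.lt, h.add_lt]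

theorem exp_le_weight (h : WeightCond θ α δ) {γ : ℝ} (hγ : α + δ ≤ γ) (z : ℝ) :
    Real.exp (-(γ * |z|)) ≤ weight α δ z := by
  refine Real.exp_le_exp.2 ?_
  have := h.pos; have := h.lt
  nlinarith [le_abs_self z, abs_nonneg z]

theorem exp_le_weight' (h : WeightCond θ α δ) (z : ℝ) :
    Real.exp (-(θ * z + |θ * z|)) ≤ weight α δ z := by
  refine Real.exp_le_exp.2 ?_
  have := h.pos; have := h.lt; have := h.add_lt; have hθ := h.theta_pos
  rcases le_total 0 z with hz | hz
  · rw [abs_of_nonneg hz, abs_of_nonneg (by positivity)]; nlinarith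
  · rw [abs_of_nonpos hz, abs_of_nonpos (mul_nonpos_of_nonneg_of_nonpos hθ.le hz)]; nlinarith

theorem exists_profile_bound (h : WeightCond θ α δ) (P : ℝ[X] × ℝ[X]) :
    ∃ C, 0 ≤ C ∧ ∀ z, |profile θ P z| ≤ C * weight α δ z := by
  obtain ⟨C₁, hC₁, h1⟩ := exists_bound_eval_tanh P.1
  obtain ⟨C₂, hC₂, h2⟩ := exists_bound_eval_tanh P.2
  have hε : 0 < 2 * θ - (α + δ) := by linarith [h.add_lt]
  refine ⟨2 * C₁ + 1 / (2 * θ - (α + δ)) * 4 * C₂, by positivity, fun z => ?_⟩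
  have ha : |(1 - Real.tanh (θ * z)) * P.1.eval (Real.tanh (θ * z))| ≤
      2 * weight α δ z * C₁ := by
    rw [abs_mul, abs_of_pos (by linarith [Real.tanh_lt_one (θ * z)])]
    refine mul_le_mul ((one_sub_tanh_le _).trans ?_) (h1 _) (abs_nonneg _)
      (by have := weight_pos α δ z; positivity)
    linarith [h.exp_le_weight' z]
  have hb : |z * (1 - Real.tanh (θ * z) ^ 2) * P.2.eval (Real.tanh (θ * z))| ≤
      1 / (2 * θ - (α + δ)) * 4 * weight α δ z * C₂ := by
    rw [abs_mul]
    refine mul_le_mul ?_ (h2 _) (abs_nonneg _) (by have := weight_pos α δ z; positivity)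
    rw [abs_mul, abs_of_pos (one_sub_tanh_sq_pos _)]
    calc |z| * (1 - Real.tanh (θ * z) ^ 2)
        ≤ (1 / (2 * θ - (α + δ)) * Real.exp ((2 * θ - (α + δ)) * |z|)) *
          (4 * Real.exp (-(2 * |θ * z|))) :=
          mul_le_mul (mul_exp_neg_le hε _) (one_sub_tanh_sq_le _) (one_sub_tanh_sq_pos _).le
            (by positivity)
      _ = 1 / (2 * θ - (α + δ)) * 4 * Real.exp (-((α + δ) * |z|)) := by
          rw [abs_mul, abs_of_pos h.theta_pos, show -((α + δ) * |z|) = (2 * θ - (α + δ)) * |z| +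
            -(2 * (θ * |z|)) by ring, Real.exp_add]
          ring
      _ ≤ _ := by gcongr; exact h.exp_le_weight le_rfl z
  calc |profile θ P z| ≤ _ := abs_add_le _ _
    _ ≤ 2 * weight α δ z * C₁ + 1 / (2 * θ - (α + δ)) * 4 * weight α δ z * C₂ := add_le_add ha hb
    _ = _ := by ring

/-- A profile as an element of the weighted space. -/
def elem (h : WeightCond θ α δ) (P : ℝ[X] × ℝ[X]) : ℝ →ᵇ ℂ :=
  ofBound α δ (fun z => (profile θ P z : ℂ))
    (Complex.continuous_ofReal.comp (continuous_profile θ P)) (h.exists_profile_bound P).choose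
    fun z => by
      rw [Complex.norm_real]
      exact (h.exists_profile_bound P).choose_spec.2 z

theorem ev_elem (h : WeightCond θ α δ) (P : ℝ[X] × ℝ[X]) (z : ℝ) :
    ev α δ (h.elem P) z = profile θ P z :=
  ev_ofBound _ _ _ _ z

theorem star_elem (h : WeightCond θ α δ) (P : ℝ[X] × ℝ[X]) : star (h.elem P) = h.elem P :=
  ev_injective (α := α) (δ := δ) fun z => by rw [ev_star, ev_elem, Complex.conj_ofReal]

theorem hasDerivAt_elem (h : WeightCond θ α δ) (P : ℝ[X] × ℝ[X]) (z : ℝ) :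
    HasDerivAt (ev α δ (h.elem P)) (ev α δ (h.elem (profileDeriv θ P)) z) z := by
  rw [ev_elem, funext (h.ev_elem P)]
  exact (hasDerivAt_profile θ P z).ofReal_comp

theorem reg_elem (h : WeightCond θ α δ) (I : Set ℝ) (m : ℕ) (P : ℝ[X] × ℝ[X]) :
    Reg α δ I m fun _ => h.elem P := by
  induction m generalizing P with
  | zero => exact contDiffOn_const
  | succ m ih => exact Reg.succ contDiffOn_const (fun _ _ => h.hasDerivAt_elem P) (ih _)

end WeightCond

/-- The bounded function `p(tanh θz)`. -/
def tanhPoly (θ : ℝ) (p : ℝ[X]) : ℝ →ᵇ ℂ :=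
  BoundedContinuousFunction.ofNormedAddCommGroup (fun z => ((p.eval (Real.tanh (θ * z)) : ℝ) : ℂ))
    (Complex.continuous_ofReal.comp (p.continuous.comp
      (continuous_iff_continuousAt.2 fun z => (hasDerivAt_tanh_mul θ z).continuousAt)))
    (exists_bound_eval_tanh p).choose fun z => by
      rw [Complex.norm_real]; exact (exists_bound_eval_tanh p).choose_spec.2 _

theorem tanhPoly_apply (θ : ℝ) (p : ℝ[X]) (z : ℝ) :
    tanhPoly θ p z = ((p.eval (Real.tanh (θ * z)) : ℝ) : ℂ) := rfl

theorem star_tanhPoly (θ : ℝ) (p : ℝ[X]) : star (tanhPoly θ p) = tanhPoly θ p := by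
  ext z; rw [BoundedContinuousFunction.star_apply, tanhPoly_apply]; exact Complex.conj_ofReal _

theorem hasDerivAt_tanhPoly (θ : ℝ) (p : ℝ[X]) (z : ℝ) :
    HasDerivAt (tanhPoly θ p) (tanhPoly θ (C θ * (1 - X ^ 2) * derivative p) z) z := by
  have h := ((p.hasDerivAt (Real.tanh (θ * z))).comp z (hasDerivAt_tanh_mul θ z)).ofReal_comp
  refine h.congr_deriv ?_
  rw [tanhPoly_apply]
  simp only [eval_mul, eval_sub, eval_one, eval_pow, eval_X, eval_C]
  congr 1; ring

theorem Reg.mul_tanhPoly {α δ : ℝ} {I : Set ℝ} {m : ℕ} {U : ℝ → ℝ →ᵇ ℂ} (θ : ℝ) (p : ℝ[X])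
    (hU : Reg α δ I m U) : Reg α δ I m fun η => tanhPoly θ p * U η := by
  induction m generalizing U p with
  | zero => exact contDiffOn_const.mul hU
  | succ m ih =>
    obtain ⟨U', hU', hr⟩ := hU.2
    refine succ (contDiffOn_const.mul hU.1) (fun η hη z => ?_)
      ((ih (C θ * (1 - X ^ 2) * derivative p) hU.of_succ).add (ih p hr))
    rw [ev_add, ev_mul, ev_mul, funext (ev_mul (α := α) (δ := δ) (tanhPoly θ p) (U η))]
    exact (hasDerivAt_tanhPoly θ p z).mul (hU' η hη z)

/-! ### Limits and integrals of profiles -/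

theorem tendsto_tanh_atTop : Tendsto Real.tanh atTop (𝓝 1) := by
  have h : Tendsto (fun y : ℝ => 1 - 2 / (1 + Real.exp (2 * y))) atTop (𝓝 (1 - 0)) := by
    refine tendsto_const_nhds.sub (tendsto_const_nhds.div_atTop (tendsto_atTop_add_const_left _ _
      (Real.tendsto_exp_atTop.comp (tendsto_id.const_mul_atTop two_pos))))
  rw [sub_zero] at h
  refine h.congr fun y => ?_
  rw [← one_sub_tanh]; ring

theorem tendsto_tanh_atBot : Tendsto Real.tanh atBot (𝓝 (-1)) := by
  have h := (tendsto_tanh_atTop.comp tendsto_neg_atBot_atTop).neg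
  refine h.congr fun y => ?_
  simp [Real.tanh_neg]

section integrals

variable {θ : ℝ}

theorem abs_id_mul_sech_le (hθ : 0 < θ) (z : ℝ) :
    |z * (1 - Real.tanh (θ * z) ^ 2)| ≤ 4 / θ * Real.exp (-(θ * |z|)) := by
  rw [abs_mul, abs_of_pos (one_sub_tanh_sq_pos _)]
  calc |z| * (1 - Real.tanh (θ * z) ^ 2)
      ≤ (1 / θ * Real.exp (θ * |z|)) * (4 * Real.exp (-(2 * |θ * z|))) :=
        mul_le_mul (mul_exp_neg_le hθ _) (one_sub_tanh_sq_le _) (one_sub_tanh_sq_pos _).le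
          (by positivity)
    _ = 4 / θ * Real.exp (-(θ * |z|)) := by
        rw [abs_mul, abs_of_pos hθ, show -(θ * |z|) = θ * |z| + -(2 * (θ * |z|)) by ring,
          Real.exp_add]
        ring

theorem tendsto_id_mul_sech (hθ : 0 < θ) {l : Filter ℝ} (hl : Tendsto (fun z : ℝ => |z|) l atTop) :
    Tendsto (fun z => z * (1 - Real.tanh (θ * z) ^ 2)) l (𝓝 0) := by
  refine squeeze_zero_norm (fun z => abs_id_mul_sech_le hθ z) ?_
  rw [show (0 : ℝ) = 4 / θ * 0 by ring]
  exact (Real.tendsto_exp_neg_atTop_nhds_zero.comp (hl.const_mul_atTop hθ)).const_mul _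

theorem tendsto_profile_atTop (hθ : 0 < θ) (P : ℝ[X] × ℝ[X]) :
    Tendsto (profile θ P) atTop (𝓝 0) := by
  have hT : Tendsto (fun z => Real.tanh (θ * z)) atTop (𝓝 1) :=
    tendsto_tanh_atTop.comp (tendsto_id.const_mul_atTop hθ)
  have h := ((hT.const_sub 1).mul ((P.1.continuous.tendsto _).comp hT)).add
    ((tendsto_id_mul_sech hθ tendsto_abs_atTop_atTop).mul ((P.2.continuous.tendsto _).comp hT))
  convert! h using 2
  norm_num

theorem tendsto_profile_atBot (hθ : 0 < θ) (P : ℝ[X] × ℝ[X]) :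
    Tendsto (profile θ P) atBot (𝓝 (2 * P.1.eval (-1))) := by
  have hT : Tendsto (fun z => Real.tanh (θ * z)) atBot (𝓝 (-1)) :=
    tendsto_tanh_atBot.comp (tendsto_id.const_mul_atBot hθ)
  have h := ((hT.const_sub 1).mul ((P.1.continuous.tendsto _).comp hT)).add
    ((tendsto_id_mul_sech hθ tendsto_abs_atBot_atTop).mul ((P.2.continuous.tendsto _).comp hT))
  convert! h using 2
  norm_num

/-- Profiles whose first component contains the factor `1 + T` decay at both ends. -/
theorem integrable_profile_deriv (hθ : 0 < θ) (P : ℝ[X] × ℝ[X]) :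
    Integrable (profile θ (profileDeriv θ P)) := by
  obtain ⟨C₁, hC₁, h1⟩ := exists_bound_eval_tanh
    (C θ * (-P.1 + (1 - X) * derivative P.1) + P.2)
  obtain ⟨C₂, hC₂, h2⟩ := exists_bound_eval_tanh (profileDeriv θ P).2
  refine ((integrable_exp_neg_abs hθ).const_mul (4 * C₁ + 4 / θ * C₂)).mono'
    (continuous_profile θ _).aestronglyMeasurable (Eventually.of_forall fun z => ?_)
  set T := Real.tanh (θ * z) with hT
  have e : profile θ (profileDeriv θ P) z =
      (1 - T ^ 2) * (C θ * (-P.1 + (1 - X) * derivative P.1) + P.2).eval T +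
        z * (1 - T ^ 2) * (profileDeriv θ P).2.eval T := by
    simp only [profile, profileDeriv, eval_mul, eval_add, eval_one, eval_X, ← hT]
    ring
  have e1 : 1 - T ^ 2 ≤ 4 * Real.exp (-θ * |z|) := by
    refine (one_sub_tanh_sq_le _).trans ?_
    rw [abs_mul, abs_of_pos hθ]
    have : -(2 * (θ * |z|)) ≤ -θ * |z| := by nlinarith [abs_nonneg z]
    linarith [Real.exp_le_exp.2 this]
  rw [e, Real.norm_eq_abs]
  refine (abs_add_le _ _).trans ?_
  rw [abs_mul, abs_mul, abs_of_pos (one_sub_tanh_sq_pos (θ * z))]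
  have e2 := abs_id_mul_sech_le hθ z
  rw [← neg_mul] at e2
  calc _ ≤ 4 * Real.exp (-θ * |z|) * C₁ + 4 / θ * Real.exp (-θ * |z|) * C₂ :=
        add_le_add (mul_le_mul e1 (h1 _) (abs_nonneg _) (by positivity))
          (mul_le_mul e2 (h2 _) (abs_nonneg _) (by positivity))
    _ = _ := by ring

theorem integral_profile_deriv (hθ : 0 < θ) (P : ℝ[X] × ℝ[X]) :
    ∫ z, profile θ (profileDeriv θ P) z = -(2 * P.1.eval (-1)) := by
  rw [integral_of_hasDerivAt_of_tendsto (hasDerivAt_profile θ P) (integrable_profile_deriv hθ P)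
    (tendsto_profile_atBot hθ P) (tendsto_profile_atTop hθ P), zero_sub]

theorem integral_Ioi_profile_deriv (hθ : 0 < θ) (P : ℝ[X] × ℝ[X]) (z : ℝ) :
    ∫ s in Ioi z, profile θ (profileDeriv θ P) s = -profile θ P z := by
  rw [integral_Ioi_of_hasDerivAt_of_tendsto' (fun x _ => hasDerivAt_profile θ P x)
    (integrable_profile_deriv hθ P).integrableOn (tendsto_profile_atTop hθ P), zero_sub]

theorem integral_Iic_profile_deriv (hθ : 0 < θ) (P : ℝ[X] × ℝ[X]) (z : ℝ) :
    ∫ s in Iic z, profile θ (profileDeriv θ P) s = profile θ P z - 2 * P.1.eval (-1) :=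
  integral_Iic_of_hasDerivAt_of_tendsto' (fun x _ => hasDerivAt_profile θ P x)
    (integrable_profile_deriv hθ P).integrableOn (tendsto_profile_atBot hθ P)

end integrals

/-! ### Primitives vanishing at `+∞` -/

open Polynomial

theorem hasDerivAt_integral_Ioi {f : ℝ → ℂ} (hf : Continuous f)
    (hi : ∀ a, IntegrableOn f (Ioi a)) (z : ℝ) :
    HasDerivAt (fun x => ∫ s in Ioi x, f s) (-f z) z := by
  have e : (fun x => ∫ s in Ioi x, f s) = fun x => (∫ s in Ioi 0, f s) - ∫ s in (0 : ℝ)..x, f s := by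
    funext x
    rw [eq_sub_iff_add_eq, add_comm]
    exact intervalIntegral.integral_interval_add_Ioi (hi 0) (hi x)
  rw [e]
  exact (intervalIntegral.integral_hasDerivAt_right (hf.intervalIntegrable _ _)
    (hf.stronglyMeasurableAtFilter _ _) hf.continuousAt).const_sub _

theorem norm_intervalIntegral_le_exp {f : ℝ → ℂ} {M ε z : ℝ} (hM : 0 ≤ M) (hε : 0 < ε) (hz : 0 ≤ z)
    (h : ∀ y, 0 ≤ y → ‖f y‖ ≤ M * Real.exp (ε * y)) :
    ‖∫ y in (0 : ℝ)..z, f y‖ ≤ M / ε * Real.exp (ε * z) := by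
  have h1 : ∫ y in (0 : ℝ)..z, M * Real.exp (ε * y) =
      M / ε * Real.exp (ε * z) - M / ε * Real.exp (ε * 0) := by
    refine intervalIntegral.integral_eq_sub_of_hasDerivAt (f := fun y => M / ε * Real.exp (ε * y))
      (fun y _ => ?_) (Continuous.intervalIntegrable (by fun_prop) _ _)
    have := (((hasDerivAt_id y).const_mul ε).exp).const_mul (M / ε)
    simp only [id, mul_one] at this
    refine this.congr_deriv ?_
    field_simp
  refine (intervalIntegral.norm_integral_le_of_norm_le hz (Eventually.of_forall fun y hy => h y hy.1.le)
    (Continuous.intervalIntegrable (by fun_prop) _ _)).trans ?_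
  rw [h1]
  have : 0 ≤ M / ε * Real.exp (ε * 0) := by positivity
  linarith

theorem norm_integral_Ioi_le_exp {f : ℝ → ℂ} {M ε z : ℝ} (hε : 0 < ε)
    (h : ∀ y, z < y → ‖f y‖ ≤ M * Real.exp (-ε * y)) :
    ‖∫ y in Ioi z, f y‖ ≤ M / ε * Real.exp (-ε * z) := by
  have hi : IntegrableOn (fun y => M * Real.exp (-ε * y)) (Ioi z) :=
    (integrableOn_exp_mul_Ioi (neg_lt_zero.2 hε) z).const_mul M
  refine (norm_integral_le_of_norm_le hi ((ae_restrict_iff' measurableSet_Ioi).2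
    (Eventually.of_forall fun y hy => h y hy))).trans_eq ?_
  rw [integral_const_mul, integral_exp_mul_Ioi (neg_lt_zero.2 hε)]
  field_simp

theorem norm_integral_Iic_le_exp {f : ℝ → ℂ} {M ε z : ℝ} (hε : 0 < ε)
    (h : ∀ y, y ≤ z → ‖f y‖ ≤ M * Real.exp (ε * y)) :
    ‖∫ y in Iic z, f y‖ ≤ M / ε * Real.exp (ε * z) := by
  have hi : IntegrableOn (fun y => M * Real.exp (ε * y)) (Iic z) :=
    (integrableOn_exp_mul_Iic hε z).const_mul M
  refine (norm_integral_le_of_norm_le hi ((ae_restrict_iff' measurableSet_Iic).2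
    (Eventually.of_forall fun y hy => h y hy))).trans_eq ?_
  rw [integral_const_mul, integral_exp_mul_Iic hε]
  field_simp

theorem weight_of_nonneg {α δ z : ℝ} (hz : 0 ≤ z) : weight α δ z = Real.exp (-(α + δ) * z) := by
  rw [weight, abs_of_nonneg hz]; congr 1; ring

theorem weight_of_nonpos {α δ z : ℝ} (hz : z ≤ 0) : weight α δ z = Real.exp (-(α - δ) * z) := by
  rw [weight, abs_of_nonpos hz]; congr 1; ring

theorem weight_le_of_le {α δ y z : ℝ} (hδ : 0 ≤ δ) (hyz : z ≤ y) :
    weight α δ y ≤ weight α δ z * Real.exp ((α - δ) * z) * Real.exp (-(α - δ) * y) := by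
  rw [weight, weight, ← Real.exp_add, ← Real.exp_add]
  refine Real.exp_le_exp.2 ?_
  have : |z| ≤ |y| + (y - z) := by
    have := abs_sub_abs_le_abs_sub z y
    rw [abs_sub_comm, abs_of_nonneg (sub_nonneg.2 hyz)] at this
    linarith
  nlinarith

namespace WeightCond

variable {θ α δ : ℝ}

theorem integrableOn_ev (h : WeightCond θ α δ) (F : ℝ →ᵇ ℂ) (a : ℝ) :
    IntegrableOn (ev α δ F) (Ioi a) := by
  have hε : 0 < α - δ := sub_pos.2 h.lt
  refine Integrable.mono' (((integrableOn_exp_mul_Ioi (neg_lt_zero.2 hε) a)).const_mul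
    (‖F‖ * (weight α δ a * Real.exp ((α - δ) * a)))) (continuous_ev F).aestronglyMeasurable
    ((ae_restrict_iff' measurableSet_Ioi).2 (Eventually.of_forall fun y hy => ?_))
  refine (norm_ev_le F y).trans ?_
  rw [mul_assoc]
  exact mul_le_mul_of_nonneg_left (weight_le_of_le h.pos.le (le_of_lt hy)) (norm_nonneg _)

/-- The operator `f ↦ ∫_z^∞ f`, bounded because the weight decays exponentially to the right. -/
def tailIntegral (h : WeightCond θ α δ) : (ℝ →ᵇ ℂ) →L[ℂ] (ℝ →ᵇ ℂ) :=
  clmOfBound α δ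
    { toFun := fun F z => ∫ s in Ioi z, ev α δ F s
      map_add' := fun F G => by
        funext z
        simp only [ev_add, Pi.add_apply]
        exact integral_add (h.integrableOn_ev F z) (h.integrableOn_ev G z)
      map_smul' := fun r F => by
        funext z
        simp only [ev_smul, Pi.smul_apply, smul_eq_mul, RingHom.id_apply]
        exact integral_const_mul _ _ }
    (1 / (α - δ)) (by have := h.lt; have : 0 < α - δ := by linarith
                      positivity)
    (fun F => continuous_iff_continuousAt.2 fun z =>
      (hasDerivAt_integral_Ioi (continuous_ev F) (h.integrableOn_ev F) z).continuousAt)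
    fun F z => by
      have hε : 0 < α - δ := sub_pos.2 h.lt
      refine (norm_integral_Ioi_le_exp (M := ‖F‖ * (weight α δ z * Real.exp ((α - δ) * z))) hε
        fun y hy => ?_).trans_eq ?_
      · refine (norm_ev_le F y).trans ?_
        rw [mul_assoc]
        exact mul_le_mul_of_nonneg_left (weight_le_of_le h.pos.le hy.le) (norm_nonneg _)
      · have : Real.exp ((α - δ) * z) * Real.exp (-(α - δ) * z) = 1 := by
          rw [← Real.exp_add, Real.exp_eq_one_iff]; ring
        linear_combination ‖F‖ * weight α δ z / (α - δ) * this

theorem ev_tailIntegral (h : WeightCond θ α δ) (F : ℝ →ᵇ ℂ) (z : ℝ) :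
    ev α δ (h.tailIntegral F) z = ∫ s in Ioi z, ev α δ F s :=
  ev_clmOfBound _ _ _ _ _ _ _

theorem hasDerivAt_tailIntegral (h : WeightCond θ α δ) (F : ℝ →ᵇ ℂ) (z : ℝ) :
    HasDerivAt (ev α δ (h.tailIntegral F)) (-ev α δ F z) z := by
  rw [funext (h.ev_tailIntegral F)]
  exact hasDerivAt_integral_Ioi (continuous_ev F) (h.integrableOn_ev F) z

theorem tailIntegral_star (h : WeightCond θ α δ) (F : ℝ →ᵇ ℂ) :
    h.tailIntegral (star F) = star (h.tailIntegral F) :=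
  ev_injective (α := α) (δ := δ) fun z => by
    rw [ev_star, ev_tailIntegral, ev_tailIntegral, ← integral_conj]
    simp only [ev_star]

end WeightCond

/-! ### Green's function of the linearized KdV operator -/

/-- The decaying solution `tanh θz sech² θz` of `y'' = θ²(4 - 12 sech² θz) y`. -/
def psi (θ z : ℝ) : ℝ := Real.tanh (θ * z) * (1 - Real.tanh (θ * z) ^ 2)

/-- The derivative of `psi`. -/
def psiDeriv (θ z : ℝ) : ℝ :=
  θ * ((1 - Real.tanh (θ * z) ^ 2) * (1 - 3 * Real.tanh (θ * z) ^ 2))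

/-- The growing solution of `y'' = θ²(4 - 12 sech² θz) y` found from `psi` by reduction of order. -/
def psiGrow (θ z : ℝ) : ℝ :=
  1 / 8 * (2 * Real.cosh (θ * z) ^ 2 + 5 - 15 * (1 - Real.tanh (θ * z) ^ 2) +
    15 * Real.tanh (θ * z) * (θ * (z * (1 - Real.tanh (θ * z) ^ 2))))

/-- The derivative of `psiGrow`. -/
def psiGrowDeriv (θ z : ℝ) : ℝ :=
  θ / 8 * (4 * Real.tanh (θ * z) * Real.cosh (θ * z) ^ 2 +
    45 * Real.tanh (θ * z) * (1 - Real.tanh (θ * z) ^ 2) +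
    15 * (1 - 3 * Real.tanh (θ * z) ^ 2) * (θ * (z * (1 - Real.tanh (θ * z) ^ 2))))

theorem hasDerivAt_psi (θ z : ℝ) : HasDerivAt (psi θ) (psiDeriv θ z) z := by
  have hT := hasDerivAt_tanh_mul θ z
  refine (hT.mul ((hT.pow 2).const_sub 1)).congr_deriv ?_
  simp only [psiDeriv, Pi.pow_apply]; push_cast; ring

theorem hasDerivAt_psiDeriv (θ z : ℝ) :
    HasDerivAt (psiDeriv θ) (θ ^ 2 * (4 - 12 * (1 - Real.tanh (θ * z) ^ 2)) * psi θ z) z := by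
  have hT := hasDerivAt_tanh_mul θ z
  refine ((((hT.pow 2).const_sub 1).mul (((hT.pow 2).const_mul 3).const_sub 1)).const_mul
    θ).congr_deriv ?_
  simp only [psi, Pi.pow_apply]; push_cast; ring

theorem hasDerivAt_cosh_sq (θ z : ℝ) :
    HasDerivAt (fun x => Real.cosh (θ * x) ^ 2)
      (2 * θ * Real.tanh (θ * z) * Real.cosh (θ * z) ^ 2) z := by
  have h1 : HasDerivAt (fun x : ℝ => θ * x) θ z := by simpa using (hasDerivAt_id z).const_mul θ
  refine (h1.cosh.pow 2).congr_deriv ?_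
  have hc : Real.cosh (θ * z) ≠ 0 := (Real.cosh_pos _).ne'
  rw [Real.tanh_eq_sinh_div_cosh]
  push_cast; field_simp

theorem cosh_sq_mul (y : ℝ) : Real.cosh y ^ 2 * (1 - Real.tanh y ^ 2) = 1 := by
  have hc : Real.cosh y ≠ 0 := (Real.cosh_pos _).ne'
  rw [one_sub_tanh_sq]; field_simp

theorem hasDerivAt_psiGrow (θ z : ℝ) : HasDerivAt (psiGrow θ) (psiGrowDeriv θ z) z := by
  have hT := hasDerivAt_tanh_mul θ z
  have hG := hasDerivAt_cosh_sq θ z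
  have hE := (hT.pow 2).const_sub 1
  refine ((((hG.const_mul 2).add_const 5).sub (hE.const_mul 15)).add ((hT.const_mul 15).mul
    (((hasDerivAt_id z).mul hE).const_mul θ))).const_mul (1 / 8) |>.congr_deriv ?_
  simp only [psiGrowDeriv, Pi.pow_apply, Pi.mul_apply, id]; push_cast; ring

theorem hasDerivAt_psiGrowDeriv (θ z : ℝ) :
    HasDerivAt (psiGrowDeriv θ) (θ ^ 2 * (4 - 12 * (1 - Real.tanh (θ * z) ^ 2)) * psiGrow θ z) z := by
  have hT := hasDerivAt_tanh_mul θ z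
  have hG := hasDerivAt_cosh_sq θ z
  have hE := (hT.pow 2).const_sub 1
  have := cosh_sq_mul (θ * z)
  refine (((((hT.const_mul 4).mul hG).add ((hT.const_mul 45).mul hE)).add
    ((((hT.pow 2).const_mul 3).const_sub 1).const_mul 15 |>.mul
    (((hasDerivAt_id z).mul hE).const_mul θ))).const_mul (θ / 8)).congr_deriv ?_
  simp only [psiGrow, Pi.pow_apply, Pi.mul_apply, id]; push_cast
  linear_combination 5 / 2 * θ ^ 2 * this

theorem wronskian_psi (θ z : ℝ) : psi θ z * psiGrowDeriv θ z - psiDeriv θ z * psiGrow θ z = θ := by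
  have := cosh_sq_mul (θ * z)
  simp only [psi, psiDeriv, psiGrow, psiGrowDeriv]
  linear_combination (θ / 8) * (4 * Real.tanh (θ * z) ^ 2 - 2 * (1 - 3 * Real.tanh (θ * z) ^ 2)) * this

theorem continuous_psi (θ : ℝ) : Continuous (psi θ) :=
  continuous_iff_continuousAt.2 fun z => (hasDerivAt_psi θ z).continuousAt

theorem continuous_psiGrow (θ : ℝ) : Continuous (psiGrow θ) :=
  continuous_iff_continuousAt.2 fun z => (hasDerivAt_psiGrow θ z).continuousAt

theorem exists_psi_bounds {θ : ℝ} (hθ : 0 < θ) : ∃ C, 0 < C ∧ ∀ z,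
    |psi θ z| ≤ C * Real.exp (-(2 * θ * |z|)) ∧ |psiDeriv θ z| ≤ C * Real.exp (-(2 * θ * |z|)) ∧
    |psiGrow θ z| ≤ C * Real.exp (2 * θ * |z|) ∧ |psiGrowDeriv θ z| ≤ C * Real.exp (2 * θ * |z|) := by
  refine ⟨100 * (1 + θ), by positivity, fun z => ?_⟩
  set T := Real.tanh (θ * z) with hTdef
  have hT : |T| ≤ 1 := (Real.abs_tanh_lt_one _).le
  have hs0 : 0 < 1 - T ^ 2 := one_sub_tanh_sq_pos _
  have hT2 : 0 ≤ T ^ 2 := sq_nonneg T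
  have hs : 1 - T ^ 2 ≤ 4 * Real.exp (-(2 * θ * |z|)) := by
    refine (one_sub_tanh_sq_le _).trans_eq ?_
    rw [abs_mul, abs_of_pos hθ, mul_assoc]
  have hE : 1 ≤ Real.exp (2 * θ * |z|) := Real.one_le_exp (by positivity)
  have hG : Real.cosh (θ * z) ^ 2 ≤ Real.exp (2 * θ * |z|) := by
    have : Real.cosh (θ * z) ≤ Real.exp (θ * |z|) := by
      rw [← Real.cosh_abs, abs_mul, abs_of_pos hθ, Real.cosh_eq]
      have : Real.exp (-(θ * |z|)) ≤ Real.exp (θ * |z|) := Real.exp_le_exp.2 (by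
        have : 0 ≤ θ * |z| := by positivity
        linarith)
      linarith
    calc Real.cosh (θ * z) ^ 2 ≤ Real.exp (θ * |z|) ^ 2 := by
          have := (Real.cosh_pos (θ * z)).le; gcongr
      _ = _ := by rw [← Real.exp_nat_mul]; congr 1; push_cast; ring
  have hy : |θ * (z * (1 - T ^ 2))| ≤ 4 := by
    rw [abs_mul, abs_of_pos hθ]
    have h1 := abs_id_mul_sech_le hθ z
    have h2 : Real.exp (-(θ * |z|)) ≤ 1 := Real.exp_le_one_iff.2 (by
      have : 0 ≤ θ * |z| := by positivity
      linarith)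
    calc θ * |z * (1 - T ^ 2)| ≤ θ * (4 / θ * 1) := by
          gcongr; exact h1.trans (by gcongr)
      _ = 4 := by field_simp
  have h3 : |1 - 3 * T ^ 2| ≤ 2 := abs_le.2 ⟨by linarith, by linarith⟩
  have he := Real.exp_pos (-(2 * θ * |z|))
  have hTy : |T * (θ * (z * (1 - T ^ 2)))| ≤ 4 := by
    rw [abs_mul]
    calc _ ≤ 1 * 4 := mul_le_mul hT hy (abs_nonneg _) zero_le_one
      _ = 4 := one_mul _
  have hTs : |T * (1 - T ^ 2)| ≤ 1 - T ^ 2 := by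
    rw [abs_mul, abs_of_pos hs0]
    exact mul_le_of_le_one_left hs0.le hT
  have h3y : |(1 - 3 * T ^ 2) * (θ * (z * (1 - T ^ 2)))| ≤ 8 := by
    rw [abs_mul]
    calc _ ≤ 2 * 4 := mul_le_mul h3 hy (abs_nonneg _) zero_le_two
      _ = 8 := by norm_num
  have hTG : |T * Real.cosh (θ * z) ^ 2| ≤ Real.exp (2 * θ * |z|) := by
    rw [abs_mul, abs_of_nonneg (sq_nonneg (Real.cosh _))]
    exact (mul_le_of_le_one_left (sq_nonneg _) hT).trans hG
  refine ⟨?_, ?_, ?_, ?_⟩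
  · refine hTs.trans (hs.trans ?_)
    gcongr; linarith
  · rw [psiDeriv, abs_mul, abs_of_pos hθ, abs_mul, abs_of_pos hs0]
    calc θ * ((1 - T ^ 2) * |1 - 3 * T ^ 2|)
        ≤ θ * ((4 * Real.exp (-(2 * θ * |z|))) * 2) := by gcongr
      _ ≤ _ := by nlinarith
  · have : psiGrow θ z = 1 / 8 * (2 * Real.cosh (θ * z) ^ 2 + 5 - 15 * (1 - T ^ 2) +
        15 * (T * (θ * (z * (1 - T ^ 2))))) := by rw [psiGrow]; ring
    rw [this, abs_le]
    have := abs_le.1 hTy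
    have := sq_nonneg (Real.cosh (θ * z))
    constructor <;> nlinarith
  · have : psiGrowDeriv θ z = θ * (1 / 8 * (4 * (T * Real.cosh (θ * z) ^ 2) +
        45 * (T * (1 - T ^ 2)) + 15 * ((1 - 3 * T ^ 2) * (θ * (z * (1 - T ^ 2)))))) := by
      rw [psiGrowDeriv]; ring
    rw [this, abs_mul, abs_of_pos hθ]
    have h1 := abs_le.1 hTG
    have h2 := abs_le.1 hTs
    have h4 := abs_le.1 h3y
    calc _ ≤ θ * (100 * Real.exp (2 * θ * |z|)) := by
          refine mul_le_mul_of_nonneg_left (abs_le.2 ?_) hθ.le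
          constructor <;> linarith
      _ ≤ _ := by nlinarith

section green

variable {θ α δ : ℝ}

/-- The function `θ⁻¹ (y₁ ∫_0^z ψ₂ H + y₂ ∫_z^∞ ψ₁ H)`, where `ψ₁`, `ψ₂` are the decaying and the
growing solution of the homogeneous equation, and `(y₁, y₂)` is either `(ψ₁, ψ₂)` or
`(ψ₁', ψ₂')`. -/
def greenFun (θ α δ : ℝ) (y₁ y₂ : ℝ → ℝ) (H : ℝ →ᵇ ℂ) (z : ℝ) : ℂ :=
  (θ : ℂ)⁻¹ * (y₁ z * (∫ s in (0 : ℝ)..z, psiGrow θ s * ev α δ H s) +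
    y₂ z * ∫ s in Ioi z, psi θ s * ev α δ H s)

theorem continuous_psi_mul (θ : ℝ) (H : ℝ →ᵇ ℂ) : Continuous fun s => (psi θ s : ℂ) * ev α δ H s :=
  (Complex.continuous_ofReal.comp (continuous_psi θ)).mul (continuous_ev H)

theorem continuous_psiGrow_mul (θ : ℝ) (H : ℝ →ᵇ ℂ) :
    Continuous fun s => (psiGrow θ s : ℂ) * ev α δ H s :=
  (Complex.continuous_ofReal.comp (continuous_psiGrow θ)).mul (continuous_ev H)

theorem exists_norm_psi_mul_le (h : WeightCond θ α δ) : ∃ C, 0 < C ∧ ∀ (H : ℝ →ᵇ ℂ) (z : ℝ),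
    ‖(psi θ z : ℂ) * ev α δ H z‖ ≤ C * ‖H‖ * (Real.exp (-(2 * θ * |z|)) * weight α δ z) ∧
    ‖(psiGrow θ z : ℂ) * ev α δ H z‖ ≤ C * ‖H‖ * (Real.exp (2 * θ * |z|) * weight α δ z) := by
  obtain ⟨C, hC, hb⟩ := exists_psi_bounds h.theta_pos
  refine ⟨C, hC, fun H z => ⟨?_, ?_⟩⟩
  · rw [norm_mul, Complex.norm_real]
    calc _ ≤ (C * Real.exp (-(2 * θ * |z|))) * (‖H‖ * weight α δ z) :=
          mul_le_mul (hb z).1 (norm_ev_le H z) (norm_nonneg _) (by positivity)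
      _ = _ := by ring
  · rw [norm_mul, Complex.norm_real]
    calc _ ≤ (C * Real.exp (2 * θ * |z|)) * (‖H‖ * weight α δ z) :=
          mul_le_mul (hb z).2.2.1 (norm_ev_le H z) (norm_nonneg _) (by positivity)
      _ = _ := by ring

theorem integrable_psi_mul (h : WeightCond θ α δ) (H : ℝ →ᵇ ℂ) :
    Integrable fun s => (psi θ s : ℂ) * ev α δ H s := by
  obtain ⟨C, hC, hb⟩ := exists_norm_psi_mul_le h
  have hε : 0 < 2 * θ - (α - δ) := by linarith [h.add_lt, h.pos]
  refine ((integrable_exp_neg_abs hε).const_mul (C * ‖H‖)).mono'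
    (continuous_psi_mul θ H).aestronglyMeasurable (Eventually.of_forall fun z =>
      (hb H z).1.trans ?_)
  rw [weight, ← Real.exp_add]
  refine mul_le_mul_of_nonneg_left (Real.exp_le_exp.2 ?_) (by positivity)
  have := h.pos; have := h.lt
  nlinarith [neg_abs_le z, abs_nonneg z]

/-- Away from the homogeneous solutions, the two integrals in Green's function are controlled by the
weight. For the second one the orthogonality to `psi` permits to integrate from the nearer end. -/
theorem exists_green_bounds (h : WeightCond θ α δ) : ∃ C, 0 < C ∧ ∀ H : ℝ →ᵇ ℂ,
    (∫ s, (psi θ s : ℂ) * ev α δ H s = 0) → ∀ z,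
    ‖∫ s in (0 : ℝ)..z, (psiGrow θ s : ℂ) * ev α δ H s‖ ≤
      C * ‖H‖ * (Real.exp (2 * θ * |z|) * weight α δ z) ∧
    ‖∫ s in Ioi z, (psi θ s : ℂ) * ev α δ H s‖ ≤
      C * ‖H‖ * (Real.exp (-(2 * θ * |z|)) * weight α δ z) := by
  obtain ⟨C, hC, hb⟩ := exists_norm_psi_mul_le h
  have h1 := h.pos; have h2 := h.lt; have h3 := h.add_lt
  have hε : 0 < 2 * θ - (α + δ) := by linarith
  have key : ∀ {ε M x y : ℝ}, 2 * θ - (α + δ) ≤ ε → 0 ≤ M → 0 ≤ x → x = y →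
      C * M / ε * x ≤ C / (2 * θ - (α + δ)) * M * y := by
    intro ε M x y hle hM hx hxy
    rw [← hxy, mul_div_right_comm]
    gcongr
  refine ⟨C / (2 * θ - (α + δ)), by positivity, fun H hH z => ⟨?_, ?_⟩⟩
  · rcases le_total 0 z with hz | hz
    · have e : ∀ y : ℝ, 0 ≤ y → Real.exp ((2 * θ - (α + δ)) * y) =
          Real.exp (2 * θ * |y|) * weight α δ y := fun y hy => by
        rw [abs_of_nonneg hy, weight_of_nonneg hy, ← Real.exp_add]; congr 1; ring
      refine (norm_intervalIntegral_le_exp (M := C * ‖H‖) (by positivity) hε hz fun y hy => ?_).trans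
        (key le_rfl (norm_nonneg H) (Real.exp_pos _).le (e z hz))
      rw [e y hy]; exact (hb H y).2
    · have e : ∀ y : ℝ, 0 ≤ y → Real.exp ((2 * θ + (α - δ)) * y) =
          Real.exp (2 * θ * |-y|) * weight α δ (-y) := fun y hy => by
        rw [abs_neg, abs_of_nonneg hy, weight_of_nonpos (neg_nonpos.2 hy), ← Real.exp_add]
        congr 1; ring
      have hr := intervalIntegral.integral_comp_neg (a := 0) (b := -z)
        fun s => (psiGrow θ s : ℂ) * ev α δ H s
      rw [neg_neg, neg_zero] at hr
      rw [← norm_neg, ← intervalIntegral.integral_symm, ← hr]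
      refine (norm_intervalIntegral_le_exp (M := C * ‖H‖) (by positivity)
        (by linarith : 0 < 2 * θ + (α - δ)) (neg_nonneg.2 hz) fun y hy => ?_).trans
        (key (by linarith) (norm_nonneg H) (Real.exp_pos _).le
          ((e (-z) (neg_nonneg.2 hz)).trans (by rw [neg_neg])))
      rw [e y hy]; exact (hb H (-y)).2
  · rcases le_total 0 z with hz | hz
    · have e : ∀ y : ℝ, 0 ≤ y → Real.exp (-(2 * θ + (α + δ)) * y) =
          Real.exp (-(2 * θ * |y|)) * weight α δ y := fun y hy => by
        rw [abs_of_nonneg hy, weight_of_nonneg hy, ← Real.exp_add]; congr 1; ring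
      refine (norm_integral_Ioi_le_exp (M := C * ‖H‖) (by linarith : 0 < 2 * θ + (α + δ))
        fun y hy => ?_).trans (key (by linarith) (norm_nonneg H) (Real.exp_pos _).le (e z hz))
      rw [e y (hz.trans hy.le)]; exact (hb H y).1
    · have e : ∀ y : ℝ, y ≤ 0 → Real.exp ((2 * θ - (α - δ)) * y) =
          Real.exp (-(2 * θ * |y|)) * weight α δ y := fun y hy => by
        rw [abs_of_nonpos hy, weight_of_nonpos hy, ← Real.exp_add]; congr 1; ring
      have hi := integrable_psi_mul h H
      have hs := intervalIntegral.integral_Iic_add_Ioi hi.integrableOn (hi.integrableOn (s := Ioi z))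
      rw [hH] at hs
      rw [eq_neg_of_add_eq_zero_right hs, norm_neg]
      refine (norm_integral_Iic_le_exp (M := C * ‖H‖) (by linarith : 0 < 2 * θ - (α - δ))
        fun y hy => ?_).trans (key (by linarith) (norm_nonneg H) (Real.exp_pos _).le (e z hz))
      rw [e y (hy.trans hz)]; exact (hb H y).1

theorem exists_norm_greenFun_le (h : WeightCond θ α δ) : ∃ C, 0 ≤ C ∧ ∀ H : ℝ →ᵇ ℂ,
    (∫ s, (psi θ s : ℂ) * ev α δ H s = 0) → ∀ z,
    ‖greenFun θ α δ (psi θ) (psiGrow θ) H z‖ ≤ C * ‖H‖ * weight α δ z ∧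
    ‖greenFun θ α δ (psiDeriv θ) (psiGrowDeriv θ) H z‖ ≤ C * ‖H‖ * weight α δ z := by
  obtain ⟨C₁, hC₁, h1⟩ := exists_psi_bounds h.theta_pos
  obtain ⟨C₂, hC₂, h2⟩ := exists_green_bounds h
  have hθ := h.theta_pos
  refine ⟨θ⁻¹ * (2 * (C₁ * C₂)), by positivity, fun H hH z => ?_⟩
  have hexp : Real.exp (-(2 * θ * |z|)) * Real.exp (2 * θ * |z|) = 1 := by
    rw [← Real.exp_add]; simp
  have key : ∀ y₁ y₂ : ℝ → ℝ, |y₁ z| ≤ C₁ * Real.exp (-(2 * θ * |z|)) →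
      |y₂ z| ≤ C₁ * Real.exp (2 * θ * |z|) →
      ‖greenFun θ α δ y₁ y₂ H z‖ ≤ θ⁻¹ * (2 * (C₁ * C₂)) * ‖H‖ * weight α δ z := by
    intro y₁ y₂ hy₁ hy₂
    rw [greenFun, norm_mul, norm_inv, Complex.norm_real, Real.norm_of_nonneg hθ.le, mul_assoc,
      mul_assoc θ⁻¹]
    refine mul_le_mul_of_nonneg_left ((norm_add_le _ _).trans ?_) (by positivity)
    rw [norm_mul, norm_mul, Complex.norm_real, Complex.norm_real]
    calc _ ≤ (C₁ * Real.exp (-(2 * θ * |z|))) *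
            (C₂ * ‖H‖ * (Real.exp (2 * θ * |z|) * weight α δ z)) +
          (C₁ * Real.exp (2 * θ * |z|)) *
            (C₂ * ‖H‖ * (Real.exp (-(2 * θ * |z|)) * weight α δ z)) :=
          add_le_add (mul_le_mul hy₁ (h2 H hH z).1 (norm_nonneg _) (by positivity))
            (mul_le_mul hy₂ (h2 H hH z).2 (norm_nonneg _) (by positivity))
      _ = _ := by linear_combination 2 * C₁ * C₂ * ‖H‖ * weight α δ z * hexp
  exact ⟨key _ _ (h1 z).1 (h1 z).2.2.1, key _ _ (h1 z).2.1 (h1 z).2.2.2⟩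

theorem hasDerivAt_greenFun (h : WeightCond θ α δ) {y₁ y₂ y₁' y₂' : ℝ → ℝ} {z : ℝ}
    (h1 : HasDerivAt y₁ (y₁' z) z) (h2 : HasDerivAt y₂ (y₂' z) z) (H : ℝ →ᵇ ℂ) :
    HasDerivAt (greenFun θ α δ y₁ y₂ H) (greenFun θ α δ y₁' y₂' H z +
      (θ : ℂ)⁻¹ * (y₁ z * psiGrow θ z - y₂ z * psi θ z) * ev α δ H z) z := by
  have hA : HasDerivAt (fun z => ∫ s in (0 : ℝ)..z, (psiGrow θ s : ℂ) * ev α δ H s)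
      ((psiGrow θ z : ℂ) * ev α δ H z) z :=
    intervalIntegral.integral_hasDerivAt_right ((continuous_psiGrow_mul θ H).intervalIntegrable _ _)
      ((continuous_psiGrow_mul θ H).stronglyMeasurableAtFilter _ _)
      (continuous_psiGrow_mul θ H).continuousAt
  have hB := hasDerivAt_integral_Ioi (continuous_psi_mul (α := α) (δ := δ) θ H)
    (fun a => (integrable_psi_mul h H).integrableOn) z
  refine (((h1.ofReal_comp.mul hA).add (h2.ofReal_comp.mul hB)).const_mul _).congr_deriv ?_
  simp only [greenFun]; ring

theorem greenFun_star (y₁ y₂ : ℝ → ℝ) (H : ℝ →ᵇ ℂ) (z : ℝ) :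
    greenFun θ α δ y₁ y₂ (star H) z = conj (greenFun θ α δ y₁ y₂ H z) := by
  have e1 : ∀ s, (psiGrow θ s : ℂ) * ev α δ (star H) s = conj ((psiGrow θ s : ℂ) * ev α δ H s) :=
    fun s => by rw [map_mul, Complex.conj_ofReal, ev_star]
  have e2 : ∀ s, (psi θ s : ℂ) * ev α δ (star H) s = conj ((psi θ s : ℂ) * ev α δ H s) :=
    fun s => by rw [map_mul, Complex.conj_ofReal, ev_star]
  have e3 : ∫ s in (0 : ℝ)..z, conj ((psiGrow θ s : ℂ) * ev α δ H s) =
      conj (∫ s in (0 : ℝ)..z, (psiGrow θ s : ℂ) * ev α δ H s) := by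
    rw [intervalIntegral, intervalIntegral, map_sub, integral_conj, integral_conj]
  simp only [greenFun, e1, e2, e3, integral_conj]
  simp only [map_mul, map_add, map_inv₀, Complex.conj_ofReal]

/-- Green's operator as a linear map. -/
def greenLin (h : WeightCond θ α δ) (y₁ y₂ : ℝ → ℝ) : (ℝ →ᵇ ℂ) →ₗ[ℂ] (ℝ → ℂ) where
  toFun := greenFun θ α δ y₁ y₂
  map_add' H K := by
    funext z
    simp only [greenFun, ev_add, mul_add, Pi.add_apply]
    rw [intervalIntegral.integral_add ((continuous_psiGrow_mul θ H).intervalIntegrable _ _)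
      ((continuous_psiGrow_mul θ K).intervalIntegrable _ _),
      integral_add (integrable_psi_mul h H).integrableOn (integrable_psi_mul h K).integrableOn]
    ring
  map_smul' r H := by
    funext z
    have e1 : ∀ s, (psiGrow θ s : ℂ) * (r * ev α δ H s) = r * ((psiGrow θ s : ℂ) * ev α δ H s) :=
      fun s => by ring
    have e2 : ∀ s, (psi θ s : ℂ) * (r * ev α δ H s) = r * ((psi θ s : ℂ) * ev α δ H s) :=
      fun s => by ring
    simp only [greenFun, ev_smul, Pi.smul_apply, smul_eq_mul, RingHom.id_apply, e1, e2,
      intervalIntegral.integral_const_mul, integral_const_mul]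
    ring

/-- Bounded solution operator of `-v'' + θ²(4 - 12 sech² θz) v = H` for right-hand sides orthogonal
to `psi`. -/
theorem exists_greenCLM (h : WeightCond θ α δ) {E : Type*} [NormedAddCommGroup E] [NormedSpace ℂ E]
    (H : E →L[ℂ] (ℝ →ᵇ ℂ)) (hH : ∀ x, ∫ s, (psi θ s : ℂ) * ev α δ (H x) s = 0) :
    ∃ V V' : E →L[ℂ] (ℝ →ᵇ ℂ),
      (∀ x z, HasDerivAt (ev α δ (V x)) (ev α δ (V' x) z) z) ∧
      (∀ x z, HasDerivAt (ev α δ (V' x)) (θ ^ 2 * (4 - 12 * (1 - Real.tanh (θ * z) ^ 2) : ℝ) *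
        ev α δ (V x) z - ev α δ (H x) z) z) ∧
      ∀ x y, H y = star (H x) → V y = star (V x) ∧ V' y = star (V' x) := by
  obtain ⟨C, hC, hb⟩ := exists_norm_greenFun_le h
  have hθ : (θ : ℂ) ≠ 0 := by exact_mod_cast h.theta_pos.ne'
  have d0 : ∀ H : ℝ →ᵇ ℂ, ∀ z, HasDerivAt (greenFun θ α δ (psi θ) (psiGrow θ) H)
      (greenFun θ α δ (psiDeriv θ) (psiGrowDeriv θ) H z) z := fun H z =>
    (hasDerivAt_greenFun h (hasDerivAt_psi θ z) (hasDerivAt_psiGrow θ z) H).congr_deriv (by ring)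
  have d1 : ∀ H : ℝ →ᵇ ℂ, ∀ z, HasDerivAt (greenFun θ α δ (psiDeriv θ) (psiGrowDeriv θ) H)
      (θ ^ 2 * (4 - 12 * (1 - Real.tanh (θ * z) ^ 2) : ℝ) *
        greenFun θ α δ (psi θ) (psiGrow θ) H z - ev α δ H z) z := fun H z => by
    refine (hasDerivAt_greenFun h (y₁' := fun z => θ ^ 2 * (4 - 12 * (1 - Real.tanh (θ * z) ^ 2)) *
      psi θ z) (y₂' := fun z => θ ^ 2 * (4 - 12 * (1 - Real.tanh (θ * z) ^ 2)) * psiGrow θ z)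
      (hasDerivAt_psiDeriv θ z) (hasDerivAt_psiGrowDeriv θ z) H).congr_deriv ?_
    have hw : (psi θ z : ℂ) * psiGrowDeriv θ z - psiDeriv θ z * psiGrow θ z = θ := by
      exact_mod_cast wronskian_psi θ z
    have hi : (θ : ℂ)⁻¹ * θ = 1 := inv_mul_cancel₀ hθ
    simp only [greenFun]
    push_cast
    linear_combination (-(θ : ℂ)⁻¹ * ev α δ H z) * hw - ev α δ H z * hi
  let V := clmOfBound α δ ((greenLin h (psi θ) (psiGrow θ)).comp (H : E →ₗ[ℂ] (ℝ →ᵇ ℂ))) (C * ‖H‖)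
    (by positivity) (fun x => continuous_iff_continuousAt.2 fun z => (d0 (H x) z).continuousAt)
    fun x z => ((hb (H x) (hH x) z).1).trans (by
      have := H.le_opNorm x
      have := (weight_pos α δ z).le
      rw [mul_assoc C ‖H‖]; gcongr)
  let V' := clmOfBound α δ ((greenLin h (psiDeriv θ) (psiGrowDeriv θ)).comp
      (H : E →ₗ[ℂ] (ℝ →ᵇ ℂ))) (C * ‖H‖)
    (by positivity) (fun x => continuous_iff_continuousAt.2 fun z => (d1 (H x) z).continuousAt)
    fun x z => ((hb (H x) (hH x) z).2).trans (by
      have := H.le_opNorm x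
      have := (weight_pos α δ z).le
      rw [mul_assoc C ‖H‖]; gcongr)
  have hV : ∀ x, ev α δ (V x) = greenFun θ α δ (psi θ) (psiGrow θ) (H x) := fun x =>
    funext fun z => ev_clmOfBound _ _ _ _ _ _ _
  have hV' : ∀ x, ev α δ (V' x) = greenFun θ α δ (psiDeriv θ) (psiGrowDeriv θ) (H x) := fun x =>
    funext fun z => ev_clmOfBound _ _ _ _ _ _ _
  refine ⟨V, V', fun x z => ?_, fun x z => ?_, fun x y hxy => ⟨?_, ?_⟩⟩
  · rw [hV, hV']; exact d0 _ _
  · rw [hV, hV']; exact d1 _ _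
  · exact ev_injective (α := α) (δ := δ) fun z => by rw [ev_star, hV, hV, hxy, greenFun_star]
  · exact ev_injective (α := α) (δ := δ) fun z => by rw [ev_star, hV', hV', hxy, greenFun_star]

/-- The profile `sech² θz = 1 - tanh² θz`. -/
def sechSq : ℝ[X] × ℝ[X] := (1 + X, 0)

theorem profile_sechSq (θ z : ℝ) : profile θ sechSq z = 1 - Real.tanh (θ * z) ^ 2 := by
  simp only [profile, sechSq, eval_add, eval_one, eval_X, eval_zero]; ring

/-- Since `psi` is a multiple of the derivative of `sech² θz`, orthogonality to `sech² θz` becomes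
orthogonality to `psi` upon integration. -/
theorem integral_psi_tailIntegral (h : WeightCond θ α δ) {F : ℝ →ᵇ ℂ}
    (hF : dualPair α h.pos (reflect (h.elem sechSq)) F = 0) :
    ∫ s, (psi θ s : ℂ) * ev α δ (h.tailIntegral F) s = 0 := by
  have hθ : (θ : ℂ) ≠ 0 := by exact_mod_cast h.theta_pos.ne'
  have hG : ∀ z, HasDerivAt (ev (-α) δ (reflect (h.elem sechSq)))
      (ev (-α) δ (-reflect (h.elem (profileDeriv θ sechSq))) z) z := fun z => by
    rw [ev_neg, ev_reflect, funext (ev_reflect α δ (h.elem sechSq))]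
    simpa [Function.comp_def] using (h.hasDerivAt_elem sechSq (-z)).scomp z (hasDerivAt_neg z)
  have key := dualPair_deriv α h.pos (F := h.tailIntegral F) (F' := -F)
    (fun z => by rw [ev_neg]; exact h.hasDerivAt_tailIntegral F z) hG
  rw [map_neg, hF, neg_zero, eq_comm, neg_eq_zero, dualPair_apply] at key
  have e : ∀ s, ev α δ (h.tailIntegral F) s *
      ev (-α) δ (-reflect (h.elem (profileDeriv θ sechSq))) s =
      (-2 * θ) * ((psi θ s : ℂ) * ev α δ (h.tailIntegral F) s) := fun s => by
    have e1 : profile θ (profileDeriv θ sechSq) (-s) = 2 * θ * psi θ s := by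
      simp only [profile, profileDeriv, sechSq, psi, eval_add, eval_mul, eval_sub, eval_neg,
        eval_one, eval_X, eval_C, eval_zero, derivative_add, derivative_one, derivative_X, mul_neg,
        Real.tanh_neg, derivative_zero, eval_ofNat, eval_pow]
      ring
    rw [ev_neg, ev_reflect, h.ev_elem, e1]
    push_cast; ring
  simp only [e] at key
  rw [integral_const_mul] at key
  exact (mul_eq_zero.1 key).resolve_left (by simpa using hθ)

/-- Bounded solution operator of `∂ (-∂² + θ²(4 - 12 sech² θz)) ∂ w = N f`, together with its first
three derivatives, for right-hand sides orthogonal to `sech² θz`. -/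
theorem exists_solutionOperator (h : WeightCond θ α δ) (N : (ℝ →ᵇ ℂ) →L[ℂ] (ℝ →ᵇ ℂ))
    (hN : ∀ f, dualPair α h.pos (reflect (h.elem sechSq)) (N f) = 0) :
    ∃ K : ℕ → (ℝ →ᵇ ℂ) →L[ℂ] (ℝ →ᵇ ℂ),
      (∀ j < 3, ∀ f z, HasDerivAt (ev α δ (K j f)) (ev α δ (K (j + 1) f) z) z) ∧
      (∀ f z, HasDerivAt (ev α δ (K 3 f))
        (θ ^ 2 * (4 - 12 * (1 - Real.tanh (θ * z) ^ 2) : ℝ) * ev α δ (K 2 f) z +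
          24 * θ ^ 3 * (Real.tanh (θ * z) * (1 - Real.tanh (θ * z) ^ 2) : ℝ) * ev α δ (K 1 f) z -
          ev α δ (N f) z) z) ∧
      ∀ f g, N g = star (N f) → ∀ j, K j g = star (K j f) := by
  have hH : ∀ f, ∫ s, (psi θ s : ℂ) * ev α δ ((-h.tailIntegral.comp N) f) s = 0 := fun f => by
    have := integral_psi_tailIntegral h (hN f)
    simp only [neg_apply, ContinuousLinearMap.comp_apply, ev_neg, mul_neg]
    rw [integral_neg, this, neg_zero]
  obtain ⟨V, V', hV, hV', hst⟩ := exists_greenCLM h _ hH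
  let p : ℝ[X] := C (θ ^ 2) * (4 - 12 * (1 - X ^ 2))
  have hp : ∀ z, tanhPoly θ p z = θ ^ 2 * (4 - 12 * (1 - Real.tanh (θ * z) ^ 2) : ℝ) := fun z => by
    rw [tanhPoly_apply]
    simp only [p, eval_mul, eval_C, eval_sub, eval_ofNat, eval_one, eval_pow, eval_X]
    push_cast; ring
  let K3 : (ℝ →ᵇ ℂ) →L[ℂ] (ℝ →ᵇ ℂ) :=
    (ContinuousLinearMap.mul ℂ (ℝ →ᵇ ℂ) (tanhPoly θ p)).comp V + h.tailIntegral.comp N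
  have hK3 : ∀ f, K3 f = tanhPoly θ p * V f + h.tailIntegral (N f) := fun f => rfl
  let K : ℕ → (ℝ →ᵇ ℂ) →L[ℂ] (ℝ →ᵇ ℂ)
    | 0 => -h.tailIntegral.comp V
    | 1 => V
    | 2 => V'
    | _ => K3
  have hsN : ∀ f g, N g = star (N f) → V g = star (V f) ∧ V' g = star (V' f) := fun f g hfg =>
    hst f g (by
      simp only [neg_apply, ContinuousLinearMap.comp_apply, hfg,
        h.tailIntegral_star, star_neg])
  refine ⟨K, fun j hj f z => ?_, fun f z => ?_, fun f g hfg j => ?_⟩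
  · interval_cases j
    · have := (h.hasDerivAt_tailIntegral (V f) z).neg
      rw [neg_neg] at this
      refine this.congr_of_eventuallyEq (Eventually.of_forall fun x => ?_)
      exact ev_neg _ x
    · exact hV f z
    · refine (hV' f z).congr_deriv ?_
      change _ = ev α δ (K3 f) z
      rw [hK3, ev_add, ev_mul, hp]
      simp only [neg_apply, ContinuousLinearMap.comp_apply, ev_neg]
      ring
  · have e : ev α δ (K 3 f) = fun z => tanhPoly θ p z * ev α δ (V f) z +
        ev α δ (h.tailIntegral (N f)) z := by
      funext z
      change ev α δ (K3 f) z = _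
      rw [hK3, ev_add, ev_mul]
    rw [e]
    refine (((hasDerivAt_tanhPoly θ p z).mul (hV f z)).add
      (h.hasDerivAt_tailIntegral (N f) z)).congr_deriv ?_
    change _ = _ * ev α δ (V' f) z + _ * ev α δ (V f) z - _
    rw [hp, tanhPoly_apply]
    simp only [p, eval_mul, eval_C, eval_sub, eval_one, eval_pow, eval_X, derivative_mul,
      derivative_C, derivative_sub, derivative_one, derivative_X_pow, derivative_ofNat, eval_add,
      eval_zero, eval_ofNat, Nat.cast_ofNat]
    push_cast
    ring
  · have hs := hsN f g hfg
    have h3 : K3 g = star (K3 f) := by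
      rw [hK3, hK3, hs.1, hfg, star_add, star_mul', star_tanhPoly, h.tailIntegral_star]
    match j with
    | 0 =>
      change (-h.tailIntegral.comp V) g = star ((-h.tailIntegral.comp V) f)
      simp only [neg_apply, ContinuousLinearMap.comp_apply, hs.1,
        h.tailIntegral_star, star_neg]
    | 1 => exact hs.1
    | 2 => exact hs.2
    | n + 3 => exact h3

end green

/-! ### A bifurcation equation -/

section branch

variable {Y : Type*} [NormedAddCommGroup Y] [NormedSpace ℂ Y] [CompleteSpace Y]

/-- The equation `f = f₀ - s R(s, μ, f)`, `ℓ(f) = μ²` has a unique analytic branch of solutions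
`(μ(s), f(s))` through a point `(μ₀, f₀)` with `ℓ(f₀) = μ₀² ≠ 0`, since its linearization at `s = 0`
is triangular. Uniqueness makes the branch real if the equation is real. -/
theorem exists_analytic_branch [StarAddMonoid Y] [NormedStarGroup Y] [StarModule ℂ Y]
    (l : Y →L[ℂ] ℂ) (R : ℂ × ℂ × Y → Y) (hR : ContDiff ℂ ω R) (f₀ : Y) (μ₀ : ℂ) (hμ : μ₀ ≠ 0)
    (h0 : l f₀ = μ₀ ^ 2) (hf₀ : star f₀ = f₀) (hμ₀ : conj μ₀ = μ₀)
    (hl : ∀ f, l (star f) = conj (l f))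
    (hRs : ∀ s μ f, R (conj s, conj μ, star f) = star (R (s, μ, f))) :
    ∃ r > 0, ∃ (μ : ℂ → ℂ) (f : ℂ → Y), μ 0 = μ₀ ∧ f 0 = f₀ ∧
      ∀ s ∈ Metric.ball (0 : ℂ) r, ContDiffAt ℂ ∞ μ s ∧ ContDiffAt ℂ ∞ f s ∧
        f s = f₀ - s • R (s, μ s, f s) ∧ l (f s) = μ s ^ 2 ∧
        μ (conj s) = conj (μ s) ∧ f (conj s) = star (f s) := by
  let Φ : ℂ × (ℂ × Y) → ℂ × Y := fun p => (l p.2.2 - p.2.1 ^ 2, p.2.2 - f₀ + p.1 • R p)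
  let u : ℂ × (ℂ × Y) := (0, (μ₀, f₀))
  have hΦ : ContDiff ℂ ω Φ := by
    refine ContDiff.prodMk ?_ ?_
    · exact (l.contDiff.comp (contDiff_snd.comp contDiff_snd)).sub
        ((contDiff_fst.comp contDiff_snd).pow 2)
    · exact ((contDiff_snd.comp contDiff_snd).sub contDiff_const).add (contDiff_fst.smul hR)
  have hΦu : Φ u = 0 := by simp [Φ, u, h0]
  let L : ℂ × Y →L[ℂ] ℂ × Y :=
    (l.comp (ContinuousLinearMap.snd ℂ ℂ Y) - (2 * μ₀) • ContinuousLinearMap.fst ℂ ℂ Y).prod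
      (ContinuousLinearMap.snd ℂ ℂ Y)
  let L' : ℂ × Y →L[ℂ] ℂ × Y :=
    ((2 * μ₀)⁻¹ • (l.comp (ContinuousLinearMap.snd ℂ ℂ Y) - ContinuousLinearMap.fst ℂ ℂ Y)).prod
      (ContinuousLinearMap.snd ℂ ℂ Y)
  have h2 : 2 * μ₀ ≠ 0 := mul_ne_zero two_ne_zero hμ
  let e : (ℂ × Y) ≃L[ℂ] (ℂ × Y) := ContinuousLinearEquiv.equivOfInverse L L'
    (fun x => by
      ext1
      · simp [L, L']; field_simp
      · simp [L, L'])
    (fun x => by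
      ext1
      · simp [L, L']; field_simp; ring
      · simp [L, L'])
  have hinv : (fderiv ℂ Φ u ∘L .inr ℂ ℂ (ℂ × Y)).IsInvertible := by
    have h1 : HasFDerivAt (fun y => Φ (0, y)) (fderiv ℂ Φ u ∘L .inr ℂ ℂ (ℂ × Y)) (μ₀, f₀) :=
      HasFDerivAt.comp (μ₀, f₀) (f := fun y => ((0 : ℂ), y)) (g := Φ)
        ((hΦ.differentiable (by simp)) u).hasFDerivAt (hasFDerivAt_prodMk_right _ _)
    have h3 : HasFDerivAt (fun y => Φ (0, y)) L (μ₀, f₀) := by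
      have e1 : (fun y => Φ (0, y)) = fun y : ℂ × Y => (l y.2 - y.1 ^ 2, y.2 - f₀) := by
        funext y; simp [Φ]
      rw [e1]
      refine HasFDerivAt.prodMk ?_ (hasFDerivAt_snd.sub_const _)
      refine ((l.hasFDerivAt.comp _ hasFDerivAt_snd).sub (hasFDerivAt_fst.pow 2)).congr_fderiv ?_
      ext <;> simp
    rw [h1.unique h3]
    exact ⟨e, rfl⟩
  have hω : (ω : ℕ∞ω) ≠ 0 := by simp
  set ψ := (hΦ.contDiffAt (x := u)).implicitFunction hω hinv with hψ
  have hψ0 : ψ 0 = (μ₀, f₀) := (hΦ.contDiffAt (x := u)).implicitFunction_apply_self hω hinv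
  have hψd : ContDiffAt ℂ ω ψ 0 := (hΦ.contDiffAt (x := u)).contDiffAt_implicitFunction hω hinv
  have hψe : ∀ᶠ s in 𝓝 (0 : ℂ), Φ (s, ψ s) = 0 := by
    have := (hΦ.contDiffAt (x := u)).eventually_apply_implicitFunction hω hinv
    rwa [hΦu] at this
  have hψu : ∀ᶠ v in 𝓝 u, Φ v = 0 ↔ ψ v.1 = v.2 := by
    have := (hΦ.contDiffAt (x := u)).eventually_apply_eq_iff_implicitFunction hω hinv
    rwa [hΦu] at this
  have hconj : Tendsto (fun s : ℂ => conj s) (𝓝 0) (𝓝 0) := by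
    simpa using (Complex.continuous_conj.tendsto 0)
  have hψs : ∀ᶠ s in 𝓝 (0 : ℂ), ψ s = (conj (ψ (conj s)).1, star (ψ (conj s)).2) := by
    have hc : Tendsto (fun s => (s, (conj (ψ (conj s)).1, star (ψ (conj s)).2))) (𝓝 (0 : ℂ))
        (𝓝 u) := by
      have h1 : Tendsto (fun s => ψ (conj s)) (𝓝 0) (𝓝 (μ₀, f₀)) := by
        rw [← hψ0]; exact hψd.continuousAt.tendsto.comp hconj
      refine tendsto_id.prodMk_nhds (Tendsto.prodMk_nhds ?_ ?_)
      · have := (Complex.continuous_conj.tendsto _).comp ((continuous_fst.tendsto _).comp h1)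
        rwa [hμ₀] at this
      · have := (continuous_star.tendsto _).comp ((continuous_snd.tendsto _).comp h1)
        rwa [hf₀] at this
    filter_upwards [hc.eventually hψu, hconj.eventually hψe] with s hs1 hs2
    refine hs1.1 ?_
    have h4 := congrArg Prod.fst hs2
    have h5 := congrArg Prod.snd hs2
    simp only [Φ, Prod.fst_zero, Prod.snd_zero] at h4 h5
    refine Prod.ext ?_ ?_
    · simp only [Φ, hl, Prod.fst_zero]
      rw [← map_pow, ← map_sub, h4, map_zero]
    · simp only [Φ, Prod.snd_zero]
      have h6 := hRs (conj s) (ψ (conj s)).1 (ψ (conj s)).2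
      rw [Complex.conj_conj] at h6
      have h7 := congrArg star h5
      rw [star_add, star_sub, star_smul, hf₀, star_zero, ← starRingEnd_apply,
        Complex.conj_conj] at h7
      rw [h6, h7]
  obtain ⟨r, hr, hball⟩ := Metric.eventually_nhds_iff_ball.1
    ((hψd.eventually (by simp)).and (hψe.and hψs))
  refine ⟨r, hr, fun s => (ψ s).1, fun s => (ψ s).2, by simp only [hψ0], by simp only [hψ0], fun s hs => ?_⟩
  obtain ⟨h1, h3, h4⟩ := hball s hs
  have hs' : conj s ∈ Metric.ball (0 : ℂ) r := by simpa using hs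
  have h5 := (hball _ hs').2.2
  rw [Complex.conj_conj] at h5
  have h6 := congrArg Prod.fst h3
  have h7 := congrArg Prod.snd h3
  simp only [Φ, Prod.fst_zero, Prod.snd_zero] at h6 h7
  refine ⟨contDiffAt_fst.comp s (h1.of_le (by simp)), contDiffAt_snd.comp s (h1.of_le (by simp)), ?_,
    sub_eq_zero.1 h6, by simp only [h5], by simp only [h5]⟩
  rw [eq_sub_iff_add_eq, ← sub_eq_zero, ← h7]
  abel

end branch

/-! ### Profiles of the solitary wave -/

open Polynomial

/-- The profile `(1 - T²) (g(T) + z r(T))` with `T = tanh θz`. -/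
def sechProfile (g r : ℝ[X]) : ℝ[X] × ℝ[X] := ((1 + X) * g, r)

theorem profile_sechProfile (θ : ℝ) (g r : ℝ[X]) (z : ℝ) :
    profile θ (sechProfile g r) z = (1 - Real.tanh (θ * z) ^ 2) *
      (g.eval (Real.tanh (θ * z)) + z * r.eval (Real.tanh (θ * z))) := by
  simp only [profile, sechProfile, eval_mul, eval_add, eval_one, eval_X]; ring

theorem profileDeriv_sechProfile (θ : ℝ) (g r : ℝ[X]) :
    profileDeriv θ (sechProfile g r) =
      sechProfile (C θ * (-2 * X * g + (1 - X ^ 2) * derivative g) + r)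
        (C θ * (-2 * X * r + (1 - X ^ 2) * derivative r)) := by
  simp only [profileDeriv, sechProfile, derivative_mul, derivative_add, derivative_one, derivative_X]
  ext1 <;> ring

theorem sechProfile_congr {g g' r r' : ℝ[X]} (h1 : g = g') (h2 : r = r') :
    sechProfile g r = sechProfile g' r' := by rw [h1, h2]

section jets

set_option linter.unusedSimpArgs false

variable (θ κ A m : ℝ)

/-- The derivatives of the solitary wave `κ sech² θz`. -/
def sechJet (j : ℕ) : ℝ[X] × ℝ[X] := (profileDeriv θ)^[j] (sechProfile (C κ) 0)

theorem sechJet_succ (j : ℕ) : sechJet θ κ (j + 1) = profileDeriv θ (sechJet θ κ j) :=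
  Function.iterate_succ_apply' _ _ _

theorem sechJet_one : sechJet θ κ 1 = sechProfile (C (κ * θ) * (-2 * X)) 0 := by
  rw [sechJet_succ, sechJet, Function.iterate_zero, id, profileDeriv_sechProfile]
  apply sechProfile_congr <;>
    simp only [derivative_C, derivative_C_mul, derivative_mul, derivative_sub, derivative_add,
      derivative_neg, derivative_ofNat, derivative_X, derivative_X_pow, derivative_zero, derivative_one] <;>
    (try simp only [C_mul, C_pow, C_add, C_neg, map_ofNat, Nat.cast_ofNat, Nat.reduceSub]) <;> ring

theorem sechJet_two : sechJet θ κ 2 = sechProfile (C (κ * θ ^ 2) * (6 * X ^ 2 - 2)) 0 := by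
  rw [sechJet_succ, sechJet_one, profileDeriv_sechProfile]
  apply sechProfile_congr <;>
    simp only [derivative_C, derivative_C_mul, derivative_mul, derivative_sub, derivative_add,
      derivative_neg, derivative_ofNat, derivative_X, derivative_X_pow, derivative_zero, derivative_one] <;>
    (try simp only [C_mul, C_pow, C_add, C_neg, map_ofNat, Nat.cast_ofNat, Nat.reduceSub]) <;> ring

theorem sechJet_three : sechJet θ κ 3 = sechProfile (C (κ * θ ^ 3) * (16 * X - 24 * X ^ 3)) 0 := by
  rw [sechJet_succ, sechJet_two, profileDeriv_sechProfile]
  apply sechProfile_congr <;>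
    simp only [derivative_C, derivative_C_mul, derivative_mul, derivative_sub, derivative_add,
      derivative_neg, derivative_ofNat, derivative_X, derivative_X_pow, derivative_zero, derivative_one] <;>
    (try simp only [C_mul, C_pow, C_add, C_neg, map_ofNat, Nat.cast_ofNat, Nat.reduceSub]) <;> ring

/-- The derivatives of `(1 - T) A + z (1 - T²) m`. -/
def primJet (j : ℕ) : ℝ[X] × ℝ[X] := (profileDeriv θ)^[j] (C A, C m)

theorem primJet_succ (j : ℕ) : primJet θ A m (j + 1) = profileDeriv θ (primJet θ A m j) :=
  Function.iterate_succ_apply' _ _ _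

theorem primJet_one :
    primJet θ A m 1 = sechProfile (C (-(θ * A) + m)) (C (θ * m) * (-2 * X)) := by
  rw [primJet_succ, primJet, Function.iterate_zero, id, profileDeriv, sechProfile]
  simp only [derivative_C, C_mul, C_add, C_neg]
  ext1 <;> ring

theorem primJet_two :
    primJet θ A m 2 = sechProfile (C (θ * (-(θ * A) + 2 * m)) * (-2 * X))
      (C (θ ^ 2 * m) * (6 * X ^ 2 - 2)) := by
  rw [primJet_succ, primJet_one, profileDeriv_sechProfile]
  apply sechProfile_congr <;>
    simp only [derivative_C, derivative_C_mul, derivative_mul, derivative_sub, derivative_add,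
      derivative_neg, derivative_ofNat, derivative_X, derivative_X_pow, derivative_zero, derivative_one] <;>
    (try simp only [C_mul, C_pow, C_add, C_neg, map_ofNat, Nat.cast_ofNat, Nat.reduceSub]) <;> ring

theorem primJet_three :
    primJet θ A m 3 = sechProfile (C (θ ^ 2 * (-(θ * A) + 3 * m)) * (6 * X ^ 2 - 2))
      (C (θ ^ 3 * m) * (16 * X - 24 * X ^ 3)) := by
  rw [primJet_succ, primJet_two, profileDeriv_sechProfile]
  apply sechProfile_congr <;>
    simp only [derivative_C, derivative_C_mul, derivative_mul, derivative_sub, derivative_add,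
      derivative_neg, derivative_ofNat, derivative_X, derivative_X_pow, derivative_zero, derivative_one] <;>
    (try simp only [C_mul, C_pow, C_add, C_neg, map_ofNat, Nat.cast_ofNat, Nat.reduceSub]) <;> ring

theorem primJet_four :
    primJet θ A m 4 = sechProfile (C (θ ^ 3 * (-(θ * A) + 4 * m)) * (16 * X - 24 * X ^ 3))
      (C (θ ^ 4 * m) * (16 - 120 * X ^ 2 + 120 * X ^ 4)) := by
  rw [primJet_succ, primJet_three, profileDeriv_sechProfile]
  apply sechProfile_congr <;>
    simp only [derivative_C, derivative_C_mul, derivative_mul, derivative_sub, derivative_add,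
      derivative_neg, derivative_ofNat, derivative_X, derivative_X_pow, derivative_zero, derivative_one] <;>
    (try simp only [C_mul, C_pow, C_add, C_neg, map_ofNat, Nat.cast_ofNat, Nat.reduceSub]) <;> ring

end jets

/-! ### The solitary wave and its dependence on the speed -/

/-- The standing conditions on the parameters. -/
structure Admissible (a b c : ℝ) : Prop where
  ha : 0 < a
  hab : a < b
  hc : 1 < c

/-- The scale `θ = α_c / 2` of the solitary wave. -/
def theta (a b c : ℝ) : ℝ := alphaC a b c / 2

/-- The coefficient `bc² - a` of the highest derivative. -/
def disp (a b c : ℝ) : ℝ := b * c ^ 2 - a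

/-- Half of the mass `∫ ∂_c q_c`. -/
def halfMass (a b c : ℝ) : ℝ := (1 + 1 / c ^ 2 - (b - a) / disp a b c) / theta a b c

/-- The `j`-th derivative of the solitary wave `q_c`, as a profile. -/
def qJ (a b c : ℝ) (j : ℕ) : ℝ[X] × ℝ[X] := sechJet (theta a b c) ((c ^ 2 - 1) / c) j

/-- The `j`-th derivative of the primitive `∫_z^∞ ∂_c q_c`, as a profile. -/
def uJ (a b c : ℝ) (j : ℕ) : ℝ[X] × ℝ[X] :=
  primJet (theta a b c) (halfMass a b c) (-((b - a) / disp a b c)) j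

namespace Admissible

variable {a b c : ℝ}

theorem c_pos (h : Admissible a b c) : 0 < c := by linarith [h.hc]

theorem sq_sub_pos (h : Admissible a b c) : 0 < c ^ 2 - 1 := by nlinarith [h.hc]

theorem disp_pos (h : Admissible a b c) : 0 < disp a b c := by
  have := h.ha; have := h.hab; have := h.hc
  unfold disp
  nlinarith [mul_pos (h.ha.trans h.hab) h.sq_sub_pos]

theorem theta_pos (h : Admissible a b c) : 0 < theta a b c :=
  half_pos (Real.sqrt_pos.2 (div_pos h.sq_sub_pos h.disp_pos))

theorem theta_sq (h : Admissible a b c) : 4 * disp a b c * theta a b c ^ 2 = c ^ 2 - 1 := by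
  have h1 : alphaC a b c ^ 2 = (c ^ 2 - 1) / disp a b c :=
    Real.sq_sqrt (div_pos h.sq_sub_pos h.disp_pos).le
  have h2 := h.disp_pos.ne'
  rw [theta, div_pow, h1]
  field_simp
  ring

theorem qc_eq (a b c z : ℝ) : qc a b c z = profile (theta a b c) (qJ a b c 0) z := by
  have e : alphaC a b c * z / 2 = theta a b c * z := by rw [theta]; ring
  rw [qc, e, one_div, inv_pow, ← one_div, ← one_sub_tanh_sq]
  rw [qJ, sechJet, Function.iterate_zero, id, profile_sechProfile, eval_C, eval_zero, mul_zero, add_zero]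
  ring

theorem hasDerivAt_theta (h : Admissible a b c) :
    HasDerivAt (fun s => theta a b s)
      (c * (b - a) / (4 * theta a b c * disp a b c ^ 2)) c := by
  have hd := h.disp_pos
  have h1 : HasDerivAt (fun s : ℝ => (s ^ 2 - 1) / (b * s ^ 2 - a))
      ((2 * c * disp a b c - (c ^ 2 - 1) * (b * (2 * c))) / disp a b c ^ 2) c := by
    have h2 : HasDerivAt (fun s : ℝ => s ^ 2) (2 * c) c := by simpa using hasDerivAt_pow 2 c
    exact (h2.sub_const 1).div ((h2.const_mul b).sub_const a) hd.ne'
  have h3 := (h1.sqrt (div_pos h.sq_sub_pos hd).ne').div_const 2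
  refine h3.congr_deriv ?_
  have hs : Real.sqrt ((c ^ 2 - 1) / (b * c ^ 2 - a)) = 2 * theta a b c := by
    rw [theta, alphaC]; ring
  rw [hs]
  have ht := h.theta_pos.ne'
  have hd' := hd.ne'
  field_simp
  rw [disp]; ring

theorem hasDerivAt_qc (h : Admissible a b c) (z : ℝ) :
    HasDerivAt (fun s => qc a b s z)
      (-profile (theta a b c) (uJ a b c 1) z) c := by
  have hc := h.c_pos.ne'
  have ht := h.theta_pos.ne'
  have hd := h.disp_pos.ne'
  have h1 : HasDerivAt (fun s : ℝ => (s ^ 2 - 1) / s) (1 + 1 / c ^ 2) c := by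
    have h2 : HasDerivAt (fun s : ℝ => s ^ 2) (2 * c) c := by simpa using hasDerivAt_pow 2 c
    refine ((h2.sub_const 1).div (hasDerivAt_id c) hc).congr_deriv ?_
    simp only [id]; field_simp; ring
  have h2 : HasDerivAt (fun s => Real.tanh (theta a b s * z))
      ((1 - Real.tanh (theta a b c * z) ^ 2) *
        (c * (b - a) / (4 * theta a b c * disp a b c ^ 2) * z)) c := by
    have h3 := hasDerivAt_tanh_mul 1 (theta a b c * z)
    simp only [one_mul] at h3
    exact h3.comp c (h.hasDerivAt_theta.mul_const z)
  have e : (fun s => qc a b s z) =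
      fun s => (s ^ 2 - 1) / s * (1 - Real.tanh (theta a b s * z) ^ 2) := by
    funext s
    rw [qc_eq]
    rw [qJ, sechJet, Function.iterate_zero, id, profile_sechProfile, eval_C, eval_zero, mul_zero, add_zero]
    ring
  rw [e]
  have h6 : theta a b c * halfMass a b c = 1 + 1 / c ^ 2 - (b - a) / disp a b c :=
    mul_div_cancel₀ _ ht
  have h4 := h.theta_sq
  have h5 : (c ^ 2 - 1) / c * (c * (b - a) / (4 * theta a b c * disp a b c ^ 2)) =
      theta a b c * ((b - a) / disp a b c) := by
    field_simp
    linear_combination -(b - a) * h4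
  refine (h1.mul ((h2.pow 2).const_sub 1)).congr_deriv ?_
  rw [uJ, primJet_one, profile_sechProfile]
  simp only [eval_mul, eval_C, eval_X, eval_neg, eval_ofNat, Pi.pow_apply]
  push_cast
  generalize Real.tanh (theta a b c * z) = T
  linear_combination -2 * T * (1 - T ^ 2) * z * h5 - (1 - T ^ 2) * h6

theorem qJ_succ (a b c : ℝ) (j : ℕ) :
    qJ a b c (j + 1) = profileDeriv (theta a b c) (qJ a b c j) := sechJet_succ _ _ _

theorem uJ_succ (a b c : ℝ) (j : ℕ) :
    uJ a b c (j + 1) = profileDeriv (theta a b c) (uJ a b c j) := primJet_succ _ _ _ _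

theorem hasDerivAt_qJ (a b c : ℝ) (j : ℕ) (z : ℝ) :
    HasDerivAt (profile (theta a b c) (qJ a b c j)) (profile (theta a b c) (qJ a b c (j + 1)) z) z := by
  rw [qJ_succ]; exact hasDerivAt_profile _ _ _

theorem hasDerivAt_uJ (a b c : ℝ) (j : ℕ) (z : ℝ) :
    HasDerivAt (profile (theta a b c) (uJ a b c j)) (profile (theta a b c) (uJ a b c (j + 1)) z) z := by
  rw [uJ_succ]; exact hasDerivAt_profile _ _ _

theorem qcz_eq (a b c z : ℝ) : qcz a b c z = profile (theta a b c) (qJ a b c 1) z := by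
  rw [qcz, funext (qc_eq a b c)]; exact (hasDerivAt_qJ a b c 0 z).deriv

theorem rcz_eq (a b c z : ℝ) : rcz a b c z = -c * qcz a b c z := by
  rw [qcz_eq, rcz]
  have : (fun x => rc a b c x) = fun x => -c * profile (theta a b c) (qJ a b c 0) x := by
    funext x; rw [rc, qc_eq]
  rw [this]
  exact ((hasDerivAt_qJ a b c 0 z).const_mul _).deriv

theorem dcqc_eq (h : Admissible a b c) (z : ℝ) :
    dcqc a b c z = -profile (theta a b c) (uJ a b c 1) z := (h.hasDerivAt_qc z).deriv

theorem dcrc_eq (h : Admissible a b c) (z : ℝ) :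
    dcrc a b c z = c * profile (theta a b c) (uJ a b c 1) z - qc a b c z := by
  refine ((((hasDerivAt_id c).neg).mul (h.hasDerivAt_qc z)).deriv).trans ?_
  simp only [id, Pi.neg_apply]; ring

theorem intRight_eq (h : Admissible a b c) (z : ℝ) :
    intRight a b c z = profile (theta a b c) (uJ a b c 0) z := by
  rw [intRight, funext h.dcqc_eq, integral_neg, uJ_succ, integral_Ioi_profile_deriv h.theta_pos,
    neg_neg]

theorem intLeft_eq (h : Admissible a b c) (z : ℝ) :
    intLeft a b c z = profile (theta a b c) (uJ a b c 0) (-z) := by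
  rw [intLeft, funext h.dcqc_eq, integral_neg, uJ_succ, integral_Iic_profile_deriv h.theta_pos]
  simp only [uJ, primJet, Function.iterate_zero, id, profile, eval_C, mul_neg, Real.tanh_neg]
  ring

/-! ### Differential equations for the solitary wave and its `c`-derivative -/

theorem disp_eq (h : Admissible a b c) :
    disp a b c = (c ^ 2 - 1) / (4 * theta a b c ^ 2) := by
  have := h.theta_pos.ne'
  rw [eq_div_iff (by positivity)]
  linarith [h.theta_sq]

theorem b_eq (h : Admissible a b c) :
    b = (1 - (b - a) / disp a b c) / (4 * theta a b c ^ 2) := by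
  have h1 := h.theta_pos.ne'
  have h2 := h.disp_pos.ne'
  have h3 := h.theta_sq
  rw [eq_div_iff (by positivity), eq_sub_iff_add_eq, ← eq_sub_iff_add_eq', div_eq_iff h2]
  have h4 : disp a b c = b * c ^ 2 - a := rfl
  linear_combination b * h3 - h4

theorem soliton_eq (h : Admissible a b c) (z : ℝ) :
    (c ^ 2 - 1) * profile (theta a b c) (qJ a b c 1) z -
      disp a b c * profile (theta a b c) (qJ a b c 3) z =
    3 * c * (profile (theta a b c) (qJ a b c 0) z * profile (theta a b c) (qJ a b c 1) z) := by
  have hc := h.c_pos.ne'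
  have ht := h.theta_pos.ne'
  simp only [qJ, sechJet_one, sechJet_three, profile_sechProfile]
  rw [sechJet, Function.iterate_zero, id, profile_sechProfile, h.disp_eq]
  simp only [eval_C, eval_mul, eval_sub, eval_neg, eval_pow, eval_ofNat, eval_X, eval_zero]
  field_simp
  ring

theorem soliton_eq_deriv (h : Admissible a b c) (z : ℝ) :
    (c ^ 2 - 1) * profile (theta a b c) (qJ a b c 2) z -
      disp a b c * profile (theta a b c) (qJ a b c 4) z =
    3 * c * (profile (theta a b c) (qJ a b c 1) z * profile (theta a b c) (qJ a b c 1) z +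
      profile (theta a b c) (qJ a b c 0) z * profile (theta a b c) (qJ a b c 2) z) := by
  have h1 := ((hasDerivAt_qJ a b c 1 z).const_mul (c ^ 2 - 1)).sub
    ((hasDerivAt_qJ a b c 3 z).const_mul (disp a b c))
  have h2 := ((hasDerivAt_qJ a b c 0 z).mul (hasDerivAt_qJ a b c 1 z)).const_mul (3 * c)
  refine h1.unique (h2.congr_of_eventuallyEq (Eventually.of_forall fun x => ?_))
  exact h.soliton_eq x

/-- The `c`-derivative of the equation for the solitary wave, for the primitive of `-∂_c q_c`. -/
theorem primitive_eq (h : Admissible a b c) (z : ℝ) :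
    (c ^ 2 - 1) * profile (theta a b c) (uJ a b c 2) z -
      disp a b c * profile (theta a b c) (uJ a b c 4) z -
      3 * c * (profile (theta a b c) (qJ a b c 1) z * profile (theta a b c) (uJ a b c 1) z +
        profile (theta a b c) (qJ a b c 0) z * profile (theta a b c) (uJ a b c 2) z) +
      (-(2 * c) * (profile (theta a b c) (qJ a b c 1) z - b * profile (theta a b c) (qJ a b c 3) z) +
        3 * (profile (theta a b c) (qJ a b c 0) z * profile (theta a b c) (qJ a b c 1) z)) = 0 := by
  have hc := h.c_pos.ne'
  have ht := h.theta_pos.ne'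
  have e1 := h.disp_eq
  have e2 := h.b_eq
  have e3 : halfMass a b c = (1 + 1 / c ^ 2 - (b - a) / disp a b c) / theta a b c := rfl
  simp only [qJ, uJ, sechJet_one, sechJet_three, primJet_one, primJet_two, primJet_four,
    profile_sechProfile]
  rw [sechJet, Function.iterate_zero, id, profile_sechProfile, e3]
  simp only [eval_C, eval_mul, eval_sub, eval_add, eval_neg, eval_pow, eval_ofNat, eval_X, eval_zero]
  generalize (b - a) / disp a b c = n at e2 ⊢
  generalize disp a b c = β at e1 ⊢
  generalize theta a b c = θ at ht e1 e2 ⊢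
  generalize Real.tanh (θ * z) = T
  subst e1 e2
  field_simp
  ring

end Admissible

/-! ### Integrals of hyperbolic functions -/

open Polynomial

/-- The function `f` is integrable on the line, with integral `v`. -/
def HasInt (f : ℝ → ℝ) (v : ℝ) : Prop := Integrable f ∧ ∫ z, f z = v

namespace HasInt

variable {f g : ℝ → ℝ} {v w : ℝ}

theorem add (hf : HasInt f v) (hg : HasInt g w) : HasInt (fun z => f z + g z) (v + w) :=
  ⟨hf.1.add hg.1, by rw [integral_add hf.1 hg.1, hf.2, hg.2]⟩

theorem const_mul (r : ℝ) (hf : HasInt f v) : HasInt (fun z => r * f z) (r * v) :=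
  ⟨hf.1.const_mul r, by rw [integral_const_mul, hf.2]⟩

/-- Only the even part of a function contributes to its integral. -/
theorem of_even_part (hf : Integrable f) (h : HasInt g v) (hfg : ∀ z, f z + f (-z) = 2 * g z) :
    HasInt f v := by
  refine ⟨hf, ?_⟩
  have h1 : ∫ z, (f z + f (-z)) = (∫ z, f z) + ∫ z, f z := by
    rw [integral_add hf hf.comp_neg, integral_neg_eq_self f volume]
  simp only [hfg] at h1
  rw [integral_const_mul, h.2] at h1
  linarith

theorem of_profileDeriv {θ : ℝ} (hθ : 0 < θ) (P : ℝ[X] × ℝ[X])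
    (h : ∀ z, profile θ (profileDeriv θ P) z = f z) (hv : -(2 * P.1.eval (-1)) = v) : HasInt f v := by
  rw [← funext h, ← hv]
  exact ⟨integrable_profile_deriv hθ P, integral_profile_deriv hθ P⟩

end HasInt

section basic

variable {θ : ℝ}

theorem hasInt_sech_two (hθ : 0 < θ) : HasInt (fun z => 1 - Real.tanh (θ * z) ^ 2) (2 / θ) := by
  have := hθ.ne'
  refine .of_profileDeriv hθ (C (-(1 / θ)), 0) (fun z => ?_) (by simp; ring)
  simp [profile, profileDeriv]
  field_simp
  ring

theorem hasInt_sech_four (hθ : 0 < θ) :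
    HasInt (fun z => (1 - Real.tanh (θ * z) ^ 2) ^ 2) (4 / (3 * θ)) := by
  have := hθ.ne'
  refine .of_profileDeriv hθ (C (-(1 / (3 * θ))) * ((1 - X) * (X + 2)), 0) (fun z => ?_)
    (by simp; ring)
  simp [profile, profileDeriv]
  field_simp
  ring

theorem hasInt_sech_six (hθ : 0 < θ) :
    HasInt (fun z => (1 - Real.tanh (θ * z) ^ 2) ^ 3) (16 / (15 * θ)) := by
  have := hθ.ne'
  refine .of_profileDeriv hθ
    (C (-(1 / (15 * θ))) * ((1 - X) ^ 2 * (3 * X ^ 2 + 9 * X + 8)), 0) (fun z => ?_)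
    (by simp; ring)
  simp [profile, profileDeriv, derivative_pow]
  field_simp
  ring

theorem hasInt_id_sech_two (hθ : 0 < θ) :
    HasInt (fun z => z * ((1 - Real.tanh (θ * z) ^ 2) * Real.tanh (θ * z))) (1 / θ ^ 2) := by
  have := hθ.ne'
  refine .of_profileDeriv hθ (C (-(1 / (2 * θ ^ 2))), C (-(1 / (2 * θ)))) (fun z => ?_)
    (by simp; ring)
  simp [profile, profileDeriv]
  field_simp
  ring

theorem hasInt_id_sech_four (hθ : 0 < θ) :
    HasInt (fun z => z * ((1 - Real.tanh (θ * z) ^ 2) ^ 2 * Real.tanh (θ * z)))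
      (1 / (3 * θ ^ 2)) := by
  have := hθ.ne'
  refine .of_profileDeriv hθ (C (-(1 / (12 * θ ^ 2))) * ((1 - X) * (X + 2)),
    C (-(1 / (4 * θ))) * (1 - X ^ 2)) (fun z => ?_) (by simp; ring)
  simp [profile, profileDeriv]
  field_simp
  ring

theorem hasInt_id_sech_six (hθ : 0 < θ) :
    HasInt (fun z => z * ((1 - Real.tanh (θ * z) ^ 2) ^ 3 * Real.tanh (θ * z)))
      (8 / (45 * θ ^ 2)) := by
  have := hθ.ne'
  refine .of_profileDeriv hθ
    (C (-(1 / (90 * θ ^ 2))) * ((1 - X) ^ 2 * (3 * X ^ 2 + 9 * X + 8)),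
    C (-(1 / (6 * θ))) * (1 - X ^ 2) ^ 2) (fun z => ?_) (by simp; ring)
  simp [profile, profileDeriv, derivative_pow]
  field_simp
  ring

end basic

/-! ### Pairings with the solitary wave -/

/-- The `j`-th derivative of the solitary wave. -/
abbrev sol (a b c : ℝ) (j : ℕ) : ℝ → ℝ := profile (theta a b c) (qJ a b c j)

/-- The `j`-th derivative of the primitive `∫_z^∞ ∂_c q_c`. -/
abbrev prim (a b c : ℝ) (j : ℕ) : ℝ → ℝ := profile (theta a b c) (uJ a b c j)

/-- The coefficient of `λ²` when the operator pencil at `η = 0` is applied to `q_c + λ ∫_z^∞ ∂_c q_c`. -/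
def chiFun (a b c z : ℝ) : ℝ :=
  -(2 * c) * (prim a b c 1 z - b * prim a b c 3 z) + 2 * (sol a b c 0 z * prim a b c 1 z) +
    sol a b c 1 z * prim a b c 0 z + (sol a b c 0 z - b * sol a b c 2 z)

/-- The coefficient of `-η²` in the operator pencil at `λ = 0`, applied to the solitary wave. -/
def forceFun (a b c z : ℝ) : ℝ :=
  -sol a b c 0 z + (2 * a - b * c ^ 2) * sol a b c 2 z - c * (sol a b c 0 z * sol a b c 0 z)

/-- The density of the second-order solvability condition, for the first-order coefficient whose
square is `M`. -/
def secondFun (a b c M z : ℝ) : ℝ :=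
  (-forceFun a b c z - M * chiFun a b c z) * prim a b c 0 (-z) -
    M * ((prim a b c 0 z - b * prim a b c 2 z) * sol a b c 0 z) -
    (-prim a b c 0 z + (2 * a - b * c ^ 2) * prim a b c 2 z -
      c * (sol a b c 0 z * prim a b c 0 z)) * sol a b c 0 z -
    2 * b * c * (sol a b c 1 z * sol a b c 0 z)

section pairings

variable {a b c : ℝ}

theorem prim_zero_apply (a b c z : ℝ) : prim a b c 0 z =
    (1 - Real.tanh (theta a b c * z)) * halfMass a b c +
      z * (1 - Real.tanh (theta a b c * z) ^ 2) * (-((b - a) / disp a b c)) := by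
  simp only [prim, uJ, primJet, Function.iterate_zero, id, profile, eval_C]

theorem sol_zero_apply (a b c z : ℝ) : sol a b c 0 z =
    (c ^ 2 - 1) / c * (1 - Real.tanh (theta a b c * z) ^ 2) := by
  rw [sol, qJ, sechJet, Function.iterate_zero, id, profile_sechProfile, eval_C, eval_zero]; ring

theorem sol_neg (a b c z : ℝ) : sol a b c 0 (-z) = sol a b c 0 z := by
  rw [sol_zero_apply, sol_zero_apply, mul_neg, Real.tanh_neg, neg_sq]

namespace Admissible

theorem hasInt_combination (h : Admissible a b c) (k₁ k₂ k₃ l₁ l₂ l₃ : ℝ) :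
    HasInt (fun z =>
      k₁ * (1 - Real.tanh (theta a b c * z) ^ 2) + k₂ * (1 - Real.tanh (theta a b c * z) ^ 2) ^ 2 +
      k₃ * (1 - Real.tanh (theta a b c * z) ^ 2) ^ 3 +
      l₁ * (z * ((1 - Real.tanh (theta a b c * z) ^ 2) * Real.tanh (theta a b c * z))) +
      l₂ * (z * ((1 - Real.tanh (theta a b c * z) ^ 2) ^ 2 * Real.tanh (theta a b c * z))) +
      l₃ * (z * ((1 - Real.tanh (theta a b c * z) ^ 2) ^ 3 * Real.tanh (theta a b c * z))))
      (k₁ * (2 / theta a b c) + k₂ * (4 / (3 * theta a b c)) + k₃ * (16 / (15 * theta a b c)) +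
        l₁ * (1 / theta a b c ^ 2) + l₂ * (1 / (3 * theta a b c ^ 2)) +
        l₃ * (8 / (45 * theta a b c ^ 2))) := by
  have ht := h.theta_pos
  exact ((((((hasInt_sech_two ht).const_mul k₁).add ((hasInt_sech_four ht).const_mul k₂)).add
    ((hasInt_sech_six ht).const_mul k₃)).add ((hasInt_id_sech_two ht).const_mul l₁)).add
    ((hasInt_id_sech_four ht).const_mul l₂)).add ((hasInt_id_sech_six ht).const_mul l₃)

/-- The quotient `(b - a)/(bc² - a)` lies between `0` and `c⁻²`. -/
theorem quot_bounds (h : Admissible a b c) :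
    0 < (b - a) / disp a b c ∧ (b - a) / disp a b c * c ^ 2 < 1 := by
  have h1 := h.disp_pos
  refine ⟨div_pos (sub_pos.2 h.hab) h1, ?_⟩
  rw [div_mul_eq_mul_div, div_lt_one h1, disp]
  nlinarith [h.ha, h.sq_sub_pos]

theorem halfMass_pos (h : Admissible a b c) : 0 < halfMass a b c := by
  have h1 := h.quot_bounds
  have h2 : 0 < 1 / c ^ 2 := by have := h.c_pos; positivity
  refine div_pos ?_ h.theta_pos
  nlinarith [h.sq_sub_pos]

end Admissible

/-- The factor by which the norming constant exceeds `(4 / 3θ) κ` with `κ` the amplitude of the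
solitary wave; here `n = (b - a)/(bc² - a)`. -/
def normFactor (c n : ℝ) : ℝ :=
  9 / 5 * c + 1 / c + 6 / (5 * c ^ 3) - n * (3 / 5 * c + 2 / (5 * c)) +
    (1 - n) * (3 / 5 * c + 1 / (5 * c) + 1 / 5 * c * n)

theorem normFactor_lower {n : ℝ} (hc : 1 < c) (hn : 0 < n) (hn' : n * c ^ 2 < 1) :
    9 / 5 * c ^ 4 + 2 / 5 * c ^ 2 + 4 / 5 < c ^ 3 * normFactor c n := by
  have hc0 : 0 < c := by linarith
  have hn1 : n < 1 := by nlinarith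
  have h1 : 0 < (1 - n) * (3 / 5 * c + 1 / (5 * c) + 1 / 5 * c * n) := by
    have : 0 < 1 - n := by linarith
    positivity
  have h2 : c ^ 3 * (n * (3 / 5 * c + 2 / (5 * c))) = n * c ^ 2 * (3 / 5 * c ^ 2 + 2 / 5) := by
    field_simp
  have h3 : c ^ 3 * (9 / 5 * c + 1 / c + 6 / (5 * c ^ 3)) = 9 / 5 * c ^ 4 + c ^ 2 + 6 / 5 := by
    field_simp
  have h4 : n * c ^ 2 * (3 / 5 * c ^ 2 + 2 / 5) < 1 * (3 / 5 * c ^ 2 + 2 / 5) := by gcongr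
  have h5 := mul_pos (pow_pos hc0 3) h1
  have h6 : c ^ 3 * normFactor c n = c ^ 3 * (9 / 5 * c + 1 / c + 6 / (5 * c ^ 3)) -
      c ^ 3 * (n * (3 / 5 * c + 2 / (5 * c))) +
      c ^ 3 * ((1 - n) * (3 / 5 * c + 1 / (5 * c) + 1 / 5 * c * n)) := by rw [normFactor]; ring
  rw [h6, h2, h3]
  linarith

theorem normFactor_pos {n : ℝ} (hc : 1 < c) (hn : 0 < n) (hn' : n * c ^ 2 < 1) :
    0 < normFactor c n := by
  have h1 := normFactor_lower hc hn hn'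
  have hc0 : 0 < c := by linarith
  exact (pos_iff_pos_of_mul_pos (lt_trans (by positivity) h1)).1 (by positivity)

namespace Admissible

theorem hasInt_chiFun (h : Admissible a b c) (hi : Integrable fun z => chiFun a b c z * sol a b c 0 z) :
    HasInt (fun z => chiFun a b c z * sol a b c 0 z)
      (4 / (3 * theta a b c) * ((c ^ 2 - 1) / c) * normFactor c ((b - a) / disp a b c)) := by
  have hc := h.c_pos.ne'
  have ht := h.theta_pos.ne'
  have e1 := h.disp_eq
  have e2 := h.b_eq
  have e3 : halfMass a b c = (1 + 1 / c ^ 2 - (b - a) / disp a b c) / theta a b c := rfl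
  obtain ⟨θ, hθ⟩ : ∃ θ, θ = theta a b c := ⟨_, rfl⟩
  obtain ⟨κ, hκ⟩ : ∃ κ, κ = (c ^ 2 - 1) / c := ⟨_, rfl⟩
  obtain ⟨H, hH⟩ : ∃ H, H = halfMass a b c := ⟨_, rfl⟩
  obtain ⟨m, hm⟩ : ∃ m, m = -((b - a) / disp a b c) := ⟨_, rfl⟩
  have key := h.hasInt_combination 0
    (κ * (-(2 * c) * (-(θ * H) + m) + 8 * b * c * θ ^ 2 * (-(θ * H) + 3 * m)) +
      2 * κ ^ 2 * θ * H + κ ^ 2 - 4 * b * κ ^ 2 * θ ^ 2)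
    (-12 * b * c * κ * θ ^ 2 * (-(θ * H) + 3 * m) + 2 * κ ^ 2 * (-(θ * H) + m) -
      2 * κ ^ 2 * θ * H + 6 * b * κ ^ 2 * θ ^ 2) 0
    (κ * (4 * c * θ * m - 16 * b * c * θ ^ 3 * m)) (48 * b * c * κ * θ ^ 3 * m - 6 * κ ^ 2 * θ * m)
  have := HasInt.of_even_part hi key fun z => ?_
  · convert this using 1
    subst hm hH hκ hθ
    rw [e3, normFactor]
    generalize (b - a) / disp a b c = n at e2 ⊢
    generalize disp a b c = β at e1 ⊢
    generalize theta a b c = θ at ht e1 e2 ⊢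
    subst e1 e2
    field_simp
    ring
  · simp only [chiFun, prim_zero_apply, sol_zero_apply]
    simp only [prim, sol, qJ, uJ, sechJet_one, sechJet_two, primJet_one, primJet_three,
      profile_sechProfile]
    simp only [eval_C, eval_mul, eval_sub, eval_neg, eval_pow, eval_ofNat, eval_X,
      eval_zero, ← hθ, ← hm, ← hH, ← hκ]
    simp only [mul_neg, Real.tanh_neg]
    ring

theorem hasInt_forceFun (h : Admissible a b c)
    (hi : Integrable fun z => forceFun a b c z * sol a b c 0 z) :
    HasInt (fun z => forceFun a b c z * sol a b c 0 z)
      (-(4 / (3 * theta a b c) * ((c ^ 2 - 1) / c) ^ 2 *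
        (3 / 5 * c ^ 2 + 3 / 5 - 1 / 5 * ((b - a) / disp a b c) * c ^ 2))) := by
  have hc := h.c_pos.ne'
  have ht := h.theta_pos.ne'
  have e1 := h.disp_eq
  have e2 := h.b_eq
  have e4 : a = b * c ^ 2 - disp a b c := by rw [disp]; ring
  obtain ⟨θ, hθ⟩ : ∃ θ, θ = theta a b c := ⟨_, rfl⟩
  obtain ⟨κ, hκ⟩ : ∃ κ, κ = (c ^ 2 - 1) / c := ⟨_, rfl⟩
  have key := h.hasInt_combination 0 (-κ ^ 2 + 4 * (2 * a - b * c ^ 2) * κ ^ 2 * θ ^ 2)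
    (-6 * (2 * a - b * c ^ 2) * κ ^ 2 * θ ^ 2 - c * κ ^ 3) 0 0 0
  have := HasInt.of_even_part hi key fun z => ?_
  · convert this using 1
    subst hκ hθ
    rw [show 2 * a - b * c ^ 2 = b * c ^ 2 - 2 * disp a b c by rw [disp]; ring]
    generalize (b - a) / disp a b c = n at e2 ⊢
    generalize disp a b c = β at e1 ⊢
    generalize theta a b c = θ at ht e1 e2 ⊢
    clear e4
    subst e1 e2
    field_simp
    ring
  · simp only [forceFun, sol_zero_apply]
    simp only [sol, qJ, sechJet_two, profile_sechProfile]
    simp only [eval_C, eval_mul, eval_sub, eval_pow, eval_ofNat, eval_X,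
      eval_zero, ← hθ, ← hκ]
    simp only [mul_neg, Real.tanh_neg]
    ring

/-- Up to a positive factor, this integral is the dissipative coefficient `λ₂` if `M = λ₁²`. -/
theorem hasInt_secondFun (h : Admissible a b c) (M : ℝ) (hi : Integrable (secondFun a b c M)) :
    HasInt (secondFun a b c M) (2 * halfMass a b c * (4 / (3 * theta a b c) * ((c ^ 2 - 1) / c)) *
        (c ^ 2 + 1 / 2 - M * (2 * c ^ 2 + 1 / c ^ 2 - (b - a) / disp a b c * (c ^ 2 + 1 / 2)) /
          ((c ^ 2 - 1)))) := by
  have hc := h.c_pos.ne'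
  have ht := h.theta_pos.ne'
  have e1 := h.disp_eq
  have e2 := h.b_eq
  have hS := h.sq_sub_pos.ne'
  have e3 : halfMass a b c = (1 + 1 / c ^ 2 - (b - a) / disp a b c) / theta a b c := rfl
  obtain ⟨θ, hθ⟩ : ∃ θ, θ = theta a b c := ⟨_, rfl⟩
  obtain ⟨κ, hκ⟩ : ∃ κ, κ = (c ^ 2 - 1) / c := ⟨_, rfl⟩
  obtain ⟨H, hH⟩ : ∃ H, H = halfMass a b c := ⟨_, rfl⟩
  obtain ⟨m, hm⟩ : ∃ m, m = -((b - a) / disp a b c) := ⟨_, rfl⟩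
  have key := h.hasInt_combination
    (2 * H * κ - 4 * H * (2 * a - b * c ^ 2) * κ * θ ^ 2 -
      M * H * (-(2 * c) * (-(θ * H) + m) + 8 * b * c * θ ^ 2 * (-(θ * H) + 3 * m) + κ -
        4 * b * κ * θ ^ 2) - M * H * κ)
    (6 * H * (2 * a - b * c ^ 2) * κ * θ ^ 2 + 2 * c * H * κ ^ 2 -
      M * H * (2 * κ * (-(θ * H) + m) - 12 * b * c * θ ^ 2 * (-(θ * H) + 3 * m) +
      6 * b * κ * θ ^ 2)) 0
    (-(M * H * (4 * c * θ * m - 16 * b * c * θ ^ 3 * m)))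
    (-(M * H * (48 * b * c * θ ^ 3 * m - 4 * κ * θ * m))) 0
  have := HasInt.of_even_part hi key fun z => ?_
  · convert this using 1
    subst hm hH hκ hθ
    rw [show 2 * a - b * c ^ 2 = b * c ^ 2 - 2 * disp a b c by rw [disp]; ring, e3]
    generalize (b - a) / disp a b c = n at e2 ⊢
    generalize disp a b c = β at e1 ⊢
    generalize theta a b c = θ at ht e1 e2 ⊢
    subst e1 e2
    field_simp
    ring
  · simp only [secondFun, forceFun, chiFun, prim_zero_apply, sol_zero_apply]
    simp only [prim, sol, qJ, uJ, sechJet_one, sechJet_two, primJet_one, primJet_two, primJet_three,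
      profile_sechProfile]
    simp only [eval_C, eval_mul, eval_sub, eval_neg, eval_pow, eval_ofNat, eval_X,
      eval_zero, ← hθ, ← hm, ← hH, ← hκ]
    simp only [mul_neg, Real.tanh_neg, neg_neg]
    ring

end Admissible

theorem forceFactor_pos {n : ℝ} (hn' : n * c ^ 2 < 1) :
    0 < 3 / 5 * c ^ 2 + 3 / 5 - 1 / 5 * n * c ^ 2 := by
  nlinarith

/-- The sign of the dissipative coefficient. -/
theorem second_pos {n M : ℝ} (hc : 1 < c) (hn : 0 < n) (hn' : n * c ^ 2 < 1)
    (hM : M * normFactor c n = (c ^ 2 - 1) / c * (3 / 5 * c ^ 2 + 3 / 5 - 1 / 5 * n * c ^ 2)) :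
    0 < c ^ 2 + 1 / 2 - M * (2 * c ^ 2 + 1 / c ^ 2 - n * (c ^ 2 + 1 / 2)) / (c ^ 2 - 1) := by
  have hc0 : 0 < c := by linarith
  have hS : 0 < c ^ 2 - 1 := by nlinarith
  have hf := normFactor_pos hc hn hn'
  have h1 := normFactor_lower hc hn hn'
  set N := normFactor c n
  have hM' : M = (c ^ 2 - 1) / c * (3 / 5 * c ^ 2 + 3 / 5 - 1 / 5 * n * c ^ 2) / N := by
    rw [← hM]; field_simp
  have h2 : (3 / 5 * c ^ 2 + 3 / 5 - 1 / 5 * n * c ^ 2) *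
      (2 * c ^ 4 + 1 - n * c ^ 2 * (c ^ 2 + 1 / 2)) < (c ^ 2 + 1 / 2) * (c ^ 3 * N) := by
    have hv : 0 < n * c ^ 2 := by positivity
    calc (3 / 5 * c ^ 2 + 3 / 5 - 1 / 5 * n * c ^ 2) *
          (2 * c ^ 4 + 1 - n * c ^ 2 * (c ^ 2 + 1 / 2))
        ≤ (3 / 5 * c ^ 2 + 3 / 5) * (2 * c ^ 4 + 1) := by
          have : 0 ≤ n * c ^ 2 * (c ^ 2 + 1 / 2) := by positivity
          refine mul_le_mul (by linarith) (by linarith) ?_ (by positivity)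
          nlinarith [pow_pos hc0 4]
      _ ≤ (c ^ 2 + 1 / 2) * (9 / 5 * c ^ 4 + 2 / 5 * c ^ 2 + 4 / 5) := by
          have : 1 ≤ c ^ 2 := by linarith
          nlinarith [mul_nonneg (sq_nonneg (c ^ 2)) hS.le, mul_nonneg (sq_nonneg c) hS.le]
      _ < _ := by gcongr
  have h3 : c ^ 2 + 1 / 2 - M * (2 * c ^ 2 + 1 / c ^ 2 - n * (c ^ 2 + 1 / 2)) / (c ^ 2 - 1) =
      ((c ^ 2 + 1 / 2) * (c ^ 3 * N) - (3 / 5 * c ^ 2 + 3 / 5 - 1 / 5 * n * c ^ 2) *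
      (2 * c ^ 4 + 1 - n * c ^ 2 * (c ^ 2 + 1 / 2))) / (c ^ 3 * N) := by
    rw [hM']
    field_simp
  rw [h3]
  exact div_pos (by linarith) (by positivity)

end pairings

/-! ### The operator pencil on the weighted space -/

open Polynomial

/-- Multiplication by the solitary wave `q_c`. -/
def solMul (a b c : ℝ) : ℝ →ᵇ ℂ :=
  tanhPoly (theta a b c) (C ((c ^ 2 - 1) / c) * (1 - X ^ 2))

/-- Multiplication by `q_c'`. -/
def solMulDeriv (a b c : ℝ) : ℝ →ᵇ ℂ :=
  tanhPoly (theta a b c) (C (theta a b c) * (1 - X ^ 2) *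
    derivative (C ((c ^ 2 - 1) / c) * (1 - X ^ 2)))

theorem solMul_apply (a b c z : ℝ) : solMul a b c z = (sol a b c 0 z : ℂ) := by
  rw [solMul, tanhPoly_apply, sol_zero_apply]
  simp only [eval_mul, eval_C, eval_sub, eval_one, eval_pow, eval_X]

theorem solMulDeriv_apply (a b c z : ℝ) : solMulDeriv a b c z = (sol a b c 1 z : ℂ) := by
  have h1 := hasDerivAt_tanhPoly (theta a b c) (C ((c ^ 2 - 1) / c) * (1 - X ^ 2)) z
  have h2 := (Admissible.hasDerivAt_qJ a b c 0 z).ofReal_comp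
  have e : (tanhPoly (theta a b c) (C ((c ^ 2 - 1) / c) * (1 - X ^ 2)) : ℝ → ℂ) =
      fun z => (sol a b c 0 z : ℂ) := funext fun z => solMul_apply a b c z
  rw [e] at h1
  exact h1.unique h2

/-- The coefficient `(c² - 1)∂² - (bc² - a)∂⁴ - 3c ∂ q_c ∂` of the pencil, acting on the sequence
`w` of derivatives of a function. -/
def opP0 (a b c : ℝ) (w : ℕ → ℝ →ᵇ ℂ) : ℝ →ᵇ ℂ :=
  ((c ^ 2 - 1 : ℝ) : ℂ) • w 2 - (disp a b c : ℂ) • w 4 -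
    (3 * c : ℂ) • (solMulDeriv a b c * w 1 + solMul a b c * w 2)

/-- The coefficient of `λ` in the pencil. -/
def opP1 (a b c : ℝ) (w : ℕ → ℝ →ᵇ ℂ) : ℝ →ᵇ ℂ :=
  (-(2 * c) : ℂ) • (w 1 - (b : ℂ) • w 3) + (2 : ℂ) • (solMul a b c * w 1) + solMulDeriv a b c * w 0

/-- The coefficient `1 - b∂²` of `λ²` in the pencil. -/
def opP2 (b : ℝ) (w : ℕ → ℝ →ᵇ ℂ) : ℝ →ᵇ ℂ := w 0 - (b : ℂ) • w 2

/-- The coefficient of `-η²` in the pencil. -/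
def opQ0 (a b c : ℝ) (w : ℕ → ℝ →ᵇ ℂ) : ℝ →ᵇ ℂ :=
  -w 0 + ((2 * a - b * c ^ 2 : ℝ) : ℂ) • w 2 - (c : ℂ) • (solMul a b c * w 0)

section ev

variable {α δ : ℝ} (a b c : ℝ) (w : ℕ → ℝ →ᵇ ℂ) (z : ℝ)

theorem ev_opP0 : ev α δ (opP0 a b c w) z =
    (c ^ 2 - 1) * ev α δ (w 2) z - disp a b c * ev α δ (w 4) z -
      3 * c * (sol a b c 1 z * ev α δ (w 1) z + sol a b c 0 z * ev α δ (w 2) z) := by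
  simp only [opP0, ev_sub, ev_smul, ev_add, ev_mul, solMul_apply, solMulDeriv_apply]
  push_cast; ring

theorem ev_opP1 : ev α δ (opP1 a b c w) z =
    -(2 * c) * (ev α δ (w 1) z - b * ev α δ (w 3) z) + 2 * (sol a b c 0 z * ev α δ (w 1) z) +
      sol a b c 1 z * ev α δ (w 0) z := by
  simp only [opP1, ev_sub, ev_smul, ev_add, ev_mul, solMul_apply, solMulDeriv_apply]

theorem ev_opP2 : ev α δ (opP2 b w) z = ev α δ (w 0) z - b * ev α δ (w 2) z := by
  simp only [opP2, ev_sub, ev_smul]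

theorem ev_opQ0 : ev α δ (opQ0 a b c w) z =
    -ev α δ (w 0) z + (2 * a - b * c ^ 2) * ev α δ (w 2) z -
      c * (sol a b c 0 z * ev α δ (w 0) z) := by
  simp only [opQ0, ev_sub, ev_smul, ev_add, ev_neg, ev_mul, solMul_apply]
  push_cast; ring

end ev

section star

variable (a b c : ℝ) (w : ℕ → ℝ →ᵇ ℂ)

theorem star_solMul : star (solMul a b c) = solMul a b c := star_tanhPoly _ _

theorem star_solMulDeriv : star (solMulDeriv a b c) = solMulDeriv a b c := star_tanhPoly _ _

theorem opP1_star : opP1 a b c (fun j => star (w j)) = star (opP1 a b c w) := by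
  simp only [opP1, star_add, star_sub, star_smul, star_mul', star_solMul, star_solMulDeriv,
    Complex.star_def, map_neg, map_mul, Complex.conj_ofReal, map_ofNat]

theorem opP2_star : opP2 b (fun j => star (w j)) = star (opP2 b w) := by
  simp only [opP2, star_sub, star_smul, Complex.star_def, Complex.conj_ofReal]

theorem opQ0_star : opQ0 a b c (fun j => star (w j)) = star (opQ0 a b c w) := by
  simp only [opQ0, star_add, star_sub, star_smul, star_mul', star_solMul, star_neg,
    Complex.star_def, Complex.conj_ofReal]

end star

/-- The terms of higher order in the equation for the correction. With `s = iη` and `λ = sμ`, the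
function `q + λu + s²w` is in the kernel of the pencil if and only if
`P₀w = -μ²χ - Q₀q - s R(s, μ, w)`. -/
def remainder (a b c : ℝ) (q u : ℕ → ℝ →ᵇ ℂ) (s μ : ℂ) (w : ℕ → ℝ →ᵇ ℂ) : ℝ →ᵇ ℂ :=
  μ • opP1 a b c w + (s * μ ^ 2) • opP2 b w + s • opQ0 a b c w +
    (s ^ 2 * μ * (2 * b * c)) • w 1 - (s ^ 3 * μ ^ 2 * b) • w 0 + (s ^ 3 * a) • w 0 +
    μ ^ 3 • opP2 b u + μ • (opQ0 a b c u + (2 * b * c : ℂ) • q 1) +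
    s • ((μ ^ 2 * (2 * b * c)) • u 1 - (μ ^ 2 * b) • q 0 + (a : ℂ) • q 0) +
    s ^ 2 • ((μ * a) • u 0 - (μ ^ 3 * b) • u 0)

theorem remainder_star (a b c : ℝ) {q u : ℕ → ℝ →ᵇ ℂ} (hq : ∀ j, star (q j) = q j)
    (hu : ∀ j, star (u j) = u j) (s μ : ℂ) (w : ℕ → ℝ →ᵇ ℂ) :
    remainder a b c q u (conj s) (conj μ) (fun j => star (w j)) =
      star (remainder a b c q u s μ w) := by
  have h2 : opP2 b u = star (opP2 b u) := by rw [← opP2_star, funext hu]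
  have h3 : opQ0 a b c u = star (opQ0 a b c u) := by rw [← opQ0_star, funext hu]
  simp only [remainder, opP1_star, opP2_star, opQ0_star, star_add, star_sub, star_smul, ← h2, ← h3,
    hq, hu, Complex.star_def, map_mul, map_pow, Complex.conj_ofReal, map_ofNat]

/-- The operator pencil obtained by eliminating the second component from the eigenvalue problem, at
`η² = -σ` and eigenvalue `λ`. -/
def pencil (a b c : ℝ) (σ lam : ℂ) (v : ℕ → ℂ) (z : ℝ) : ℂ :=
  (c ^ 2 - 1) * v 2 - disp a b c * v 4 - 3 * c * (sol a b c 1 z * v 1 + sol a b c 0 z * v 2) +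
    lam * (-(2 * c) * (v 1 - b * v 3) + 2 * (sol a b c 0 z * v 1) + sol a b c 1 z * v 0) +
    lam ^ 2 * (v 0 - b * v 2) +
    σ * (-v 0 + (2 * a - b * c ^ 2) * v 2 - c * (sol a b c 0 z * v 0) + lam * (2 * b * c * v 1) -
      lam ^ 2 * (b * v 0)) + σ ^ 2 * (a * v 0)

section remainder

variable {a b c α δ : ℝ}

theorem contDiff_remainder {K : ℕ → (ℝ →ᵇ ℂ) →L[ℂ] (ℝ →ᵇ ℂ)} (q u : ℕ → ℝ →ᵇ ℂ) :
    ContDiff ℂ ω fun p : ℂ × ℂ × (ℝ →ᵇ ℂ) =>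
      remainder a b c q u p.1 p.2.1 (fun j => K j p.2.2) := by
  unfold remainder opP1 opP2 opQ0
  fun_prop

/-- The equation for the correction, and the eigenvalue problem for the corrected function. -/
theorem pencil_eq_zero (h : Admissible a b c) {z : ℝ} {q u w : ℕ → ℝ →ᵇ ℂ} {s μ : ℂ}
    (hq : ∀ j, ev α δ (q j) z = sol a b c j z) (hu : ∀ j, ev α δ (u j) z = prim a b c j z)
    (hw : opP0 a b c w = -opQ0 a b c q - s • remainder a b c q u s μ w -
      μ ^ 2 • (opP1 a b c u + opP2 b q)) :
    pencil a b c (s ^ 2) (s * μ)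
      (fun j => ev α δ (q j) z + s * μ * ev α δ (u j) z + s ^ 2 * ev α δ (w j) z) z = 0 := by
  have h1 := congrArg (fun F => ev α δ F z) hw
  have h2 : ((_ : ℝ) : ℂ) = ((_ : ℝ) : ℂ) := congrArg Complex.ofReal (h.soliton_eq_deriv z)
  have h3 : ((_ : ℝ) : ℂ) = ((_ : ℝ) : ℂ) := congrArg Complex.ofReal (h.primitive_eq z)
  simp only [remainder, ev_sub, ev_add, ev_neg, ev_smul, ev_opP0, ev_opP1, ev_opP2, ev_opQ0, hq, hu] at h1
  push_cast at h2 h3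
  simp only [pencil, hq, hu]
  linear_combination s ^ 2 * h1 + h2 + s * μ * h3

end remainder

/-! ### Solvability conditions -/

open Polynomial

section solvability

variable {a b c α δ : ℝ}

/-- The derivatives of the solitary wave in the weighted space. -/
def qE (hw : WeightCond (theta a b c) α δ) (j : ℕ) : ℝ →ᵇ ℂ := hw.elem (qJ a b c j)

/-- The derivatives of the primitive `∫_z^∞ ∂_c q_c` in the weighted space. -/
def uE (hw : WeightCond (theta a b c) α δ) (j : ℕ) : ℝ →ᵇ ℂ := hw.elem (uJ a b c j)

theorem ev_qE (hw : WeightCond (theta a b c) α δ) (j : ℕ) (z : ℝ) :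
    ev α δ (qE hw j) z = sol a b c j z := hw.ev_elem _ z

theorem ev_uE (hw : WeightCond (theta a b c) α δ) (j : ℕ) (z : ℝ) :
    ev α δ (uE hw j) z = prim a b c j z := hw.ev_elem _ z

/-- The pairing with the solitary wave, which spans the cokernel of the unperturbed operator. -/
def pairQ (hw : WeightCond (theta a b c) α δ) : (ℝ →ᵇ ℂ) →L[ℂ] ℂ :=
  dualPair α hw.pos (reflect (qE hw 0))

theorem pairQ_apply (hw : WeightCond (theta a b c) α δ) (F : ℝ →ᵇ ℂ) :
    pairQ hw F = ∫ z, ev α δ F z * sol a b c 0 z := by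
  rw [pairQ, dualPair_apply]
  congr 1; funext z
  rw [ev_reflect, ev_qE, sol_neg]

theorem integrable_mul_sol (hw : WeightCond (theta a b c) α δ) (F : ℝ →ᵇ ℂ) :
    Integrable fun z => ev α δ F z * sol a b c 0 z := by
  have := integrable_ev_mul_ev (α := α) hw.pos F (reflect (qE hw 0))
  simpa only [ev_reflect, ev_qE, sol_neg] using this

theorem pairQ_eq (hw : WeightCond (theta a b c) α δ) {F : ℝ →ᵇ ℂ} {φ : ℝ → ℝ} {v : ℝ}
    (hF : ∀ z, ev α δ F z = φ z)
    (hv : Integrable (fun z => φ z * sol a b c 0 z) → HasInt (fun z => φ z * sol a b c 0 z) v) :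
    pairQ hw F = v := by
  have h1 := (integrable_mul_sol hw F).re
  simp only [hF, ← Complex.ofReal_mul] at h1
  rw [pairQ_apply]
  simp only [hF, ← Complex.ofReal_mul]
  exact integral_ofReal.trans (congrArg _ (hv h1).2)

theorem sol_one_neg (a b c z : ℝ) : sol a b c 1 (-z) = -sol a b c 1 z := by
  simp only [sol, qJ, sechJet_one, profile_sechProfile, eval_mul, eval_C, eval_X, eval_neg,
    eval_ofNat, eval_zero, mul_neg, Real.tanh_neg]
  ring

theorem sol_three_neg (a b c z : ℝ) : sol a b c 3 (-z) = -sol a b c 3 z := by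
  simp only [sol, qJ, sechJet_three, profile_sechProfile, eval_mul, eval_C, eval_X, eval_sub,
    eval_pow, eval_ofNat, eval_zero, mul_neg, Real.tanh_neg]
  ring

/-- The reflected primitive `∫_{-∞}^z ∂_c q_c` solves the equation adjoint to that of the correction;
this moves the operators from the unknown correction `w` to explicit functions. -/
theorem pairQ_opP1 (h : Admissible a b c) (hw : WeightCond (theta a b c) α δ) {w : ℕ → ℝ →ᵇ ℂ}
    (hd : ∀ j < 4, ∀ z, HasDerivAt (ev α δ (w j)) (ev α δ (w (j + 1)) z) z) :
    pairQ hw (opP1 a b c w) = -dualPair α hw.pos (reflect (uE hw 0)) (opP0 a b c w) := by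
  have hi1 := integrable_ev_mul_ev (α := α) hw.pos (opP1 a b c w) (reflect (qE hw 0))
  have hi0 := integrable_ev_mul_ev (α := α) hw.pos (opP0 a b c w) (reflect (uE hw 0))
  have hq : ∀ j z, ev (-α) δ (reflect (qE hw j)) z = sol a b c j (-z) := fun j z => by
    rw [ev_reflect, ev_qE]
  have hu : ∀ j z, ev (-α) δ (reflect (uE hw j)) z = prim a b c j (-z) := fun j z => by
    rw [ev_reflect, ev_uE]
  have hqd : ∀ j z, HasDerivAt (ev (-α) δ (reflect (qE hw j)))
      (-ev (-α) δ (reflect (qE hw (j + 1))) z) z := fun j z => by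
    rw [hq, funext (hq j)]
    simpa [Function.comp_def] using
      ((Admissible.hasDerivAt_qJ a b c j (-z)).scomp z (hasDerivAt_neg z)).ofReal_comp
  have hud : ∀ j z, HasDerivAt (ev (-α) δ (reflect (uE hw j)))
      (-ev (-α) δ (reflect (uE hw (j + 1))) z) z := fun j z => by
    rw [hu, funext (hu j)]
    simpa [Function.comp_def] using
      ((Admissible.hasDerivAt_uJ a b c j (-z)).scomp z (hasDerivAt_neg z)).ofReal_comp
  have hg : ∀ j < 4, ∀ z, HasDerivAt (ev α δ (solMul a b c * w j))
      (sol a b c 1 z * ev α δ (w j) z + sol a b c 0 z * ev α δ (w (j + 1)) z) z := fun j hj z => by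
    have e : ev α δ (solMul a b c * w j) = fun x => (sol a b c 0 x : ℂ) * ev α δ (w j) x := by
      funext x; rw [ev_mul, solMul_apply]
    rw [e]
    exact (Admissible.hasDerivAt_qJ a b c 0 z).ofReal_comp.mul (hd j hj z)
  rw [eq_neg_iff_add_eq_zero, pairQ, dualPair_apply, dualPair_apply, ← integral_add hi1 hi0]
  -- The integrand is the derivative of a sum of products of dual weighted functions.
  have hP : ∀ F G, Integrable fun z => ev α δ F z * ev (-α) δ G z :=
    fun F G => integrable_ev_mul_ev (α := α) hw.pos F G
  refine integral_eq_zero_of_hasDerivAt_of_integrable (f := fun z =>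
    ((c ^ 2 - 1) * (ev α δ (w 1) z * ev (-α) δ (reflect (uE hw 0)) z +
      ev α δ (w 0) z * ev (-α) δ (reflect (uE hw 1)) z) -
    disp a b c * (ev α δ (w 3) z * ev (-α) δ (reflect (uE hw 0)) z +
      ev α δ (w 2) z * ev (-α) δ (reflect (uE hw 1)) z +
      ev α δ (w 1) z * ev (-α) δ (reflect (uE hw 2)) z +
      ev α δ (w 0) z * ev (-α) δ (reflect (uE hw 3)) z)) -
    3 * c * (ev α δ (solMul a b c * w 1) z * ev (-α) δ (reflect (uE hw 0)) z +
      ev α δ (solMul a b c * w 0) z * ev (-α) δ (reflect (uE hw 1)) z) +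
    (2 * (ev α δ (solMul a b c * w 0) z * ev (-α) δ (reflect (qE hw 0)) z) -
    2 * c * (ev α δ (w 0) z * ev (-α) δ (reflect (qE hw 0)) z -
      b * (ev α δ (w 2) z * ev (-α) δ (reflect (qE hw 0)) z +
        ev α δ (w 1) z * ev (-α) δ (reflect (qE hw 1)) z +
        ev α δ (w 0) z * ev (-α) δ (reflect (qE hw 2)) z)))) (fun z => ?_) (hi1.add hi0) ?_
  · have d0 := hd 0 (by norm_num) z
    have d1 := hd 1 (by norm_num) z
    have d2 := hd 2 (by norm_num) z
    have d3 := hd 3 (by norm_num) z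
    refine (((((d1.mul (hud 0 z)).add (d0.mul (hud 1 z))).const_mul (c ^ 2 - 1 : ℂ)).sub
      (((((d3.mul (hud 0 z)).add (d2.mul (hud 1 z))).add (d1.mul (hud 2 z))).add
        (d0.mul (hud 3 z))).const_mul (disp a b c : ℂ))).sub
      ((((hg 1 (by norm_num) z).mul (hud 0 z)).add
        ((hg 0 (by norm_num) z).mul (hud 1 z))).const_mul (3 * c : ℂ))).add
      ((((hg 0 (by norm_num) z).mul (hqd 0 z)).const_mul (2 : ℂ)).sub
        (((d0.mul (hqd 0 z)).sub ((((d2.mul (hqd 0 z)).add (d1.mul (hqd 1 z))).add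
          (d0.mul (hqd 2 z))).const_mul (b : ℂ))).const_mul (2 * c : ℂ))) |>.congr_deriv ?_
    have h3 : ((_ : ℝ) : ℂ) = ((_ : ℝ) : ℂ) := congrArg Complex.ofReal (h.primitive_eq (-z))
    push_cast at h3
    simp only [ev_opP0, ev_opP1, ev_mul, solMul_apply, hq, hu, Nat.reduceAdd]
    simp only [sol_neg, sol_one_neg, sol_three_neg] at h3 ⊢
    push_cast at h3 ⊢
    linear_combination -ev α δ (w 0) z * h3
  · exact (((((hP _ _).add (hP _ _)).const_mul _).sub ((((((hP _ _).add (hP _ _)).add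
      (hP _ _)).add (hP _ _))).const_mul _)).sub (((hP _ _).add (hP _ _)).const_mul _)).add
      (((hP _ _).const_mul _).sub (((hP _ _).sub ((((hP _ _).add (hP _ _)).add
        (hP _ _)).const_mul _)).const_mul _))

end solvability

/-! ### The branch of eigenvalues -/

open Polynomial

section branch

variable {a b c α δ : ℝ}

theorem star_qE (hw : WeightCond (theta a b c) α δ) (j : ℕ) : star (qE hw j) = qE hw j :=
  hw.star_elem _

theorem star_uE (hw : WeightCond (theta a b c) α δ) (j : ℕ) : star (uE hw j) = uE hw j :=
  hw.star_elem _

theorem pairQ_star (hw : WeightCond (theta a b c) α δ) (F : ℝ →ᵇ ℂ) :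
    pairQ hw (star F) = conj (pairQ hw F) :=
  dualPair_star α hw.pos F _ (by rw [← reflect_star, star_qE])

/-- The coefficient of `λ²` in the pencil applied to `q + λu`. -/
def chi (hw : WeightCond (theta a b c) α δ) : ℝ →ᵇ ℂ :=
  opP1 a b c (uE hw) + opP2 b (qE hw)

/-- The norming constant `⟨χ, q⟩`. -/
def normConst (a b c : ℝ) : ℝ :=
  4 / (3 * theta a b c) * ((c ^ 2 - 1) / c) * normFactor c ((b - a) / disp a b c)

/-- The quantity `-⟨Q₀q, q⟩`. -/
def forceConst (a b c : ℝ) : ℝ :=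
  4 / (3 * theta a b c) * ((c ^ 2 - 1) / c) ^ 2 *
    (3 / 5 * c ^ 2 + 3 / 5 - 1 / 5 * ((b - a) / disp a b c) * c ^ 2)

theorem normConst_pos (h : Admissible a b c) : 0 < normConst a b c := by
  have h1 := normFactor_pos h.hc h.quot_bounds.1 h.quot_bounds.2
  have h2 := h.theta_pos
  have h3 := div_pos h.sq_sub_pos h.c_pos
  unfold normConst
  positivity

theorem forceConst_pos (h : Admissible a b c) : 0 < forceConst a b c := by
  have h1 := forceFactor_pos (c := c) h.quot_bounds.2
  have h2 := h.theta_pos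
  have h3 := div_pos h.sq_sub_pos h.c_pos
  unfold forceConst
  positivity

theorem ev_chi (hw : WeightCond (theta a b c) α δ) (z : ℝ) : ev α δ (chi hw) z = chiFun a b c z := by
  simp only [chi, ev_add, ev_opP1, ev_opP2, ev_qE, ev_uE, chiFun]
  push_cast; ring

theorem ev_force (hw : WeightCond (theta a b c) α δ) (z : ℝ) :
    ev α δ (opQ0 a b c (qE hw)) z = forceFun a b c z := by
  simp only [ev_opQ0, ev_qE, forceFun]
  push_cast; ring

theorem pairQ_chi (h : Admissible a b c) (hw : WeightCond (theta a b c) α δ) :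
    pairQ hw (chi hw) = normConst a b c :=
  pairQ_eq hw (ev_chi hw) fun hi => h.hasInt_chiFun hi

theorem pairQ_force (h : Admissible a b c) (hw : WeightCond (theta a b c) α δ) :
    pairQ hw (opQ0 a b c (qE hw)) = -(forceConst a b c : ℂ) := by
  rw [← Complex.ofReal_neg]
  exact pairQ_eq hw (ev_force hw) fun hi => h.hasInt_forceFun hi

/-- The right inverse of the unperturbed operator modulo its cokernel. -/
theorem exists_correctionOperator (h : Admissible a b c) (hw : WeightCond (theta a b c) α δ) :
    ∃ K : ℕ → (ℝ →ᵇ ℂ) →L[ℂ] (ℝ →ᵇ ℂ),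
      (∀ f, ∀ j < 4, ∀ z, HasDerivAt (ev α δ (K j f)) (ev α δ (K (j + 1) f) z) z) ∧
      (∀ f, opP0 a b c (fun j => K j f) = f - (pairQ hw f / normConst a b c) • chi hw) ∧
      ∀ f j, K j (star f) = star (K j f) := by
  have hX : (normConst a b c : ℂ) ≠ 0 := by exact_mod_cast (normConst_pos h).ne'
  have hβ : (disp a b c : ℂ) ≠ 0 := by exact_mod_cast h.disp_pos.ne'
  let N : (ℝ →ᵇ ℂ) →L[ℂ] (ℝ →ᵇ ℂ) := (disp a b c : ℂ)⁻¹ •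
    (ContinuousLinearMap.id ℂ _ - ((normConst a b c : ℂ)⁻¹ • pairQ hw).smulRight (chi hw))
  have hNa : ∀ f, N f = (disp a b c : ℂ)⁻¹ • (f - (pairQ hw f / normConst a b c) • chi hw) := by
    intro f
    simp only [N, _root_.smul_apply, _root_.sub_apply,
      ContinuousLinearMap.id_apply, ContinuousLinearMap.smulRight_apply, smul_eq_mul]
    rw [div_eq_inv_mul]
  have hNq : ∀ f, pairQ hw (N f) = 0 := fun f => by
    rw [hNa, map_smul, map_sub, map_smul, pairQ_chi h, smul_eq_mul, smul_eq_mul,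
      div_mul_cancel₀ _ hX, sub_self, mul_zero]
  have hN : ∀ f, dualPair α hw.pos (reflect (hw.elem sechSq)) (N f) = 0 := fun f => by
    have h1 := hNq f
    have hκ : (((c ^ 2 - 1) / c : ℝ) : ℂ) ≠ 0 := by
      exact_mod_cast (div_pos h.sq_sub_pos h.c_pos).ne'
    have h2 : pairQ hw (N f) = (((c ^ 2 - 1) / c : ℝ) : ℂ) *
        dualPair α hw.pos (reflect (hw.elem sechSq)) (N f) := by
      rw [pairQ_apply, dualPair_apply, ← integral_const_mul]
      congr 1; funext z
      rw [ev_reflect, hw.ev_elem, profile_sechSq, ← sol_neg,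
        sol_zero_apply]
      push_cast; ring
    rw [h1, eq_comm, mul_eq_zero] at h2
    exact h2.resolve_left hκ
  obtain ⟨K, hK, hK3, hKs⟩ := exists_solutionOperator hw N hN
  have hNs : ∀ f, N (star f) = star (N f) := fun f => by
    have hc : star (chi hw) = chi hw := ev_injective (α := α) (δ := δ) fun z => by
      rw [ev_star, ev_chi, Complex.conj_ofReal]
    rw [hNa, hNa, star_smul, star_sub, star_smul, hc, pairQ_star, Complex.star_def, map_div₀, map_inv₀, Complex.conj_ofReal, Complex.conj_ofReal]
  let g : ℝ →ᵇ ℂ := tanhPoly (theta a b c) (C (theta a b c ^ 2) * (4 - 12 * (1 - X ^ 2)))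
  let g' : ℝ →ᵇ ℂ := tanhPoly (theta a b c) (C (24 * theta a b c ^ 3) * (X * (1 - X ^ 2)))
  let K4 : (ℝ →ᵇ ℂ) →L[ℂ] (ℝ →ᵇ ℂ) := (ContinuousLinearMap.mul ℂ (ℝ →ᵇ ℂ) g).comp (K 2) +
    (ContinuousLinearMap.mul ℂ (ℝ →ᵇ ℂ) g').comp (K 1) - N
  have hK4 : ∀ f, K4 f = g * K 2 f + g' * K 1 f - N f := fun f => rfl
  let K' : ℕ → (ℝ →ᵇ ℂ) →L[ℂ] (ℝ →ᵇ ℂ) := fun j => if j < 4 then K j else K4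
  have e : ∀ j < 4, K' j = K j := fun j hj => if_pos hj
  have e4 : K' 4 = K4 := if_neg (by norm_num)
  refine ⟨K', fun f j hj z => ?_, fun f => ?_, fun f j => ?_⟩
  · rw [e j hj]
    rcases Nat.lt_succ_iff_lt_or_eq.1 hj with hj' | rfl
    · rw [e (j + 1) (by omega)]
      exact hK j hj' f z
    · rw [e4]
      refine (hK3 f z).congr_deriv ?_
      simp only [hK4, ev_sub, ev_add, ev_mul, g, g', tanhPoly_apply, eval_mul, eval_C, eval_sub,
        eval_ofNat, eval_one, eval_pow, eval_X]
      push_cast; ring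
  · refine ev_injective (α := α) (δ := δ) fun z => ?_
    have h4 : (4 * disp a b c * theta a b c ^ 2 : ℂ) = c ^ 2 - 1 := by exact_mod_cast h.theta_sq
    rw [ev_opP0, e4, e 1 (by norm_num), e 2 (by norm_num), hK4]
    have h5 : ev α δ (N f) z = (disp a b c : ℂ)⁻¹ *
        ev α δ (f - (pairQ hw f / normConst a b c) • chi hw) z := by rw [hNa, ev_smul]
    have h6 : (sol a b c 1 z : ℂ) = -2 * ((c ^ 2 - 1) / c) * theta a b c *
        ((1 - Real.tanh (theta a b c * z) ^ 2 : ℝ) * Real.tanh (theta a b c * z) : ℂ) := by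
      simp only [sol, qJ, sechJet_one, profile_sechProfile, eval_mul, eval_C, eval_X, eval_neg,
        eval_ofNat, eval_zero]
      push_cast; ring
    have hc0 : (c : ℂ) ≠ 0 := by exact_mod_cast h.c_pos.ne'
    simp only [ev_sub, ev_add, ev_mul, g, g', tanhPoly_apply, eval_mul, eval_C, eval_sub,
        eval_ofNat, eval_one, eval_pow, eval_X, h5, h6, sol_zero_apply]
    push_cast
    rw [← h4]
    field_simp
    ring
  · rcases lt_or_ge j 4 with hj | hj
    · rw [e j hj]; exact hKs _ _ (hNs f) j
    · have : K' j = K4 := if_neg (by omega)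
      rw [this, hK4, hK4, hKs _ _ (hNs f), hKs _ _ (hNs f), hNs, star_sub, star_add, star_mul',
        star_mul', star_tanhPoly, star_tanhPoly]

end branch

section branch

variable {a b c α δ : ℝ}

/-! ### Regularity of the branch -/

section regularity

variable {I : Set ℝ} {m : ℕ} {w : ℕ → ℝ → ℝ →ᵇ ℂ}

theorem Reg.map_solMul {U : ℝ → ℝ →ᵇ ℂ} (hU : Reg α δ I m U) : Reg α δ I m fun η => solMul a b c * U η :=
  hU.mul_tanhPoly _ _

theorem Reg.map_solMulDeriv {U : ℝ → ℝ →ᵇ ℂ} (hU : Reg α δ I m U) :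
    Reg α δ I m fun η => solMulDeriv a b c * U η :=
  hU.mul_tanhPoly _ _

theorem Reg.map_opP1 (hw : ∀ j < 4, Reg α δ I m (w j)) :
    Reg α δ I m fun η => opP1 a b c fun j => w j η :=
  ((((hw 1 (by norm_num)).sub ((hw 3 (by norm_num)).const_smul _)).const_smul _).add
    ((hw 1 (by norm_num)).map_solMul.const_smul _)).add (hw 0 (by norm_num)).map_solMulDeriv

theorem Reg.map_opP2 (hw : ∀ j < 4, Reg α δ I m (w j)) : Reg α δ I m fun η => opP2 b fun j => w j η :=
  (hw 0 (by norm_num)).sub ((hw 2 (by norm_num)).const_smul _)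

theorem Reg.map_opQ0 (hw : ∀ j < 4, Reg α δ I m (w j)) :
    Reg α δ I m fun η => opQ0 a b c fun j => w j η :=
  ((hw 0 (by norm_num)).neg.add ((hw 2 (by norm_num)).const_smul _)).sub
    ((hw 0 (by norm_num)).map_solMul.const_smul _)

theorem Reg.map_remainder {q u : ℕ → ℝ →ᵇ ℂ} (hq : ∀ j, Reg α δ I m fun _ => q j)
    (hu : ∀ j, Reg α δ I m fun _ => u j) {s μ : ℝ → ℂ} (hs : ContDiffOn ℝ ∞ s I)
    (hμ : ContDiffOn ℝ ∞ μ I) (hw : ∀ j < 4, Reg α δ I m (w j)) :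
    Reg α δ I m fun η => remainder a b c q u (s η) (μ η) fun j => w j η := by
  have hu' : ∀ j < 4, Reg α δ I m fun _ => u j := fun j _ => hu j
  unfold remainder
  refine (((((((((Reg.smul ?_ (Reg.map_opP1 hw)).add (Reg.smul ?_ (Reg.map_opP2 hw))).add
    (Reg.smul ?_ (Reg.map_opQ0 hw))).add (Reg.smul ?_ (hw 1 (by norm_num)))).sub
    (Reg.smul ?_ (hw 0 (by norm_num)))).add (Reg.smul ?_ (hw 0 (by norm_num)))).add
    (Reg.smul ?_ (Reg.map_opP2 hu'))).add (Reg.smul ?_ ((Reg.map_opQ0 hu').add ((hq 1).const_smul _)))).add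
    (Reg.smul ?_ (((Reg.smul ?_ (hu 1)).sub (Reg.smul ?_ (hq 0))).add ((hq 0).const_smul _)))).add
    (Reg.smul ?_ ((Reg.smul ?_ (hu 0)).sub (Reg.smul ?_ (hu 0))))
  all_goals fun_prop

/-- Solutions of the equation for the correction are smooth, because the equation expresses the fourth
derivative through the lower ones. -/
theorem Reg.of_equation (h : Admissible a b c) {q u : ℕ → ℝ →ᵇ ℂ} {s μ : ℝ → ℂ}
    (hq : ∀ m j, Reg α δ I m fun _ => q j) (hu : ∀ m j, Reg α δ I m fun _ => u j)
    (hs : ContDiffOn ℝ ∞ s I) (hμ : ContDiffOn ℝ ∞ μ I) (hwc : ∀ j, ContDiffOn ℝ ∞ (w j) I)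
    (hd : ∀ η ∈ I, ∀ j < 4, ∀ z, HasDerivAt (ev α δ (w j η)) (ev α δ (w (j + 1) η) z) z)
    (he : ∀ η ∈ I, opP0 a b c (fun j => w j η) = -opQ0 a b c q -
      s η • remainder a b c q u (s η) (μ η) (fun j => w j η) -
      μ η ^ 2 • (opP1 a b c u + opP2 b q)) (m : ℕ) :
    ∀ j ≤ 4, Reg α δ I m (w j) := by
  induction m with
  | zero => exact fun j _ => hwc j
  | succ m ih =>
    have h1 : ∀ j < 4, Reg α δ I (m + 1) (w j) := fun j hj =>
      Reg.succ (hwc j) (fun η hη => hd η hη j hj) (ih (j + 1) hj)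
    intro j hj
    rcases Nat.lt_or_eq_of_le hj with hj' | rfl
    · exact h1 j hj'
    have hq' : ∀ j < 4, Reg α δ I (m + 1) fun _ => q j := fun j _ => hq (m + 1) j
    have hu' : ∀ j < 4, Reg α δ I (m + 1) fun _ => u j := fun j _ => hu (m + 1) j
    have hA := (h1 2 (by norm_num)).const_smul ((c ^ 2 - 1 : ℝ) : ℂ)
    have hB := ((h1 1 (by norm_num)).map_solMulDeriv (a := a) (b := b) (c := c)).add
      ((h1 2 (by norm_num)).map_solMul (a := a) (b := b) (c := c))
    have hC := (Reg.map_opQ0 (a := a) (b := b) (c := c) hq').neg.sub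
      (Reg.smul hs (Reg.map_remainder (a := a) (b := b) (c := c) (hq _) (hu _) hs hμ h1))
    have hD := Reg.smul (hμ.pow 2) ((Reg.map_opP1 (a := a) (b := b) (c := c) hu').add
      (Reg.map_opP2 (b := b) hq'))
    have h2 := ((hA.sub (hB.const_smul (3 * c : ℂ))).sub (hC.sub hD)).const_smul (disp a b c : ℂ)⁻¹
    refine h2.congr fun η hη => ?_
    have hβ : (disp a b c : ℂ) ≠ 0 := by exact_mod_cast h.disp_pos.ne'
    rw [eq_inv_smul_iff₀ hβ, ← he η hη, opP0]
    abel

end regularity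

/-! ### Existence of the branch -/

/-- The density of the second-order condition is the pairing of the remainder with the solitary
wave. -/
theorem pairQ_remainder (h : Admissible a b c) (hw : WeightCond (theta a b c) α δ)
    {w : ℕ → ℝ →ᵇ ℂ} {M μ₀ : ℝ} (hM : μ₀ ^ 2 = M)
    (hd : ∀ j < 4, ∀ z, HasDerivAt (ev α δ (w j)) (ev α δ (w (j + 1)) z) z)
    (he : opP0 a b c w = -opQ0 a b c (qE hw) - (M : ℂ) • chi hw) :
    pairQ hw (remainder a b c (qE hw) (uE hw) 0 μ₀ w) =
      -(μ₀ : ℂ) * ((∫ z, secondFun a b c M z : ℝ) : ℂ) ∧ Integrable (secondFun a b c M) := by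
  have e1 : ∀ z, ev α δ (opP0 a b c w) z * ev (-α) δ (reflect (uE hw 0)) z -
      (M : ℂ) * (ev α δ (opP2 b (uE hw)) z * sol a b c 0 z) -
      ev α δ (opQ0 a b c (uE hw)) z * sol a b c 0 z -
      (2 * b * c : ℂ) * (ev α δ (qE hw 1) z * sol a b c 0 z) = (secondFun a b c M z : ℂ) := by
    intro z
    rw [he, ev_reflect, ev_sub, ev_neg, ev_force, ev_smul, ev_chi, ev_opP2, ev_opQ0]
    simp only [ev_uE, ev_qE, secondFun]
    push_cast; ring
  have i1 := integrable_ev_mul_ev (α := α) hw.pos (opP0 a b c w) (reflect (uE hw 0))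
  have i2 := (integrable_mul_sol hw (opP2 b (uE hw))).const_mul (M : ℂ)
  have i3 := integrable_mul_sol hw (opQ0 a b c (uE hw))
  have i4 := (integrable_mul_sol hw (qE hw 1)).const_mul (2 * b * c : ℂ)
  have hi := ((i1.sub i2).sub i3).sub i4
  have e2 := integral_sub ((i1.sub i2).sub i3) i4
  have e3 := integral_sub (i1.sub i2) i3
  have e4 := integral_sub i1 i2
  simp only [Pi.sub_apply] at e2 e3 e4
  rw [e3, e4, integral_const_mul, integral_const_mul, ← pairQ_apply hw, ← pairQ_apply hw, ← pairQ_apply hw,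
    ← dualPair_apply α hw.pos] at e2
  refine ⟨?_, ?_⟩
  · rw [← integral_complex_ofReal, ← funext e1, e2]
    have hM' : (M : ℂ) = (μ₀ : ℂ) ^ 2 := by rw [← hM]; push_cast; ring
    simp only [remainder, zero_mul, zero_smul, ne_eq, OfNat.ofNat_ne_zero, not_false_eq_true, zero_pow, add_zero,
      sub_zero, map_add, map_smul, pairQ_opP1 h hw hd, smul_eq_mul, hM']
    ring
  · have := hi.re
    refine this.congr (Eventually.of_forall fun z => ?_)
    simp only [Pi.sub_apply, e1 z]
    exact Complex.ofReal_re _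

end branch

section branch

variable {a b c α δ : ℝ}

/-- Taylor expansion of the second order for an analytic function, with the remainder as a continuous
function. -/
theorem exists_taylor_two {μ : ℂ → ℂ} {r : ℝ} (hr : 0 < r)
    (hμ : DifferentiableOn ℂ μ (Metric.ball 0 r)) :
    ∃ ν : ℂ → ℂ, ContinuousOn ν (Metric.ball 0 r) ∧
      ∀ s, μ s = μ 0 + s * deriv μ 0 + s ^ 2 * ν s := by
  have h0 := Metric.ball_mem_nhds (0 : ℂ) hr
  have h1 := (Complex.differentiableOn_dslope h0).2 hμ
  have h2 := (Complex.differentiableOn_dslope h0).2 h1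
  refine ⟨_, h2.continuousOn, fun s => ?_⟩
  have e1 := sub_smul_dslope μ 0 s
  have e2 := sub_smul_dslope (dslope μ 0) 0 s
  rw [dslope_same, sub_zero, smul_eq_mul] at e2
  rw [sub_zero, smul_eq_mul] at e1
  linear_combination -e1 - s * e2

/-- The first-order coefficient `λ₁` of the eigenvalue. -/
def speed (a b c : ℝ) : ℝ := Real.sqrt (forceConst a b c / normConst a b c)

theorem speed_pos (h : Admissible a b c) : 0 < speed a b c :=
  Real.sqrt_pos.2 (div_pos (forceConst_pos h) (normConst_pos h))

theorem speed_sq (h : Admissible a b c) :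
    speed a b c ^ 2 = forceConst a b c / normConst a b c :=
  Real.sq_sqrt (div_pos (forceConst_pos h) (normConst_pos h)).le

theorem integral_secondFun_pos (h : Admissible a b c)
    (hi : Integrable (secondFun a b c (speed a b c ^ 2))) :
    0 < ∫ z, secondFun a b c (speed a b c ^ 2) z := by
  have hf := normFactor_pos h.hc h.quot_bounds.1 h.quot_bounds.2
  have ht := h.theta_pos
  have hκ := div_pos h.sq_sub_pos h.c_pos
  rw [(h.hasInt_secondFun _ hi).2]
  refine mul_pos (mul_pos (mul_pos two_pos h.halfMass_pos) (by positivity)) ?_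
  refine second_pos h.hc h.quot_bounds.1 h.quot_bounds.2 ?_
  rw [speed_sq h, forceConst, normConst]
  have := hκ.ne'
  generalize (c ^ 2 - 1) / c = κ at *
  field_simp

/-- The branch of eigenvalues `λ(η) = iημ(η)`, and the corrections `w` for which `q + λu - η²w` is in
the kernel of the pencil. The function `w j` is the `j`-th derivative of `w 0` in `z`. -/
theorem exists_branch (h : Admissible a b c) (hw : WeightCond (theta a b c) α δ) :
    ∃ η₀ > 0, ∃ (lam μ : ℝ → ℂ) (w : ℕ → ℝ → ℝ →ᵇ ℂ) (lam₁ lam₂ : ℝ), 0 < lam₁ ∧ 0 < lam₂ ∧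
      ContDiffOn ℝ ∞ μ (Icc (-η₀) η₀) ∧ (∀ η, lam η = Complex.I * η * μ η) ∧
      (∃ C : ℝ, ∀ η ∈ Icc (-η₀) η₀,
        ‖lam η - (Complex.I * lam₁ * η - lam₂ * η ^ 2)‖ ≤ C * |η| ^ 3) ∧
      (∀ m, ∀ j ≤ 4, Reg α δ (Icc (-η₀) η₀) m (w j)) ∧
      (∀ η ∈ Icc (-η₀) η₀, ∀ j < 4, ∀ z,
        HasDerivAt (ev α δ (w j η)) (ev α δ (w (j + 1) η) z) z) ∧
      (∀ η ∈ Icc (-η₀) η₀, ∀ z, pencil a b c (-(η : ℂ) ^ 2) (lam η)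
        (fun j => sol a b c j z + lam η * prim a b c j z + -(η : ℂ) ^ 2 * ev α δ (w j η) z) z = 0) ∧
      (∀ η ∈ Icc (-η₀) η₀, conj (lam η) = lam (-η) ∧ ∀ j, star (w j η) = w j (-η)) := by
  obtain ⟨K, hKd, hK0, hKs⟩ := exists_correctionOperator h hw
  have hX := normConst_pos h
  have hXc : (normConst a b c : ℂ) ≠ 0 := by exact_mod_cast hX.ne'
  have hμ₀ := speed_pos h
  have hμc : (speed a b c : ℂ) ≠ 0 := by exact_mod_cast hμ₀.ne'
  set l : (ℝ →ᵇ ℂ) →L[ℂ] ℂ := (normConst a b c : ℂ)⁻¹ • pairQ hw with hl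
  have hla : ∀ f, l f = pairQ hw f / normConst a b c := fun f => by
    rw [hl, _root_.smul_apply, smul_eq_mul, inv_mul_eq_div]
  set R : ℂ × ℂ × (ℝ →ᵇ ℂ) → ℝ →ᵇ ℂ := fun p =>
    remainder a b c (qE hw) (uE hw) p.1 p.2.1 (fun j => K j p.2.2) with hR
  have hl0 : l (-opQ0 a b c (qE hw)) = (speed a b c : ℂ) ^ 2 := by
    rw [hla, map_neg, pairQ_force h, neg_neg]
    exact_mod_cast (speed_sq h).symm
  have hf₀ : star (-opQ0 a b c (qE hw)) = -opQ0 a b c (qE hw) := by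
    rw [star_neg, ← opQ0_star, funext (star_qE hw)]
  obtain ⟨r, hr, μ, f, hμ0, hf0, hb⟩ := exists_analytic_branch l R (contDiff_remainder _ _) _
    (speed a b c : ℂ) hμc hl0 hf₀ (Complex.conj_ofReal _)
    (fun f => by rw [hla, hla, pairQ_star, map_div₀, Complex.conj_ofReal])
    (fun s μ f => by
      simp only [hR, hKs]
      exact remainder_star a b c (star_qE hw) (star_uE hw) s μ _)
  have hμd : DifferentiableOn ℂ μ (Metric.ball 0 r) := fun s hs =>
    ((hb s hs).1.differentiableAt (by simp)).differentiableWithinAt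
  obtain ⟨ν, hν, hT⟩ := exists_taylor_two hr hμd
  have h0 : (0 : ℂ) ∈ Metric.ball 0 r := Metric.mem_ball_self hr
  -- The equation for the correction, with the solvability condition built in.
  have heq : ∀ s ∈ Metric.ball (0 : ℂ) r, opP0 a b c (fun j => K j (f s)) =
      -opQ0 a b c (qE hw) - s • remainder a b c (qE hw) (uE hw) s (μ s) (fun j => K j (f s)) -
      μ s ^ 2 • chi hw := fun s hs => by
    rw [hK0, ← hla, (hb s hs).2.2.2.1]
    congr 1
    exact (hb s hs).2.2.1
  have he0 := heq 0 h0
  rw [zero_smul, sub_zero, hμ0, ← Complex.ofReal_pow] at he0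
  obtain ⟨hpr, hsi⟩ := pairQ_remainder h hw rfl (fun j hj z => hKd (f 0) j hj z) he0
  have hJ := integral_secondFun_pos h hsi
  set J := ∫ z, secondFun a b c (speed a b c ^ 2) z with hJd
  -- The derivative of `μ` at `0` is read off from `ℓ(f(s)) = μ(s)²`.
  have hder : deriv μ 0 = ((J / (2 * normConst a b c) : ℝ) : ℂ) := by
    have e1 : ∀ s ∈ Metric.ball (0 : ℂ) r, s ≠ 0 →
        (deriv μ 0 + s * ν s) * (μ s + speed a b c) = -l (R (s, μ s, f s)) := fun s hs hs0 => by
      have e2 := congrArg l (hb s hs).2.2.1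
      rw [map_sub, map_smul, hl0, (hb s hs).2.2.2.1, smul_eq_mul] at e2
      have e3 := hT s
      rw [hμ0] at e3
      refine mul_left_cancel₀ hs0 ?_
      linear_combination e2 - (μ s + speed a b c) * e3
    have hν0 : ContinuousAt ν 0 := hν.continuousAt (Metric.ball_mem_nhds _ hr)
    have hμ0c : ContinuousAt μ 0 := (hb 0 h0).1.continuousAt
    have hf0c : ContinuousAt f 0 := (hb 0 h0).2.1.continuousAt
    have hRc : Continuous R := (contDiff_remainder (a := a) (b := b) (c := c) (K := K) _ _).continuous
    have c1 : Tendsto (fun s => (deriv μ 0 + s * ν s) * (μ s + speed a b c)) (𝓝[≠] 0)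
        (𝓝 ((deriv μ 0 + 0 * ν 0) * (μ 0 + speed a b c))) := by
      have : ContinuousAt (fun s => (deriv μ 0 + s * ν s) * (μ s + speed a b c)) 0 :=
        (continuousAt_const.add (continuousAt_id.mul hν0)).mul (hμ0c.add continuousAt_const)
      exact this.tendsto.mono_left nhdsWithin_le_nhds
    have c2 : Tendsto (fun s => -l (R (s, μ s, f s))) (𝓝[≠] 0) (𝓝 (-l (R (0, μ 0, f 0)))) := by
      have : ContinuousAt (fun s => -l (R (s, μ s, f s))) 0 :=
        ((l.continuous.comp hRc).continuousAt.comp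
          (continuousAt_id.prodMk (hμ0c.prodMk hf0c))).neg
      exact this.tendsto.mono_left nhdsWithin_le_nhds
    have e4 := tendsto_nhds_unique c1 (c2.congr' (by
      filter_upwards [self_mem_nhdsWithin, nhdsWithin_le_nhds (Metric.ball_mem_nhds (0 : ℂ) hr)]
        with s hs0 hs
      exact (e1 s hs hs0).symm))
    rw [hla, hμ0, zero_mul, add_zero] at e4
    simp only [hR] at e4
    rw [hpr] at e4
    have e5 : deriv μ 0 * (2 * normConst a b c) = J := by
      field_simp at e4
      linear_combination e4
    rw [Complex.ofReal_div, eq_div_iff (by push_cast; simpa using hXc)]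
    exact_mod_cast e5
  have hη₀ : 0 < r / 2 := half_pos hr
  have hmem : ∀ η ∈ Icc (-(r / 2)) (r / 2), Complex.I * (η : ℂ) ∈ Metric.closedBall (0 : ℂ) (r / 2) :=
    fun η hη => by
      rw [mem_closedBall_zero_iff, norm_mul, Complex.norm_I, one_mul, Complex.norm_real]
      exact abs_le.2 hη
  have hsub : Metric.closedBall (0 : ℂ) (r / 2) ⊆ Metric.ball 0 r :=
    Metric.closedBall_subset_ball (half_lt_self hr)
  have hlin : ContDiff ℝ ∞ fun η : ℝ => Complex.I * (η : ℂ) :=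
    contDiff_const.mul Complex.ofRealCLM.contDiff
  have hμs : ContDiffOn ℝ ∞ (fun η : ℝ => μ (Complex.I * η)) (Icc (-(r / 2)) (r / 2)) :=
    fun η hη => (((hb _ (hsub (hmem η hη))).1.restrict_scalars ℝ).comp η
      hlin.contDiffAt).contDiffWithinAt
  have hfs : ContDiffOn ℝ ∞ (fun η : ℝ => f (Complex.I * η)) (Icc (-(r / 2)) (r / 2)) :=
    fun η hη => (((hb _ (hsub (hmem η hη))).2.1.restrict_scalars ℝ).comp η
      hlin.contDiffAt).contDiffWithinAt
  have hsq : ∀ η : ℝ, (Complex.I * (η : ℂ)) ^ 2 = -(η : ℂ) ^ 2 := fun η => by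
    rw [mul_pow, Complex.I_sq]; ring
  have hcj : ∀ η : ℝ, Complex.I * ((-η : ℝ) : ℂ) = conj (Complex.I * (η : ℂ)) := fun η => by
    rw [map_mul, Complex.conj_I, Complex.conj_ofReal]; push_cast; ring
  refine ⟨r / 2, hη₀, fun η => Complex.I * η * μ (Complex.I * η), fun η => μ (Complex.I * η),
    fun j η => K j (f (Complex.I * η)), speed a b c, J / (2 * normConst a b c), hμ₀,
    by positivity, hμs, fun η => rfl, ?_, ?_, fun η _ j hj z => hKd _ j hj z, fun η hη z => ?_,
    fun η hη => ⟨?_, fun j => ?_⟩⟩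
  · obtain ⟨C, hC⟩ := (isCompact_closedBall (0 : ℂ) (r / 2)).exists_bound_of_continuousOn
      (hν.mono hsub)
    refine ⟨C, fun η hη => ?_⟩
    have e1 : Complex.I * η * μ (Complex.I * η) - (Complex.I * speed a b c * η -
        ((J / (2 * normConst a b c) : ℝ) : ℂ) * η ^ 2) =
        ν (Complex.I * η) * (Complex.I * η) ^ 3 := by
      rw [hT (Complex.I * η), hμ0, hder]
      linear_combination ((J / (2 * normConst a b c) : ℝ) : ℂ) * hsq η
    rw [e1, norm_mul, norm_pow, norm_mul, Complex.norm_I, one_mul, Complex.norm_real]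
    exact mul_le_mul_of_nonneg_right (hC _ (hmem η hη)) (by positivity)
  · exact Reg.of_equation h (s := fun η : ℝ => Complex.I * η) (μ := fun η : ℝ => μ (Complex.I * η))
      (fun m j => hw.reg_elem _ m _) (fun m j => hw.reg_elem _ m _) hlin.contDiffOn hμs
      (fun j => ((K j).restrictScalars ℝ).contDiff.comp_contDiffOn hfs)
      (fun η _ j hj z => hKd _ j hj z) (fun η hη => heq _ (hsub (hmem η hη)))
  · have := pencil_eq_zero h (α := α) (δ := δ) (z := z) (ev_qE hw · z) (ev_uE hw · z)
      (heq _ (hsub (hmem η hη)))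
    simpa only [hsq, ev_qE, ev_uE] using this
  · beta_reduce
    rw [hcj, (hb _ (hsub (hmem η hη))).2.2.2.2.1, map_mul]
  · beta_reduce
    rw [← hKs, hcj, (hb _ (hsub (hmem η hη))).2.2.2.2.2]

end branch

/-! ### Classical solutions of the eigenvalue problem -/

section classical

variable {a b c α δ : ℝ}

theorem integral_mul_helmEta {f f' f'' : ℝ → ℂ} (hf : ∀ z, HasDerivAt f (f' z) z)
    (hf' : ∀ z, HasDerivAt f' (f'' z) z) (hc : Continuous f'') (d η : ℝ) {φ : ℝ → ℂ}
    (hφ : IsTest φ) :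
    ∫ z, f z * helmEta d η φ z = ∫ z, ((1 + d * η ^ 2) * f z - d * f'' z) * φ z := by
  have hfc : Continuous f := continuous_iff_continuousAt.2 fun z => (hf z).continuousAt
  have hfc' : Continuous f' := continuous_iff_continuousAt.2 fun z => (hf' z).continuousAt
  have h1 := ((weakDeriv_zero f'').of_hasDerivAt hf' hc).of_hasDerivAt hf hfc' φ hφ
  have h2 := hφ.iteratedDeriv 2
  have i1 : Integrable fun z => f z * φ z :=
    (hfc.mul hφ.1.continuous).integrable_of_hasCompactSupport hφ.2.mul_left
  have i2 : Integrable fun z => f z * iteratedDeriv 2 φ z :=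
    (hfc.mul h2.1).integrable_of_hasCompactSupport h2.2.mul_left
  have i3 : Integrable fun z => f'' z * φ z :=
    (hc.mul hφ.1.continuous).integrable_of_hasCompactSupport hφ.2.mul_left
  have e1 : ∀ z, f z * helmEta d η φ z =
      (1 + d * η ^ 2) * (f z * φ z) - d * (f z * iteratedDeriv 2 φ z) := fun z => by
    rw [helmEta]; ring
  have e2 : ∀ z, ((1 + d * η ^ 2) * f z - d * f'' z) * φ z =
      (1 + d * η ^ 2) * (f z * φ z) - d * (f'' z * φ z) := fun z => by ring
  simp only [e1, e2]
  rw [integral_sub (i1.const_mul _) (i2.const_mul _), integral_sub (i1.const_mul _) (i3.const_mul _),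
    integral_const_mul, integral_const_mul, integral_const_mul, h1]
  norm_num

theorem continuous_sol (a b c : ℝ) (j : ℕ) : Continuous fun z => (sol a b c j z : ℂ) :=
  Complex.continuous_ofReal.comp (continuous_profile _ _)

/-- A function in the kernel of the pencil gives an eigenfunction of the linearized operator. -/
theorem memGraph_of_pencil (hδ : 0 < δ) {η : ℝ} {lam : ℂ} {v : ℕ → ℝ →ᵇ ℂ}
    (hd : ∀ j < 4, ∀ z, HasDerivAt (ev α δ (v j)) (ev α δ (v (j + 1)) z) z)
    (hp : ∀ z, pencil a b c (-(η : ℂ) ^ 2) lam (fun j => ev α δ (v j) z) z = 0)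
    {u : WL2 α × WL2 α} (hu : u = (toWL2 α hδ (v 0), toWL2 α hδ (lam • v 0 - (c : ℂ) • v 1))) :
    MemGraph a b c α η u (lam • u) := by
  subst hu
  have hc : ∀ j, Continuous (ev α δ (v j)) := fun j => continuous_ev _
  have h0 := hd 0 (by norm_num)
  have h1 := hd 1 (by norm_num)
  have h2 := hd 2 (by norm_num)
  have h3 := hd 3 (by norm_num)
  simp only [Nat.reduceAdd] at h0 h1 h2 h3
  have ae : ∀ F : ℝ →ᵇ ℂ, (toWL2 α hδ F : ℝ → ℂ) =ᵐ[volume] ev α δ F := coeFn_toWL2 α hδ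
  refine ⟨toWL2 α hδ (v 1), toWL2 α hδ (v 2), toWL2 α hδ (lam • v 1 - (c : ℂ) • v 2),
    toWL2 α hδ (lam ^ 2 • v 0 - (2 * c * lam) • v 1 + (c : ℂ) ^ 2 • v 2), ?_, ?_, ?_, ?_, ?_⟩
  · exact weakDeriv_congr (ae _) (ae _) ((weakDeriv_zero _).of_hasDerivAt h0 (hc 1))
  · exact weakDeriv_congr (ae _) (ae _)
      (((weakDeriv_zero _).of_hasDerivAt h1 (hc 2)).of_hasDerivAt h0 (hc 1))
  · refine weakDeriv_congr (ae _) (ae _) ((weakDeriv_zero _).of_hasDerivAt (fun z => ?_)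
      (continuous_ev _))
    rw [funext (ev_sub (α := α) (δ := δ) _ _)]
    simp only [ev_sub, ev_smul]
    exact ((h0 z).const_mul lam).sub ((h1 z).const_mul (c : ℂ))
  · intro φ hφ
    have e1 : ∫ z, (toWL2 α hδ (lam ^ 2 • v 0 - (2 * c * lam) • v 1 + (c : ℂ) ^ 2 • v 2)) z *
        helmEta b η φ z = ∫ z, (lam ^ 2 * ev α δ (v 0) z - 2 * c * lam * ev α δ (v 1) z +
          (c : ℂ) ^ 2 * ev α δ (v 2) z) * helmEta b η φ z := by
      refine integral_congr_ae ?_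
      filter_upwards [ae (lam ^ 2 • v 0 - (2 * c * lam) • v 1 + (c : ℂ) ^ 2 • v 2)] with z hz
      rw [hz]; simp only [ev_add, ev_sub, ev_smul]
    have e2 : ∫ z, ((toWL2 α hδ (v 2)) z - η ^ 2 * (toWL2 α hδ (v 0)) z) * helmEta a η φ z =
        ∫ z, (ev α δ (v 2) z - η ^ 2 * ev α δ (v 0) z) * helmEta a η φ z := by
      refine integral_congr_ae ?_
      filter_upwards [ae (v 2), ae (v 0)] with z hz hz'
      rw [hz, hz']
    have e3 : ∫ z, (2 * rcz a b c z * (toWL2 α hδ (v 1)) z +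
        rc a b c z * ((toWL2 α hδ (v 2)) z - η ^ 2 * (toWL2 α hδ (v 0)) z)) * φ z =
        ∫ z, (2 * (-c * sol a b c 1 z) * ev α δ (v 1) z +
          (-c * sol a b c 0 z) * (ev α δ (v 2) z - η ^ 2 * ev α δ (v 0) z)) * φ z := by
      refine integral_congr_ae ?_
      filter_upwards [ae (v 2), ae (v 1), ae (v 0)] with z hz hz' hz''
      rw [hz, hz', hz'', Admissible.rcz_eq, Admissible.qcz_eq, rc, Admissible.qc_eq]
      push_cast; rfl
    have e4 : ∫ z, (2 * qc a b c z * (toWL2 α hδ (lam • v 1 - (c : ℂ) • v 2)) z +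
        qcz a b c z * (toWL2 α hδ (lam • v 0 - (c : ℂ) • v 1)) z) * φ z =
        ∫ z, (2 * sol a b c 0 z * (lam * ev α δ (v 1) z - c * ev α δ (v 2) z) +
          sol a b c 1 z * (lam * ev α δ (v 0) z - c * ev α δ (v 1) z)) * φ z := by
      refine integral_congr_ae ?_
      filter_upwards [ae (lam • v 1 - (c : ℂ) • v 2), ae (lam • v 0 - (c : ℂ) • v 1)] with z hz hz'
      rw [hz, hz', Admissible.qcz_eq, Admissible.qc_eq]
      simp only [ev_sub, ev_smul]
    have s0 := continuous_sol a b c 0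
    have s1 := continuous_sol a b c 1
    have c0 := hc 0
    have c1 := hc 1
    have c2 := hc 2
    have c3 := hc 3
    have c4 := hc 4
    have hi : ∀ f : ℝ → ℂ, Continuous f → Integrable fun z => f z * φ z := fun f hf =>
      (hf.mul hφ.1.continuous).integrable_of_hasCompactSupport hφ.2.mul_left
    rw [e1, e2, e3, e4]
    have k1 := integral_mul_helmEta
      (f := fun z => lam ^ 2 * ev α δ (v 0) z - 2 * c * lam * ev α δ (v 1) z +
        (c : ℂ) ^ 2 * ev α δ (v 2) z)
      (f'' := fun z => lam ^ 2 * ev α δ (v 2) z - 2 * c * lam * ev α δ (v 3) z +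
        (c : ℂ) ^ 2 * ev α δ (v 4) z)
      (fun z => (((h0 z).const_mul (lam ^ 2)).sub
        ((h1 z).const_mul (2 * c * lam))).add ((h2 z).const_mul ((c : ℂ) ^ 2)))
      (fun z => (((h1 z).const_mul (lam ^ 2)).sub
        ((h2 z).const_mul (2 * c * lam))).add ((h3 z).const_mul ((c : ℂ) ^ 2)))
      (by fun_prop) b η hφ
    have k2 := integral_mul_helmEta
      (f := fun z => ev α δ (v 2) z - η ^ 2 * ev α δ (v 0) z)
      (f'' := fun z => ev α δ (v 4) z - η ^ 2 * ev α δ (v 2) z)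
      (fun z => (h2 z).sub ((h0 z).const_mul ((η : ℂ) ^ 2)))
      (fun z => (h3 z).sub ((h1 z).const_mul ((η : ℂ) ^ 2))) (by fun_prop) a η hφ
    have hs : ∀ f g : ℝ → ℂ, Continuous f → Continuous g →
        (∫ z, f z * φ z) - ∫ z, g z * φ z = ∫ z, (f z - g z) * φ z := fun f g hf hg => by
      simp only [sub_mul]
      rw [integral_sub (hi f hf) (hi g hg)]
    rw [k1, k2, hs _ _ (by fun_prop) (by fun_prop), hs _ _ (by fun_prop) (by fun_prop)]
    congr 1; funext z
    have hz := hp z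
    simp only [pencil, disp] at hz
    push_cast at hz
    linear_combination φ z * hz
  · simp only [Prod.smul_mk, ← map_smul, ← map_add]
    congr 2
    · rw [add_sub_cancel]
    · module

end classical

/-! ### Extension of distributional identities by cutoff -/

/-- A smooth cutoff function with its first two derivatives and a common bound for them. -/
theorem exists_cutoff : ∃ (χ χ' χ'' : ℝ → ℂ) (M : ℝ), IsTest χ ∧ χ 0 = 1 ∧ Continuous χ' ∧
    Continuous χ'' ∧ (∀ z, HasDerivAt χ (χ' z) z) ∧ (∀ z, HasDerivAt χ' (χ'' z) z) ∧
    ∀ z, ‖χ z‖ ≤ M ∧ ‖χ' z‖ ≤ M ∧ ‖χ'' z‖ ≤ M := by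
  let f : ContDiffBump (0 : ℝ) := ⟨1, 2, one_pos, one_lt_two⟩
  have hc : ContDiff ℝ ∞ fun z => (f z : ℂ) := Complex.ofRealCLM.contDiff.comp f.contDiff
  have ht : IsTest fun z => (f z : ℂ) := ⟨hc, f.hasCompactSupport.comp_left Complex.ofReal_zero⟩
  obtain ⟨M₀, h0⟩ := ht.2.exists_bound_of_continuous ht.1.continuous
  obtain ⟨M₁, h1⟩ := ht.deriv.2.exists_bound_of_continuous ht.deriv.1.continuous
  obtain ⟨M₂, h2⟩ := ht.deriv.deriv.2.exists_bound_of_continuous ht.deriv.deriv.1.continuous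
  refine ⟨_, _, _, max M₀ (max M₁ M₂), ht, ?_, ht.deriv.1.continuous, ht.deriv.deriv.1.continuous,
    fun z => (ht.1.differentiable (by simp) z).hasDerivAt,
    fun z => (ht.deriv.1.differentiable (by simp) z).hasDerivAt,
    fun z => ⟨(h0 z).trans (le_max_left _ _), (h1 z).trans ((le_max_left _ _).trans (le_max_right _ _)),
      (h2 z).trans ((le_max_right _ _).trans (le_max_right _ _))⟩⟩
  have : f 0 = 1 := f.one_of_mem_closedBall (by simp [f])
  rw [this, Complex.ofReal_one]

/-- An identity `∫ (G₀φ + G₁φ' + G₂φ'') = 0` for all test functions extends to smooth functions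
`φ` in whose weight the products are integrable. -/
theorem integral_eq_zero_of_test {G₀ G₁ G₂ Φ Φ' Φ'' : ℝ → ℂ}
    (hG : ∀ φ : ℝ → ℂ, IsTest φ →
      ∫ z, (G₀ z * φ z + G₁ z * deriv φ z + G₂ z * iteratedDeriv 2 φ z) = 0)
    (hΦ : ContDiff ℝ ∞ Φ) (hd : ∀ z, HasDerivAt Φ (Φ' z) z) (hd' : ∀ z, HasDerivAt Φ' (Φ'' z) z)
    (i00 : Integrable fun z => G₀ z * Φ z) (i10 : Integrable fun z => G₁ z * Φ z)
    (i11 : Integrable fun z => G₁ z * Φ' z) (i20 : Integrable fun z => G₂ z * Φ z)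
    (i21 : Integrable fun z => G₂ z * Φ' z) (i22 : Integrable fun z => G₂ z * Φ'' z) :
    ∫ z, (G₀ z * Φ z + G₁ z * Φ' z + G₂ z * Φ'' z) = 0 := by
  obtain ⟨χ, χ', χ'', M, hχ, hχ0, hc1, hc2, h1, h2, hM⟩ := exists_cutoff
  let ε : ℕ → ℝ := fun n => 1 / ((n : ℝ) + 1)
  have hε : Tendsto ε atTop (𝓝 0) := tendsto_one_div_add_atTop_nhds_zero_nat
  have hε1 : ∀ n, |ε n| ≤ 1 := fun n => by
    have : (0 : ℝ) < (n : ℝ) + 1 := by positivity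
    rw [abs_of_nonneg (by positivity)]
    exact (div_le_one this).2 (by linarith [n.cast_nonneg (α := ℝ)])
  have hεc : ∀ n, ‖(ε n : ℂ)‖ ≤ 1 := fun n => by rw [Complex.norm_real]; exact hε1 n
  let φ : ℕ → ℝ → ℂ := fun n z => χ (ε n * z) * Φ z
  let φ' : ℕ → ℝ → ℂ := fun n z => ε n * χ' (ε n * z) * Φ z + χ (ε n * z) * Φ' z
  let φ'' : ℕ → ℝ → ℂ := fun n z =>
    ε n * (ε n * χ'' (ε n * z)) * Φ z + 2 * (ε n * χ' (ε n * z) * Φ' z) + χ (ε n * z) * Φ'' z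
  have dχ : ∀ n z, HasDerivAt (fun x => χ (ε n * x)) (ε n * χ' (ε n * z)) z := fun n z => by
    simpa [Function.comp_def] using (h1 (ε n * z)).scomp z ((hasDerivAt_id z).const_mul (ε n))
  have dχ' : ∀ n z, HasDerivAt (fun x => χ' (ε n * x)) (ε n * χ'' (ε n * z)) z := fun n z => by
    simpa [Function.comp_def] using (h2 (ε n * z)).scomp z ((hasDerivAt_id z).const_mul (ε n))
  have d1 : ∀ n z, HasDerivAt (φ n) (φ' n z) z := fun n z => (dχ n z).mul (hd z)
  have d2 : ∀ n z, HasDerivAt (φ' n) (φ'' n z) z := fun n z => by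
    refine ((((dχ' n z).const_mul (ε n : ℂ)).mul (hd z)).add ((dχ n z).mul (hd' z))).congr_deriv ?_
    simp only [φ'']; ring
  have hφ : ∀ n, IsTest (φ n) := fun n => by
    have hn : ε n ≠ 0 := by have : (0 : ℝ) < (n : ℝ) + 1 := by positivity
                            exact (one_div_pos.2 this).ne'
    refine ⟨(hχ.1.comp (contDiff_const.mul contDiff_id)).mul hΦ, HasCompactSupport.mul_right ?_⟩
    exact hχ.2.comp_homeomorph (Homeomorph.mulLeft₀ (ε n) hn)
  have hz : ∀ n, ∫ z, (G₀ z * φ n z + G₁ z * φ' n z + G₂ z * φ'' n z) = 0 := fun n => by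
    have e1 : deriv (φ n) = φ' n := funext fun z => (d1 n z).deriv
    have e2 : iteratedDeriv 2 (φ n) = φ'' n := by
      rw [iteratedDeriv_succ, iteratedDeriv_one, e1]; exact funext fun z => (d2 n z).deriv
    have := hG _ (hφ n)
    rwa [e1, e2] at this
  have hM0 : 0 ≤ M := (norm_nonneg _).trans (hM 0).1
  -- The coefficient bounds come from `|ε| ≤ 1`.
  let bd : ℝ → ℝ := fun z => M * ‖G₀ z * Φ z‖ + (M * ‖G₁ z * Φ z‖ + M * ‖G₁ z * Φ' z‖) +
    (M * ‖G₂ z * Φ z‖ + 2 * (M * ‖G₂ z * Φ' z‖) + M * ‖G₂ z * Φ'' z‖)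
  have hbi : Integrable bd := ((i00.norm.const_mul M).add ((i10.norm.const_mul M).add
    (i11.norm.const_mul M))).add (((i20.norm.const_mul M).add
    ((i21.norm.const_mul M).const_mul 2)).add (i22.norm.const_mul M))
  have hform : ∀ n z, G₀ z * φ n z + G₁ z * φ' n z + G₂ z * φ'' n z =
      χ (ε n * z) * (G₀ z * Φ z) +
      (ε n * χ' (ε n * z) * (G₁ z * Φ z) + χ (ε n * z) * (G₁ z * Φ' z)) +
      (ε n * (ε n * χ'' (ε n * z)) * (G₂ z * Φ z) + 2 * (ε n * χ' (ε n * z) * (G₂ z * Φ' z)) +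
        χ (ε n * z) * (G₂ z * Φ'' z)) := fun n z => by
    simp only [φ, φ', φ'']; ring
  have hcχ : Continuous χ := hχ.1.continuous
  have key : Tendsto (fun n => ∫ z, (G₀ z * φ n z + G₁ z * φ' n z + G₂ z * φ'' n z)) atTop
      (𝓝 (∫ z, (G₀ z * Φ z + G₁ z * Φ' z + G₂ z * Φ'' z))) := by
    refine tendsto_integral_of_dominated_convergence bd (fun n => ?_) hbi (fun n => ?_) ?_
    · simp only [hform]
      have m0 : AEStronglyMeasurable fun z => χ (ε n * z) :=
        (by fun_prop : Continuous fun z => χ (ε n * z)).aestronglyMeasurable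
      have m1 : AEStronglyMeasurable fun z => (ε n : ℂ) * χ' (ε n * z) :=
        (by fun_prop : Continuous fun z => (ε n : ℂ) * χ' (ε n * z)).aestronglyMeasurable
      have m2 : AEStronglyMeasurable fun z => (ε n : ℂ) * ((ε n : ℂ) * χ'' (ε n * z)) :=
        (by fun_prop : Continuous fun z => (ε n : ℂ) * ((ε n : ℂ) * χ'' (ε n * z))).aestronglyMeasurable
      exact ((m0.mul i00.1).add ((m1.mul i10.1).add (m0.mul i11.1))).add
        (((m2.mul i20.1).add ((m1.mul i21.1).const_mul 2)).add (m0.mul i22.1))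
    · refine Eventually.of_forall fun z => ?_
      rw [hform]
      have n1 : ‖(ε n : ℂ) * χ' (ε n * z)‖ ≤ M := by
        rw [norm_mul]
        calc _ ≤ 1 * M := mul_le_mul (hεc n) (hM _).2.1 (norm_nonneg _) zero_le_one
          _ = M := one_mul M
      have n2 : ‖(ε n : ℂ) * (ε n * χ'' (ε n * z))‖ ≤ M := by
        rw [norm_mul, norm_mul]
        calc _ ≤ 1 * (1 * M) := mul_le_mul (hεc n) (mul_le_mul (hεc n) (hM _).2.2 (norm_nonneg _)
              zero_le_one) (by positivity) zero_le_one
          _ = M := by ring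
      have n0 := (hM (ε n * z)).1
      refine (norm_add₃_le).trans (add_le_add (add_le_add ?_ ((norm_add_le _ _).trans
        (add_le_add ?_ ?_))) ((norm_add₃_le).trans (add_le_add (add_le_add ?_ ?_) ?_)))
      · rw [norm_mul]; gcongr
      · rw [norm_mul]; gcongr
      · rw [norm_mul]; gcongr
      · rw [norm_mul]; gcongr
      · rw [norm_mul, norm_mul]; simp only [Complex.norm_ofNat]; gcongr
      · rw [norm_mul]; gcongr
    · refine Eventually.of_forall fun z => ?_
      have hεz : Tendsto (fun n => ε n * z) atTop (𝓝 0) := by simpa using hε.mul_const z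
      have hεC : Tendsto (fun n => (ε n : ℂ)) atTop (𝓝 0) := by
        simpa [Function.comp_def] using (Complex.continuous_ofReal.tendsto 0).comp hε
      have t0 : Tendsto (fun n => χ (ε n * z)) atTop (𝓝 1) := by
        have := (hcχ.tendsto 0).comp hεz; rwa [hχ0] at this
      have t1 : Tendsto (fun n => (ε n : ℂ) * χ' (ε n * z)) atTop (𝓝 0) := by
        have := hεC.mul ((hc1.tendsto 0).comp hεz); rwa [zero_mul] at this
      have t2 : Tendsto (fun n => (ε n : ℂ) * (ε n * χ'' (ε n * z))) atTop (𝓝 0) := by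
        have := hεC.mul (hεC.mul ((hc2.tendsto 0).comp hεz)); rwa [zero_mul] at this
      simp only [hform]
      have := ((t0.mul_const (G₀ z * Φ z)).add ((t1.mul_const (G₁ z * Φ z)).add
        (t0.mul_const (G₁ z * Φ' z)))).add (((t2.mul_const (G₂ z * Φ z)).add
        ((t1.mul_const (G₂ z * Φ' z)).const_mul 2)).add (t0.mul_const (G₂ z * Φ'' z)))
      simpa using this
  simp only [hz] at key
  exact (tendsto_nhds_unique key tendsto_const_nhds)

/-! ### Classical solutions of the adjoint eigenvalue problem -/

section adjoint

variable {a b c α δ : ℝ}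

theorem contDiff_sol (a b c : ℝ) (j : ℕ) : ContDiff ℝ ∞ fun z => (sol a b c j z : ℂ) := by
  refine contDiff_infty.2 fun n => ?_
  induction n generalizing j with
  | zero => exact contDiff_zero.2 (continuous_sol a b c j)
  | succ n ih =>
    have hd : ∀ z, HasDerivAt (fun z => (sol a b c j z : ℂ)) (sol a b c (j + 1) z) z := fun z =>
      (Admissible.hasDerivAt_qJ a b c j z).ofReal_comp
    push_cast
    rw [contDiff_succ_iff_deriv]
    refine ⟨fun z => (hd z).differentiableAt, by simp, ?_⟩
    rw [funext fun z => (hd z).deriv]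
    exact ih (j + 1)

/-- The function `G` is integrable against the functions which are small in the dual weight. -/
def DualIntegrable (α δ : ℝ) (G : ℝ → ℂ) : Prop :=
  ∀ F : ℝ →ᵇ ℂ, Integrable fun z => G z * ev (-α) δ F z

namespace DualIntegrable

variable {G H : ℝ → ℂ}

theorem of_WL2 (hδ : 0 < δ) (u : WL2 α) : DualIntegrable α δ u := fun F =>
  WL2.integrable_mul_ev hδ u F

theorem add (hG : DualIntegrable α δ G) (hH : DualIntegrable α δ H) :
    DualIntegrable α δ fun z => G z + H z := fun F => by
  simp only [add_mul]; exact (hG F).add (hH F)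

theorem sub (hG : DualIntegrable α δ G) (hH : DualIntegrable α δ H) :
    DualIntegrable α δ fun z => G z - H z := fun F => by
  simp only [sub_mul]; exact (hG F).sub (hH F)

theorem const_mul (r : ℂ) (hG : DualIntegrable α δ G) : DualIntegrable α δ fun z => r * G z :=
  fun F => by simp only [mul_assoc]; exact (hG F).const_mul r

theorem bdd_mul (g : ℝ →ᵇ ℂ) (hG : DualIntegrable α δ G) : DualIntegrable α δ fun z => g z * G z :=
  fun F => by
    refine (hG (g * F)).congr (Eventually.of_forall fun z => ?_)
    simp only [ev_mul]; ring

theorem sol_mul (hG : DualIntegrable α δ G) : DualIntegrable α δ fun z => sol a b c 0 z * G z := by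
  simpa only [solMul_apply] using hG.bdd_mul (solMul a b c)

theorem sol_one_mul (hG : DualIntegrable α δ G) :
    DualIntegrable α δ fun z => sol a b c 1 z * G z := by
  simpa only [solMulDeriv_apply] using hG.bdd_mul (solMulDeriv a b c)

end DualIntegrable

theorem WeakDeriv.of_two {u u₁ u₂ : ℝ → ℂ} (h1 : WeakDeriv 1 u u₁) (h2 : WeakDeriv 2 u u₂) :
    WeakDeriv 1 u₁ u₂ := fun φ hφ => by
  have e1 := h1 _ hφ.deriv
  have e2 := h2 _ hφ
  rw [iteratedDeriv_succ, iteratedDeriv_one] at e2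
  rw [iteratedDeriv_one] at e1 ⊢
  rw [e2] at e1
  linear_combination e1

/-- Integration by parts of a weak derivative against a smooth function in the dual weight. -/
theorem WeakDeriv.integral_add_eq_zero (hδ : 0 < δ) {u u' : WL2 α} (h : WeakDeriv 1 u u')
    {F F' : ℝ →ᵇ ℂ} (hd : ∀ z, HasDerivAt (ev (-α) δ F) (ev (-α) δ F' z) z)
    (hs : ContDiff ℝ ∞ (ev (-α) δ F)) :
    ∫ z, (u' z * ev (-α) δ F z + u z * ev (-α) δ F' z) = 0 := by
  have hF' : ContDiff ℝ ∞ (ev (-α) δ F') := by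
    have := (contDiff_infty_iff_deriv.1 hs).2
    rwa [funext fun z => (hd z).deriv] at this
  have h0 := integral_eq_zero_of_test (G₀ := u') (G₁ := u) (G₂ := 0) (Φ := ev (-α) δ F)
    (Φ' := ev (-α) δ F') (Φ'' := deriv (ev (-α) δ F')) (fun φ hφ => ?_) hs hd
    (fun z => (hF'.differentiable (by simp) z).hasDerivAt) (WL2.integrable_mul_ev hδ u' F)
    (WL2.integrable_mul_ev hδ u F) (WL2.integrable_mul_ev hδ u F') (by simp) (by simp) (by simp)
  · simpa using h0
  · have e := h φ hφ
    rw [iteratedDeriv_one] at e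
    simp only [Pi.zero_apply, zero_mul, add_zero]
    rw [integral_add (WL2.integrable_mul u' hφ.1.continuous hφ.2)
      (WL2.integrable_mul u hφ.deriv.1.continuous hφ.deriv.2), e]
    ring

/-- The first component of the adjoint eigenfunction in terms of its scalar potential. -/
def adjFst (a b c η : ℝ) (lam : ℂ) (p : ℕ → ℝ →ᵇ ℂ) : ℝ →ᵇ ℂ :=
  lam • ((1 + b * η ^ 2 : ℂ) • p 0 - (b : ℂ) • p 2) +
    (c : ℂ) • ((1 + b * η ^ 2 : ℂ) • p 1 - (b : ℂ) • p 3) -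
    ((2 : ℂ) • (solMul a b c * p 1) + solMulDeriv a b c * p 0)

/-- The second component of the adjoint eigenfunction in terms of its scalar potential. -/
def adjSnd (b η : ℝ) (p : ℕ → ℝ →ᵇ ℂ) : ℝ →ᵇ ℂ := (1 + b * η ^ 2 : ℂ) • p 0 - (b : ℂ) • p 2

theorem memAdjointGraph_of_pencil (hδ : 0 < δ) {η : ℝ} {lam : ℂ} {p : ℕ → ℝ →ᵇ ℂ}
    (hd : ∀ j < 4, ∀ z, HasDerivAt (ev (-α) δ (p j)) (ev (-α) δ (p (j + 1)) z) z)
    (hs : ∀ j ≤ 4, ContDiff ℝ ∞ (ev (-α) δ (p j)))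
    (hp : ∀ z, pencil a b c (-(η : ℂ) ^ 2) lam (fun j => (-1) ^ j * ev (-α) δ (p j) z) (-z) = 0)
    {v : WL2 (-α) × WL2 (-α)}
    (hv1 : ∀ᵐ z, conj (v.1 z) = ev (-α) δ (adjFst a b c η lam p) z)
    (hv2 : ∀ᵐ z, conj (v.2 z) = ev (-α) δ (adjSnd b η p) z) :
    MemAdjointGraph a b c α η v (conj lam • v) := by
  rintro f _ ⟨du, ddu, dw, g, k1, k2, k3, kg, rfl⟩
  have d0 := hd 0 (by norm_num)
  have d1 := hd 1 (by norm_num)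
  have d2 := hd 2 (by norm_num)
  have d3 := hd 3 (by norm_num)
  have s0 := hs 0 (by norm_num)
  have s1 := hs 1 (by norm_num)
  have s2 := hs 2 (by norm_num)
  have s3 := hs 3 (by norm_num)
  simp only [Nat.reduceAdd] at d0 d1 d2 d3
  have q0 := contDiff_sol a b c 0
  have q1 := contDiff_sol a b c 1
  have dq : ∀ z, HasDerivAt (fun z => (sol a b c 0 z : ℂ)) (sol a b c 1 z) z := fun z =>
    (Admissible.hasDerivAt_qJ a b c 0 z).ofReal_comp
  have A : ∀ u : WL2 α, DualIntegrable α δ u := DualIntegrable.of_WL2 hδ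
  -- The defining identity of the operator, tested with the potential `p`.
  let G₀ : ℝ → ℂ := fun z => (1 + b * η ^ 2) * g z - (1 + a * η ^ 2) * (ddu z - η ^ 2 * f.1 z) -
    (2 * c) * (sol a b c 1 z * du z) - c * (sol a b c 0 z * (ddu z - η ^ 2 * f.1 z)) +
    (2 * (sol a b c 0 z * dw z) + sol a b c 1 z * f.2 z)
  let G₂ : ℝ → ℂ := fun z => a * (ddu z - η ^ 2 * f.1 z) - b * g z
  have A0 : DualIntegrable α δ G₀ :=
    (((((A g).const_mul _).sub (((A ddu).sub ((A f.1).const_mul _)).const_mul _)).sub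
      ((A du).sol_one_mul.const_mul _)).sub ((((A ddu).sub
      ((A f.1).const_mul _)).sol_mul).const_mul _)).add
      ((((A dw).sol_mul).const_mul _).add (A f.2).sol_one_mul)
  have A2 : DualIntegrable α δ G₂ :=
    (((A ddu).sub ((A f.1).const_mul _)).const_mul _).sub ((A g).const_mul _)
  have E1 := integral_eq_zero_of_test (G₀ := G₀) (G₁ := 0) (G₂ := G₂) (Φ := ev (-α) δ (p 0))
    (fun φ hφ => by
      have h2 := hφ.isTest_iteratedDeriv 2
      have hI : ∀ (u : WL2 α) (ψ : ℝ → ℂ), Continuous ψ → Integrable fun z => u z * (ψ z * φ z) :=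
        fun u ψ hψ => WL2.integrable_mul u (hψ.mul hφ.1.continuous) hφ.2.mul_left
      have hI2 : ∀ u : WL2 α, Integrable fun z => u z * iteratedDeriv 2 φ z := fun u =>
        WL2.integrable_mul u h2.1.continuous h2.2
      have hI0 : ∀ u : WL2 α, Integrable fun z => u z * φ z := fun u =>
        WL2.integrable_mul u hφ.1.continuous hφ.2
      have hg : Integrable fun z => g z * helmEta b η φ z := by
        refine (((hI0 g).const_mul (1 + b * η ^ 2 : ℂ)).sub ((hI2 g).const_mul (b : ℂ))).congr
          (Eventually.of_forall fun z => ?_)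
        simp only [Pi.sub_apply, helmEta]; ring
      have ha : Integrable fun z => (ddu z - η ^ 2 * f.1 z) * helmEta a η φ z := by
        refine ((((hI0 ddu).const_mul (1 + a * η ^ 2 : ℂ)).sub ((hI2 ddu).const_mul (a : ℂ))).sub
          ((((hI0 f.1).const_mul (1 + a * η ^ 2 : ℂ)).sub
            ((hI2 f.1).const_mul (a : ℂ))).const_mul (η ^ 2 : ℂ))).congr
          (Eventually.of_forall fun z => ?_)
        simp only [Pi.sub_apply, helmEta]; ring
      have hr : Integrable fun z =>
          (2 * rcz a b c z * du z + rc a b c z * (ddu z - η ^ 2 * f.1 z)) * φ z := by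
        refine ((((hI du _ q1.continuous).const_mul (-(2 * c) : ℂ))).add
          (((hI ddu _ q0.continuous).sub ((hI f.1 _ q0.continuous).const_mul (η ^ 2 : ℂ))).const_mul
            (-c : ℂ))).congr (Eventually.of_forall fun z => ?_)
        simp only [Pi.sub_apply, Pi.add_apply, Admissible.rcz_eq, Admissible.qcz_eq, rc,
          Admissible.qc_eq]
        push_cast; ring
      have hq : Integrable fun z => (2 * qc a b c z * dw z + qcz a b c z * f.2 z) * φ z := by
        refine (((hI dw _ q0.continuous).const_mul (2 : ℂ)).add (hI f.2 _ q1.continuous)).congr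
          (Eventually.of_forall fun z => ?_)
        simp only [Pi.add_apply, Admissible.qcz_eq, Admissible.qc_eq]
        ring
      have e := kg φ hφ
      have t1 := integral_sub ha hr
      have t2 := integral_sub (ha.sub hr) hq
      have t3 := integral_sub hg ((ha.sub hr).sub hq)
      simp only [Pi.sub_apply] at t2 t3
      rw [← t1, ← t2, ← sub_eq_zero, ← t3] at e
      rw [← e]
      congr 1; funext z
      simp only [G₀, G₂, Pi.zero_apply, helmEta, Admissible.rcz_eq,
        Admissible.qcz_eq, rc, Admissible.qc_eq]
      push_cast; ring) s0 d0 d1 (A0 _) (by simp) (by simp) (A2 _) (A2 _) (A2 _)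
  simp only [Pi.zero_apply, zero_mul, add_zero] at E1
  -- Integrations by parts which remove the weak derivatives.
  let Ψ : ℝ →ᵇ ℂ := (1 + a * η ^ 2 : ℂ) • p 0 - (a : ℂ) • p 2 + (c : ℂ) • (solMul a b c * p 0)
  let Ψ' : ℝ →ᵇ ℂ := (1 + a * η ^ 2 : ℂ) • p 1 - (a : ℂ) • p 3 +
    (c : ℂ) • (solMulDeriv a b c * p 0 + solMul a b c * p 1)
  let Φ : ℝ →ᵇ ℂ := (c * lam : ℂ) • ((1 + b * η ^ 2 : ℂ) • p 0 - (b : ℂ) • p 2) +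
    (c ^ 2 : ℂ) • ((1 + b * η ^ 2 : ℂ) • p 1 - (b : ℂ) • p 3) -
    ((1 + a * η ^ 2 : ℂ) • p 1 - (a : ℂ) • p 3) - (3 * c : ℂ) • (solMul a b c * p 1)
  let Φ' : ℝ →ᵇ ℂ := (c * lam : ℂ) • ((1 + b * η ^ 2 : ℂ) • p 1 - (b : ℂ) • p 3) +
    (c ^ 2 : ℂ) • ((1 + b * η ^ 2 : ℂ) • p 2 - (b : ℂ) • p 4) -
    ((1 + a * η ^ 2 : ℂ) • p 2 - (a : ℂ) • p 4) -
    (3 * c : ℂ) • (solMulDeriv a b c * p 1 + solMul a b c * p 2)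
  let Θ : ℝ →ᵇ ℂ := (c : ℂ) • ((1 + b * η ^ 2 : ℂ) • p 0 - (b : ℂ) • p 2) -
    (2 : ℂ) • (solMul a b c * p 0)
  let Θ' : ℝ →ᵇ ℂ := (c : ℂ) • ((1 + b * η ^ 2 : ℂ) • p 1 - (b : ℂ) • p 3) -
    (2 : ℂ) • (solMulDeriv a b c * p 0 + solMul a b c * p 1)
  have eΨ : ev (-α) δ Ψ = fun z => (1 + a * η ^ 2 : ℂ) * ev (-α) δ (p 0) z -
      a * ev (-α) δ (p 2) z + c * (sol a b c 0 z * ev (-α) δ (p 0) z) := by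
    funext z; simp only [Ψ, ev_add, ev_sub, ev_smul, ev_mul, solMul_apply]
  have eΦ : ev (-α) δ Φ = fun z => c * lam * ((1 + b * η ^ 2) * ev (-α) δ (p 0) z -
      b * ev (-α) δ (p 2) z) + c ^ 2 * ((1 + b * η ^ 2) * ev (-α) δ (p 1) z -
      b * ev (-α) δ (p 3) z) - ((1 + a * η ^ 2) * ev (-α) δ (p 1) z - a * ev (-α) δ (p 3) z) -
      3 * c * (sol a b c 0 z * ev (-α) δ (p 1) z) := by
    funext z; simp only [Φ, ev_add, ev_sub, ev_smul, ev_mul, solMul_apply]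
  have eΘ : ev (-α) δ Θ = fun z => c * ((1 + b * η ^ 2) * ev (-α) δ (p 0) z -
      b * ev (-α) δ (p 2) z) - 2 * (sol a b c 0 z * ev (-α) δ (p 0) z) := by
    funext z; simp only [Θ, ev_sub, ev_smul, ev_mul, solMul_apply]
  have E2 := (k1.of_two k2).integral_add_eq_zero hδ (F := Ψ) (F' := Ψ') (fun z => by
    rw [eΨ]
    simp only [Ψ', ev_add, ev_sub, ev_smul, ev_mul, solMul_apply, solMulDeriv_apply]
    exact (((d0 z).const_mul _).sub ((d2 z).const_mul _)).add (((dq z).mul (d0 z)).const_mul _))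
    (by rw [eΨ]; fun_prop)
  have E3 := k1.integral_add_eq_zero hδ (F := Φ) (F' := Φ') (fun z => by
    rw [eΦ]
    simp only [Φ', ev_add, ev_sub, ev_smul, ev_mul, solMul_apply, solMulDeriv_apply]
    exact ((((((d0 z).const_mul _).sub ((d2 z).const_mul _)).const_mul _).add
      ((((d1 z).const_mul _).sub ((d3 z).const_mul _)).const_mul _)).sub
      (((d1 z).const_mul _).sub ((d3 z).const_mul _))).sub (((dq z).mul (d1 z)).const_mul _))
    (by rw [eΦ]; fun_prop)
  have E4 := k3.integral_add_eq_zero hδ (F := Θ) (F' := Θ') (fun z => by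
    rw [eΘ]
    simp only [Θ', ev_add, ev_sub, ev_smul, ev_mul, solMul_apply, solMulDeriv_apply]
    exact ((((d0 z).const_mul _).sub ((d2 z).const_mul _)).const_mul _).sub
      (((dq z).mul (d0 z)).const_mul _))
    (by rw [eΘ]; fun_prop)
  set V₁ := adjFst a b c η lam p with hV₁
  set V₂ := adjSnd b η p with hV₂
  have P1 : pairing ((c : ℂ) • du + f.2, g + (c : ℂ) • dw) v =
      (∫ z, (c * du z + f.2 z) * ev (-α) δ V₁ z) + ∫ z, (g z + c * dw z) * ev (-α) δ V₂ z := by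
    rw [pairing]
    congr 1
    · refine integral_congr_ae ?_
      filter_upwards [hv1, (volume_ac α).ae_le (Lp.coeFn_add ((c : ℂ) • du) f.2),
        (volume_ac α).ae_le (Lp.coeFn_smul (c : ℂ) du)] with z h1 h2 h3
      rw [h1, h2, Pi.add_apply, h3, Pi.smul_apply, smul_eq_mul]
    · refine integral_congr_ae ?_
      filter_upwards [hv2, (volume_ac α).ae_le (Lp.coeFn_add g ((c : ℂ) • dw)),
        (volume_ac α).ae_le (Lp.coeFn_smul (c : ℂ) dw)] with z h1 h2 h3
      rw [h1, h2, Pi.add_apply, h3, Pi.smul_apply, smul_eq_mul]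
  have P2 : pairing f (conj lam • v) =
      (∫ z, lam * f.1 z * ev (-α) δ V₁ z) + ∫ z, lam * f.2 z * ev (-α) δ V₂ z := by
    rw [pairing]
    congr 1
    · refine integral_congr_ae ?_
      filter_upwards [hv1, (volume_ac (-α)).ae_le (Lp.coeFn_smul (conj lam) v.1)] with z h1 h2
      rw [Prod.smul_fst, h2, Pi.smul_apply, smul_eq_mul, map_mul, Complex.conj_conj, h1]; ring
    · refine integral_congr_ae ?_
      filter_upwards [hv2, (volume_ac (-α)).ae_le (Lp.coeFn_smul (conj lam) v.2)] with z h1 h2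
      rw [Prod.smul_snd, h2, Pi.smul_apply, smul_eq_mul, map_mul, Complex.conj_conj, h1]; ring
  have J1 : Integrable fun z => (c * du z + f.2 z) * ev (-α) δ V₁ z :=
    (((A du).const_mul (c : ℂ)).add (A f.2)) V₁
  have J2 : Integrable fun z => (g z + c * dw z) * ev (-α) δ V₂ z :=
    ((A g).add ((A dw).const_mul (c : ℂ))) V₂
  have J3 : Integrable fun z => lam * f.1 z * ev (-α) δ V₁ z := ((A f.1).const_mul lam) V₁
  have J4 : Integrable fun z => lam * f.2 z * ev (-α) δ V₂ z := ((A f.2).const_mul lam) V₂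
  have L1 := (A0 (p 0)).add (A2 (p 2))
  have L2 := (A ddu Ψ).add (A du Ψ')
  have L3 := (A du Φ).add (A f.1 Φ')
  have L4 := (A dw Θ).add (A f.2 Θ')
  have hsum : ∫ z, ((G₀ z * ev (-α) δ (p 0) z + G₂ z * ev (-α) δ (p 2) z) +
      (ddu z * ev (-α) δ Ψ z + du z * ev (-α) δ Ψ' z) +
      (du z * ev (-α) δ Φ z + f.1 z * ev (-α) δ Φ' z) +
      (dw z * ev (-α) δ Θ z + f.2 z * ev (-α) δ Θ' z)) = 0 := by
    have t1 := integral_add ((L1.add L2).add L3) L4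
    have t2 := integral_add (L1.add L2) L3
    have t3 := integral_add L1 L2
    simp only [Pi.add_apply] at t1 t2 t3
    rw [t1, t2, t3, E1, E2, E3, E4]
    ring
  have t := integral_sub (J1.add J2) (J3.add J4)
  simp only [Pi.add_apply] at t
  rw [P1, P2, ← integral_add J1 J2, ← integral_add J3 J4, ← sub_eq_zero, ← t, ← hsum]
  congr 1; funext z
  have hz := hp z
  simp only [pencil, disp, sol_neg, sol_one_neg] at hz
  push_cast at hz
  simp only [hV₁, hV₂, adjFst, adjSnd, eΨ, eΦ, eΘ, Ψ', Φ', Θ', G₀, G₂, ev_add, ev_sub,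
    ev_smul, ev_mul, solMul_apply, solMulDeriv_apply]
  linear_combination -f.1 z * hz

end adjoint

/-! ### Eigenfunctions as elements of the weighted Sobolev spaces -/

section lift

variable {α δ : ℝ} {k : ℕ} {I : Set ℝ}

theorem Reg.exists_lift_pair (hδ : 0 < δ) {U V : ℝ → ℝ →ᵇ ℂ} (hU : Reg α δ I k U)
    (hV : Reg α δ I (k - 1) V) : ∃ Z : ℝ → XSpace α k, ContDiffOn ℝ ∞ Z I ∧
      ∀ η ∈ I, (Z η).toL2 = (toWL2 α hδ (U η), toWL2 α hδ (V η)) := by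
  obtain ⟨Z₁, h1, e1⟩ := hU.exists_lift hδ
  obtain ⟨Z₂, h2, e2⟩ := hV.exists_lift hδ
  exact ⟨fun η => (Z₁ η, Z₂ η), h1.prodMk h2, fun η hη => Prod.ext (e1 η hη) (e2 η hη)⟩

theorem exists_lift_const (hδ : 0 < δ) {U V : ℝ →ᵇ ℂ} (hU : Reg α δ univ k fun _ => U)
    (hV : Reg α δ univ (k - 1) fun _ => V) :
    ∃ Z : XSpace α k, Z.toL2 = (toWL2 α hδ U, toWL2 α hδ V) := by
  obtain ⟨Z, -, hZ⟩ := hU.exists_lift_pair hδ hV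
  exact ⟨Z 0, hZ 0 (mem_univ _)⟩

theorem XSpace.toL2_combination (r s : ℂ) (Z₁ Z₂ Z₃ : XSpace α k) :
    (Z₁ + r • Z₂ + s • Z₃).toL2 = Z₁.toL2 + r • Z₂.toL2 + s • Z₃.toL2 := rfl

theorem represents_toWL2 (hδ : 0 < δ) {U V : ℝ →ᵇ ℂ} {f : ℝ → ℝ × ℝ}
    (h1 : ∀ z, ev α δ U z = (f z).1) (h2 : ∀ z, ev α δ V z = (f z).2) :
    Represents (toWL2 α hδ U, toWL2 α hδ V) f := by
  filter_upwards [coeFn_toWL2 α hδ U, coeFn_toWL2 α hδ V] with z hz hz'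
  exact ⟨hz.trans (h1 z), hz'.trans (h2 z)⟩

theorem conj_toWL2 (hδ : 0 < δ) (U : ℝ →ᵇ ℂ) :
    ∀ᵐ z : ℝ, conj (toWL2 α hδ U z) = ev α δ (star U) z := by
  filter_upwards [coeFn_toWL2 α hδ U] with z hz
  rw [hz, ev_star]

theorem isConjOf_toWL2 (hδ : 0 < δ) {U V U' V' : ℝ →ᵇ ℂ} (hU : star U = U') (hV : star V = V') :
    IsConjOf (toWL2 α hδ U, toWL2 α hδ V) (toWL2 α hδ U', toWL2 α hδ V') := by
  subst hU hV
  filter_upwards [conj_toWL2 hδ U, conj_toWL2 hδ V, coeFn_toWL2 α hδ (star U),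
    coeFn_toWL2 α hδ (star V)] with z h1 h2 h3 h4
  exact ⟨h1.trans h3.symm, h2.trans h4.symm⟩

theorem eq_zero_of_toWL2_eq_zero (hδ : 0 < δ) {U : ℝ →ᵇ ℂ} (h : toWL2 α hδ U = 0) (z : ℝ) :
    ev α δ U z = 0 := by
  have h1 : ev α δ U =ᵐ[volume] fun _ => (0 : ℂ) := by
    have h2 := coeFn_toWL2 α hδ U
    rw [h] at h2
    exact h2.symm.trans ((volume_ac α).ae_le (Lp.coeFn_zero ℂ 2 (wMeasure α)))
  exact congrFun ((continuous_ev U).ae_eq_iff_eq volume continuous_const |>.1 h1) z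

theorem memGraph_neg (a b c α η : ℝ) : MemGraph a b c α (-η) = MemGraph a b c α η := by
  funext u w
  simp only [MemGraph, helmEta, Complex.ofReal_neg, neg_sq]

theorem memAdjointGraph_neg (a b c α η : ℝ) :
    MemAdjointGraph a b c α (-η) = MemAdjointGraph a b c α η := by
  funext u w
  simp only [MemAdjointGraph, memGraph_neg]

/-- First-order expansion of a family `Z₁ + λ(η) Z₂ - η² E(η)`. -/
theorem exists_expansion_bound {X : Type*} [NormedAddCommGroup X] [NormedSpace ℂ X] {η₀ C : ℝ}
    {lam : ℝ → ℂ} {r : ℂ} {E : ℝ → X} (Z₁ Z₂ : X) (hE : ContinuousOn E (Icc (-η₀) η₀))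
    (hl : ∀ η ∈ Icc (-η₀) η₀, ‖lam η - r * η‖ ≤ C * |η| ^ 2) :
    ∃ C' : ℝ, ∀ η ∈ Icc (-η₀) η₀,
      ‖Z₁ + lam η • Z₂ + (-(η : ℂ) ^ 2) • E η - (Z₁ + (r * η) • Z₂)‖ ≤ C' * |η| ^ 2 := by
  obtain ⟨D, hD⟩ := isCompact_Icc.exists_bound_of_continuousOn hE
  refine ⟨C * ‖Z₂‖ + D, fun η hη => ?_⟩
  have e : Z₁ + lam η • Z₂ + (-(η : ℂ) ^ 2) • E η - (Z₁ + (r * η) • Z₂) =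
      (lam η - r * η) • Z₂ + (-(η : ℂ) ^ 2) • E η := by module
  rw [e]
  refine (norm_add_le _ _).trans ?_
  rw [norm_smul, norm_smul, norm_neg, norm_pow, Complex.norm_real, Real.norm_eq_abs]
  have h1 := mul_le_mul_of_nonneg_right (hl η hη) (norm_nonneg Z₂)
  have h2 := mul_le_mul_of_nonneg_left (hD η hη) (sq_nonneg |η|)
  linarith

theorem exists_ne_zero_near {X : Type*} [NormedAddCommGroup X] {η₀ : ℝ} (h0 : 0 < η₀) {ζ : ℝ → X}
    (hζ : ContinuousOn ζ (Icc (-η₀) η₀)) (hz : ζ 0 ≠ 0) :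
    ∃ ε > 0, ∀ η, |η| ≤ ε → ζ η ≠ 0 := by
  have h1 : ContinuousAt ζ 0 := hζ.continuousAt (Icc_mem_nhds (by linarith) h0)
  obtain ⟨ε, hε, h2⟩ := Metric.eventually_nhds_iff.1 (h1.eventually_ne hz)
  refine ⟨ε / 2, half_pos hε, fun η hη => h2 ?_⟩
  rw [Real.dist_eq, sub_zero]
  linarith

end lift

/-! ### The reflected primitive -/

open Polynomial

section reflection

variable (a b c : ℝ)

theorem prim_one_neg (z : ℝ) : prim a b c 1 (-z) = prim a b c 1 z := by
  simp only [prim, uJ, primJet_one, profile_sechProfile, eval_mul, eval_C, eval_X, eval_neg,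
    eval_ofNat, mul_neg, Real.tanh_neg]
  ring

theorem prim_three_neg (z : ℝ) : prim a b c 3 (-z) = prim a b c 3 z := by
  simp only [prim, uJ, primJet_three, profile_sechProfile, eval_mul, eval_C, eval_X, eval_sub,
    eval_pow, eval_ofNat, mul_neg, Real.tanh_neg]
  ring

theorem sol_two_neg (z : ℝ) : sol a b c 2 (-z) = sol a b c 2 z := by
  simp only [sol, qJ, sechJet_two, profile_sechProfile, eval_mul, eval_C, eval_X, eval_sub, eval_pow,
    eval_ofNat, eval_zero, mul_neg, Real.tanh_neg]
  ring

theorem helm_eq {d : ℝ} {f f' f'' : ℝ → ℝ} (h1 : ∀ z, HasDerivAt f (f' z) z)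
    (h2 : ∀ z, HasDerivAt f' (f'' z) z) (z : ℝ) : helm d f z = f z - d * f'' z := by
  rw [helm, funext fun z => (h1 z).deriv, (h2 z).deriv]

end reflection

/-! ### The families of eigenfunctions -/

section families

variable {a b c α δ : ℝ} {k : ℕ} {I : Set ℝ}

/-- The derivatives of `q + λu - η²w(η)`, the first component of the eigenfunction. -/
def eigJet (hw : WeightCond (theta a b c) α δ) (lam : ℝ → ℂ) (w : ℕ → ℝ → ℝ →ᵇ ℂ) (j : ℕ)
    (η : ℝ) : ℝ →ᵇ ℂ :=
  qE hw j + lam η • uE hw j + (-(η : ℂ) ^ 2) • w j η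

/-- The derivatives of `c F(-z)`, where `F j` is the `j`-th derivative of `F`. -/
def dualJet (c : ℝ) (F : ℕ → ℝ →ᵇ ℂ) (j : ℕ) : ℝ →ᵇ ℂ := ((-1) ^ j * c : ℂ) • reflect (F j)

theorem ev_dualJet (F : ℕ → ℝ →ᵇ ℂ) (j : ℕ) (z : ℝ) :
    ev (-α) δ (dualJet c F j) z = (-1) ^ j * c * ev α δ (F j) (-z) := by
  rw [dualJet, ev_smul, ev_reflect]

/-- A member of a smooth family, regarded as a constant family. -/
theorem Reg.freeze {m : ℕ} {U : ℝ → ℝ →ᵇ ℂ} (hU : Reg α δ I m U) {η : ℝ} (hη : η ∈ I) {J : Set ℝ} :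
    Reg α δ J m fun _ => U η := by
  induction m generalizing U with
  | zero => exact contDiffOn_const
  | succ m ih =>
    obtain ⟨V, hV, hr⟩ := hU.2
    exact Reg.succ contDiffOn_const (fun _ _ => hV η hη) (ih hr)

theorem star_dualJet (F : ℕ → ℝ →ᵇ ℂ) (j : ℕ) :
    star (dualJet c F j) = dualJet c (fun j => star (F j)) j := by
  simp only [dualJet, star_smul, reflect_star, Complex.star_def, map_mul, map_pow, map_neg, map_one,
    Complex.conj_ofReal]

theorem dualJet_combination (r s : ℂ) (F G H : ℕ → ℝ →ᵇ ℂ) (j : ℕ) :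
    dualJet c (fun j => F j + r • G j + s • H j) j =
      dualJet c F j + r • dualJet c G j + s • dualJet c H j := by
  refine ev_injective (α := -0) (δ := 0) fun z => ?_
  simp only [ev_dualJet, ev_add, ev_smul]; ring

theorem hasDerivAt_dualJet {F : ℕ → ℝ →ᵇ ℂ} {j : ℕ}
    (hF : ∀ z, HasDerivAt (ev α δ (F j)) (ev α δ (F (j + 1)) z) z) (z : ℝ) :
    HasDerivAt (ev (-α) δ (dualJet c F j)) (ev (-α) δ (dualJet c F (j + 1)) z) z := by
  rw [funext (ev_dualJet F j), ev_dualJet]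
  refine (((hF (-z)).scomp z (hasDerivAt_neg z)).const_mul ((-1) ^ j * c : ℂ)).congr_deriv ?_
  rw [neg_one_smul, pow_succ]; ring

theorem Reg.map_dualJet {m j : ℕ} {F : ℕ → ℝ → ℝ →ᵇ ℂ} (hF : Reg α δ I m (F j)) :
    Reg (-α) δ I m fun η => dualJet c (fun j => F j η) j :=
  hF.reflect.const_smul _

/-- The operator `c(1 - b∂²)∂ - 2q_c∂ - q_c'` acting on the sequence `p` of derivatives of a
function. -/
def driftOp (a b c : ℝ) (p : ℕ → ℝ →ᵇ ℂ) : ℝ →ᵇ ℂ :=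
  (c : ℂ) • (p 1 - (b : ℂ) • p 3) - ((2 : ℂ) • (solMul a b c * p 1) + solMulDeriv a b c * p 0)

theorem Reg.map_driftOp {m : ℕ} {p : ℕ → ℝ → ℝ →ᵇ ℂ} (hp : ∀ j < 4, Reg α δ I m (p j)) :
    Reg α δ I m fun η => driftOp a b c fun j => p j η :=
  (((hp 1 (by norm_num)).sub ((hp 3 (by norm_num)).const_smul _)).const_smul _).sub
    (((hp 1 (by norm_num)).map_solMul.const_smul _).add (hp 0 (by norm_num)).map_solMulDeriv)

theorem adjFst_combination {η : ℝ} {lam μ : ℂ} (hl : lam ^ 2 = -(η : ℂ) ^ 2 * μ ^ 2)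
    (Q U W : ℕ → ℝ →ᵇ ℂ) :
    adjFst a b c η lam (fun j => Q j + lam • U j + (-(η : ℂ) ^ 2) • W j) =
      driftOp a b c Q + lam • (opP2 b Q + driftOp a b c U) +
        (-(η : ℂ) ^ 2) • (μ ^ 2 • opP2 b U + lam • opP2 b W + driftOp a b c W -
          (b * lam) • (Q 0 + lam • U 0 + (-(η : ℂ) ^ 2) • W 0) -
          (b * c : ℂ) • (Q 1 + lam • U 1 + (-(η : ℂ) ^ 2) • W 1)) := by
  refine ev_injective (α := 0) (δ := 0) fun z => ?_
  simp only [adjFst, driftOp, opP2, ev_add, ev_sub, ev_smul, ev_mul]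
  linear_combination (ev 0 0 (U 0) z - b * ev 0 0 (U 2) z) * hl

theorem adjSnd_combination {η : ℝ} (r : ℂ) (Q U W : ℕ → ℝ →ᵇ ℂ) :
    adjSnd b η (fun j => Q j + r • U j + (-(η : ℂ) ^ 2) • W j) =
      opP2 b Q + r • opP2 b U + (-(η : ℂ) ^ 2) • (opP2 b W -
          (b : ℂ) • (Q 0 + r • U 0 + (-(η : ℂ) ^ 2) • W 0)) := by
  refine ev_injective (α := 0) (δ := 0) fun z => ?_
  simp only [adjSnd, opP2, ev_add, ev_sub, ev_smul]
  ring

theorem star_adjFst (η : ℝ) (lam : ℂ) (p : ℕ → ℝ →ᵇ ℂ) :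
    star (adjFst a b c η lam p) = adjFst a b c (-η) (conj lam) fun j => star (p j) := by
  simp only [adjFst, star_add, star_sub, star_smul, star_mul', star_solMul, star_solMulDeriv,
    Complex.star_def, map_pow, map_one, Complex.conj_ofReal, map_ofNat,
    Complex.ofReal_neg, neg_sq]

theorem star_adjSnd (η : ℝ) (p : ℕ → ℝ →ᵇ ℂ) :
    star (adjSnd b η p) = adjSnd b (-η) fun j => star (p j) := by
  simp only [adjSnd, star_sub, star_smul, Complex.star_def, map_add, map_mul, map_pow, map_one,
    Complex.conj_ofReal, Complex.ofReal_neg, neg_sq]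

theorem star_eigJet (hw : WeightCond (theta a b c) α δ) {lam : ℝ → ℂ} {w : ℕ → ℝ → ℝ →ᵇ ℂ} {η : ℝ}
    (hl : conj (lam η) = lam (-η)) {j : ℕ} (hs : star (w j η) = w j (-η)) :
    star (eigJet hw lam w j η) = eigJet hw lam w j (-η) := by
  simp only [eigJet, star_add, star_smul, star_qE, star_uE, hs, Complex.star_def, hl, map_neg,
    map_pow, Complex.conj_ofReal, Complex.ofReal_neg, neg_sq]

theorem hasDerivAt_eigJet (hw : WeightCond (theta a b c) α δ) (lam : ℝ → ℂ)
    {w : ℕ → ℝ → ℝ →ᵇ ℂ} {j : ℕ} {η : ℝ}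
    (hd : ∀ z, HasDerivAt (ev α δ (w j η)) (ev α δ (w (j + 1) η) z) z) (z : ℝ) :
    HasDerivAt (ev α δ (eigJet hw lam w j η)) (ev α δ (eigJet hw lam w (j + 1) η) z) z := by
  have e : ∀ i z, ev α δ (eigJet hw lam w i η) z =
      sol a b c i z + lam η * prim a b c i z + -(η : ℂ) ^ 2 * ev α δ (w i η) z := fun i z => by
    simp only [eigJet, ev_add, ev_smul, ev_qE, ev_uE]
  rw [funext (e j), e]
  exact ((Admissible.hasDerivAt_qJ a b c j z).ofReal_comp.add
    ((Admissible.hasDerivAt_uJ a b c j z).ofReal_comp.const_mul _)).add ((hd z).const_mul _)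

theorem pencil_mul (σ lam r : ℂ) (v : ℕ → ℂ) (z : ℝ) :
    pencil a b c σ lam (fun j => r * v j) z = r * pencil a b c σ lam v z := by
  simp only [pencil]; ring

theorem represents_zeta1 (hw : WeightCond (theta a b c) α δ) :
    Represents (toWL2 α hw.pos (qE hw 0), toWL2 α hw.pos (-(c : ℂ) • qE hw 1)) (zeta1 a b c) := by
  refine represents_toWL2 _ (fun z => ?_) fun z => ?_
  · rw [ev_qE, zeta1, Admissible.qc_eq]
  · rw [ev_smul, ev_qE, zeta1, Admissible.rcz_eq, Admissible.qcz_eq]; push_cast; rfl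

theorem represents_zeta2 (h : Admissible a b c) (hw : WeightCond (theta a b c) α δ) :
    Represents (toWL2 α hw.pos (uE hw 0), toWL2 α hw.pos (qE hw 0 - (c : ℂ) • uE hw 1))
      (zeta2 a b c) := by
  refine represents_toWL2 _ (fun z => ?_) fun z => ?_
  · rw [ev_uE, zeta2, h.intRight_eq]
  · rw [ev_sub, ev_smul, ev_qE, ev_uE, zeta2, h.dcrc_eq, Admissible.qc_eq]; push_cast; ring

theorem represents_zeta2Star (h : Admissible a b c) (hw : WeightCond (theta a b c) α δ) :
    Represents (toWL2 (-α) hw.pos (driftOp a b c (dualJet c (qE hw))),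
      toWL2 (-α) hw.pos (opP2 b (dualJet c (qE hw)))) (zeta2Star a b c) := by
  refine represents_toWL2 _ (fun z => ?_) fun z => ?_
  · have e : helm a (qcz a b c) z = sol a b c 1 z - a * sol a b c 3 z := by
      rw [funext (Admissible.qcz_eq a b c)]
      exact helm_eq (Admissible.hasDerivAt_qJ a b c 1) (Admissible.hasDerivAt_qJ a b c 2) z
    have h1 : ((_ : ℝ) : ℂ) = ((_ : ℝ) : ℂ) := congrArg Complex.ofReal (h.soliton_eq z)
    simp only [driftOp, ev_add, ev_sub, ev_smul, ev_mul, solMul_apply, solMulDeriv_apply, ev_dualJet,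
      ev_qE, sol_one_neg, sol_three_neg, sol_neg, zeta2Star, e]
    rw [disp] at h1
    push_cast at h1 ⊢
    linear_combination h1
  · have e : helm b (rc a b c) z = -c * sol a b c 0 z - b * (-c * sol a b c 2 z) := by
      rw [show rc a b c = fun z => -c * sol a b c 0 z from
        funext fun z => by rw [rc, Admissible.qc_eq]]
      exact helm_eq (fun z => (Admissible.hasDerivAt_qJ a b c 0 z).const_mul _)
        (fun z => (Admissible.hasDerivAt_qJ a b c 1 z).const_mul _) z
    simp only [opP2, ev_sub, ev_smul, ev_dualJet, ev_qE, sol_two_neg, sol_neg, zeta2Star, e]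
    push_cast; ring

theorem represents_zeta1Star (h : Admissible a b c) (hw : WeightCond (theta a b c) α δ) :
    Represents (toWL2 (-α) hw.pos (opP2 b (dualJet c (qE hw)) + driftOp a b c (dualJet c (uE hw))),
      toWL2 (-α) hw.pos (opP2 b (dualJet c (uE hw)))) (zeta1Star a b c) := by
  refine represents_toWL2 _ (fun z => ?_) fun z => ?_
  · have e : helm b (dcrc a b c) z =
        (c * prim a b c 1 z - sol a b c 0 z) - b * (c * prim a b c 3 z - sol a b c 2 z) := by
      rw [show dcrc a b c = fun z => c * prim a b c 1 z - sol a b c 0 z from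
        funext fun z => by rw [h.dcrc_eq, Admissible.qc_eq]]
      exact helm_eq
        (fun z => ((Admissible.hasDerivAt_uJ a b c 1 z).const_mul c).sub
          (Admissible.hasDerivAt_qJ a b c 0 z))
        (fun z => ((Admissible.hasDerivAt_uJ a b c 2 z).const_mul c).sub
          (Admissible.hasDerivAt_qJ a b c 1 z)) z
    simp only [driftOp, opP2, ev_add, ev_sub, ev_smul, ev_mul, solMul_apply, solMulDeriv_apply,
      ev_dualJet, ev_qE, ev_uE, sol_two_neg, sol_neg, prim_one_neg, prim_three_neg, zeta1Star, e,
      h.dcqc_eq, h.intLeft_eq, Admissible.qc_eq, Admissible.qcz_eq]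
    push_cast; ring
  · have hd : ∀ j z, HasDerivAt (fun z => (-1 : ℝ) ^ j * prim a b c j (-z))
        ((-1) ^ (j + 1) * prim a b c (j + 1) (-z)) z := fun j z => by
      refine (((Admissible.hasDerivAt_uJ a b c j (-z)).scomp z (hasDerivAt_neg z)).const_mul
        ((-1 : ℝ) ^ j)).congr_deriv ?_
      rw [neg_one_smul, pow_succ]; ring
    have e : helm b (intLeft a b c) z = (-1) ^ 0 * prim a b c 0 (-z) -
        b * ((-1) ^ 2 * prim a b c 2 (-z)) := by
      rw [show intLeft a b c = fun z => (-1) ^ 0 * prim a b c 0 (-z) from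
        funext fun z => by rw [h.intLeft_eq, pow_zero, one_mul]]
      exact helm_eq (hd 0) (hd 1) z
    simp only [opP2, ev_sub, ev_smul, ev_dualJet, ev_uE, zeta1Star, e]
    push_cast; ring

theorem ev_opP2_dualJet_zero (hw : WeightCond (theta a b c) α δ) :
    ev (-α) δ (opP2 b (dualJet c (qE hw))) 0 =
      ((c * ((c ^ 2 - 1) / c) * (1 + 2 * b * theta a b c ^ 2) : ℝ) : ℂ) := by
  have e2 : sol a b c 2 0 = -2 * ((c ^ 2 - 1) / c * theta a b c ^ 2) := by
    simp [sol, qJ, sechJet_two, profile_sechProfile]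
    ring
  have e0 : sol a b c 0 0 = (c ^ 2 - 1) / c := by simp [sol_zero_apply]
  simp only [opP2, ev_sub, ev_smul, ev_dualJet, ev_qE, neg_zero, e0, e2]
  push_cast; ring

/-- The eigenfunctions form a smooth family in `H^k_α × H^{k-1}_α`, expanded to second order. -/
theorem exists_direct_family (hw : WeightCond (theta a b c) α δ) (k : ℕ) {lam μ : ℝ → ℂ}
    {w : ℕ → ℝ → ℝ →ᵇ ℂ} (hμ : ContDiffOn ℝ ∞ μ I) (hl : ∀ η, lam η = Complex.I * η * μ η)
    (hls : ContDiffOn ℝ ∞ lam I) (hr : ∀ m, ∀ j ≤ 4, Reg α δ I m (w j)) :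
    ∃ (Z₁ Z₂ : XSpace α k) (E : ℝ → XSpace α k), ContDiffOn ℝ ∞ E I ∧
      Z₁.toL2 = (toWL2 α hw.pos (qE hw 0), toWL2 α hw.pos (-(c : ℂ) • qE hw 1)) ∧
      Z₂.toL2 = (toWL2 α hw.pos (uE hw 0), toWL2 α hw.pos (qE hw 0 - (c : ℂ) • uE hw 1)) ∧
      ∀ η ∈ I, (Z₁ + lam η • Z₂ + (-(η : ℂ) ^ 2) • E η).toL2 =
        (toWL2 α hw.pos (eigJet hw lam w 0 η),
          toWL2 α hw.pos (lam η • eigJet hw lam w 0 η - (c : ℂ) • eigJet hw lam w 1 η)) := by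
  have rq : ∀ J m j, Reg α δ J m fun _ => qE hw j := fun J m j => hw.reg_elem J m _
  have ru : ∀ J m j, Reg α δ J m fun _ => uE hw j := fun J m j => hw.reg_elem J m _
  obtain ⟨Z₁, e1⟩ := exists_lift_const (k := k) hw.pos (rq _ _ 0) ((rq _ _ 1).const_smul (-(c : ℂ)))
  obtain ⟨Z₂, e2⟩ := exists_lift_const (k := k) hw.pos (ru _ _ 0)
    ((rq _ _ 0).sub ((ru _ _ 1).const_smul (c : ℂ)))
  obtain ⟨E, hE, e3⟩ := (hr k 0 (by norm_num)).exists_lift_pair hw.pos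
    (((Reg.smul (hμ.pow 2) (ru _ _ 0)).add (Reg.smul hls (hr _ 0 (by norm_num)))).sub
      ((hr (k - 1) 1 (by norm_num)).const_smul (c : ℂ)))
  refine ⟨Z₁, Z₂, E, hE, e1, e2, fun η hη => ?_⟩
  have hl2 : lam η ^ 2 = -(η : ℂ) ^ 2 * μ η ^ 2 := by
    rw [hl, mul_pow, mul_pow, Complex.I_sq]; ring
  rw [XSpace.toL2_combination, e1, e2, e3 η hη]
  simp only [Prod.smul_mk, Prod.mk_add_mk, ← map_smul, ← map_add]
  have e : -(c : ℂ) • qE hw 1 + lam η • (qE hw 0 - (c : ℂ) • uE hw 1) +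
      (-(η : ℂ) ^ 2) • (μ η ^ 2 • uE hw 0 + lam η • w 0 η - (c : ℂ) • w 1 η) =
      lam η • eigJet hw lam w 0 η - (c : ℂ) • eigJet hw lam w 1 η := by
    refine ev_injective (α := α) (δ := δ) fun z => ?_
    simp only [eigJet, ev_add, ev_sub, ev_smul]
    linear_combination -(ev α δ (uE hw 0) z) * hl2
  rw [e]; rfl

/-- The eigenfunctions of the adjoint form a smooth family in `H^k_{-α} × H^{k-1}_{-α}`, expanded to
second order. -/
theorem exists_adjoint_family (hw : WeightCond (theta a b c) α δ) (k : ℕ) {lam μ : ℝ → ℂ}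
    {w : ℕ → ℝ → ℝ →ᵇ ℂ} (hI : ∀ η ∈ I, -η ∈ I) (hμ : ContDiffOn ℝ ∞ μ I)
    (hl : ∀ η, lam η = Complex.I * η * μ η)
    (hls : ContDiffOn ℝ ∞ lam I) (hr : ∀ m, ∀ j ≤ 4, Reg α δ I m (w j)) :
    ∃ (Y₂ Y₁ : XSpace (-α) k) (E : ℝ → XSpace (-α) k), ContDiffOn ℝ ∞ E I ∧
      Y₂.toL2 = (toWL2 (-α) hw.pos (driftOp a b c (dualJet c (qE hw))),
        toWL2 (-α) hw.pos (opP2 b (dualJet c (qE hw)))) ∧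
      Y₁.toL2 =
        (toWL2 (-α) hw.pos (opP2 b (dualJet c (qE hw)) + driftOp a b c (dualJet c (uE hw))),
        toWL2 (-α) hw.pos (opP2 b (dualJet c (uE hw)))) ∧
      ∀ η ∈ I, (Y₂ + lam (-η) • Y₁ + (-(η : ℂ) ^ 2) • E η).toL2 =
        (toWL2 (-α) hw.pos
          (adjFst a b c η (lam (-η)) (dualJet c fun j => eigJet hw lam w j (-η))),
        toWL2 (-α) hw.pos (adjSnd b η (dualJet c fun j => eigJet hw lam w j (-η)))) := by
  have rq : ∀ J m j, Reg (-α) δ J m fun _ => dualJet c (qE hw) j := fun J m j =>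
    Reg.map_dualJet (F := fun j _ => qE hw j) (hw.reg_elem J m _)
  have ru : ∀ J m j, Reg (-α) δ J m fun _ => dualJet c (uE hw) j := fun J m j =>
    Reg.map_dualJet (F := fun j _ => uE hw j) (hw.reg_elem J m _)
  have rw' : ∀ m, ∀ j < 4, Reg (-α) δ I m fun η => dualJet c (fun j => w j (-η)) j := fun m j hj =>
    Reg.map_dualJet (F := fun j η => w j (-η)) ((hr m j hj.le).comp_neg hI)
  have hμ' : ContDiffOn ℝ ∞ (fun η => μ (-η)) I := hμ.comp contDiffOn_id.neg hI
  have hls' : ContDiffOn ℝ ∞ (fun η => lam (-η)) I := hls.comp contDiffOn_id.neg hI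
  have hsq : ContDiffOn ℝ ∞ (fun η : ℝ => -(η : ℂ) ^ 2) I :=
    (Complex.ofRealCLM.contDiff.pow 2).neg.contDiffOn
  have rp : ∀ m, ∀ j < 4, Reg (-α) δ I m fun η => dualJet c (qE hw) j + lam (-η) • dualJet c (uE hw) j +
      (-(η : ℂ) ^ 2) • dualJet c (fun j => w j (-η)) j := fun m j hj =>
    ((rq I m j).add (Reg.smul hls' (ru I m j))).add (Reg.smul hsq (rw' m j hj))
  obtain ⟨Y₂, e2⟩ := exists_lift_const (k := k) hw.pos
    (Reg.map_driftOp (a := a) (b := b) (c := c) fun j _ => rq _ _ j)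
    (Reg.map_opP2 (b := b) fun j _ => rq _ _ j)
  obtain ⟨Y₁, e1⟩ := exists_lift_const (k := k) hw.pos
    ((Reg.map_opP2 (b := b) fun j _ => rq _ _ j).add
      (Reg.map_driftOp (a := a) (b := b) (c := c) fun j _ => ru _ _ j))
    (Reg.map_opP2 (b := b) fun j _ => ru _ _ j)
  obtain ⟨E, hE, e3⟩ := Reg.exists_lift_pair (k := k) hw.pos
    (((((Reg.smul (hμ'.pow 2) (Reg.map_opP2 (b := b) fun j _ => ru _ _ j)).add
      (Reg.smul hls' (Reg.map_opP2 (b := b) (rw' _)))).add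
      (Reg.map_driftOp (a := a) (b := b) (c := c) (rw' _))).sub
      (Reg.smul (contDiffOn_const.mul hls' : ContDiffOn ℝ ∞ (fun η => b * lam (-η)) I)
        (rp _ 0 (by norm_num)))).sub ((rp _ 1 (by norm_num)).const_smul (b * c : ℂ)))
    ((Reg.map_opP2 (b := b) (rw' _)).sub ((rp _ 0 (by norm_num)).const_smul (b : ℂ)))
  refine ⟨Y₂, Y₁, E, hE, e2, e1, fun η hη => ?_⟩
  have hl2 : lam (-η) ^ 2 = -(η : ℂ) ^ 2 * μ (-η) ^ 2 := by
    rw [hl, mul_pow, mul_pow, Complex.I_sq]; push_cast; ring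
  have ep : (dualJet c fun j => eigJet hw lam w j (-η)) = fun j => dualJet c (qE hw) j +
      lam (-η) • dualJet c (uE hw) j + (-(η : ℂ) ^ 2) • dualJet c (fun j => w j (-η)) j := by
    funext j
    rw [← dualJet_combination]
    simp only [eigJet, Complex.ofReal_neg, neg_sq]
  rw [XSpace.toL2_combination, e1, e2, e3 η hη, ep, adjFst_combination hl2, adjSnd_combination]
  simp only [Prod.smul_mk, Prod.mk_add_mk, ← map_smul, ← map_add]

/-- The adjoint eigenvalue problem for the reflected eigenfunction. -/
theorem memAdjointGraph_of_eigJet (hw : WeightCond (theta a b c) α δ) {lam : ℝ → ℂ}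
    {w : ℕ → ℝ → ℝ →ᵇ ℂ} (hI : ∀ η ∈ I, -η ∈ I) (hr : ∀ m, ∀ j ≤ 4, Reg α δ I m (w j))
    (hd : ∀ η ∈ I, ∀ j < 4, ∀ z, HasDerivAt (ev α δ (w j η)) (ev α δ (w (j + 1) η) z) z)
    (hp : ∀ η ∈ I, ∀ z, pencil a b c (-(η : ℂ) ^ 2) (lam η)
      (fun j => ev α δ (eigJet hw lam w j η) z) z = 0)
    (hc : ∀ η ∈ I, conj (lam η) = lam (-η) ∧ ∀ j, star (w j η) = w j (-η)) {η : ℝ} (hη : η ∈ I)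
    {v : WL2 (-α) × WL2 (-α)}
    (hv : v = (toWL2 (-α) hw.pos
        (adjFst a b c η (lam (-η)) (dualJet c fun j => eigJet hw lam w j (-η))),
      toWL2 (-α) hw.pos (adjSnd b η (dualJet c fun j => eigJet hw lam w j (-η))))) :
    MemAdjointGraph a b c α η v (lam (-η) • v) := by
  have hη' := hI η hη
  have es : ∀ j, star (dualJet c (fun j => eigJet hw lam w j (-η)) j) =
      dualJet c (fun j => eigJet hw lam w j η) j := fun j => by
    rw [star_dualJet]
    congr 1; funext i
    rw [star_eigJet hw (hc _ hη').1 ((hc _ hη').2 i), neg_neg]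
  rw [← (hc η hη).1]
  refine memAdjointGraph_of_pencil hw.pos (p := dualJet c fun j => eigJet hw lam w j η)
    (fun j hj => hasDerivAt_dualJet (hasDerivAt_eigJet hw lam (hd η hη j hj)))
    (fun j hj => contDiff_infty.2 fun m => ?_) (fun z => ?_) ?_ ?_
  · have h1 : Reg α δ {η} m fun _ => eigJet hw lam w j η :=
      ((hw.reg_elem _ m _).add ((hw.reg_elem _ m _).const_smul _)).add
        (((hr m j hj).freeze hη).const_smul _)
    exact (Reg.map_dualJet (c := c) (F := fun j _ => eigJet hw lam w j η) h1).contDiff_ev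
      (mem_singleton η)
  · have e : ∀ j, (-1) ^ j * ev (-α) δ (dualJet c (fun j => eigJet hw lam w j η) j) z =
        c * ev α δ (eigJet hw lam w j η) (-z) := fun j => by
      rw [ev_dualJet]
      have : ((-1) ^ j * (-1) ^ j : ℂ) = 1 := by rw [← mul_pow]; norm_num
      linear_combination c * ev α δ (eigJet hw lam w j η) (-z) * this
    rw [funext e, pencil_mul, hp η hη, mul_zero]
  · subst hv
    filter_upwards [conj_toWL2 hw.pos
      (adjFst a b c η (lam (-η)) (dualJet c fun j => eigJet hw lam w j (-η)))] with z hz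
    rw [hz, star_adjFst, funext es, (hc _ hη').1, neg_neg]
    simp only [adjFst, Complex.ofReal_neg, neg_sq]
  · subst hv
    filter_upwards [conj_toWL2 hw.pos
      (adjSnd b η (dualJet c fun j => eigJet hw lam w j (-η)))] with z hz
    rw [hz, star_adjSnd, funext es]
    simp only [adjSnd, Complex.ofReal_neg, neg_sq]

end families

end BenneyLuke

end


open BenneyLuke in
theorem theorem1 (a b c α : ℝ) (k : ℕ) (ha : 0 < a) (hab : a < b) (hk : 1 ≤ k) (hc : 1 < c)
    (hα : 0 < α) (hαc : α < alphaC a b c) :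
    ∃ η₀ : ℝ, 0 < η₀ ∧
    ∃ (lam : ℝ → ℂ) (ζ : ℝ → XSpace α k) (ζs : ℝ → XSpace (-α) k) (lam₁ lam₂ : ℝ),
      0 < lam₁ ∧ 0 < lam₂ ∧
      ContDiffOn ℝ ∞ lam (Icc (-η₀) η₀) ∧
      ContDiffOn ℝ ∞ ζ (Icc (-η₀) η₀) ∧
      ContDiffOn ℝ ∞ ζs (Icc (-η₀) η₀) ∧
      -- eigenvalue problems for the operator and its adjoint, with non-zero eigenfunctions
      (∀ η ∈ Icc (-η₀) η₀, ζ η ≠ 0 ∧ ζs η ≠ 0 ∧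
        MemGraph a b c α η (ζ η).toL2 (lam η • (ζ η).toL2) ∧
        MemGraph a b c α η (ζ (-η)).toL2 (lam (-η) • (ζ (-η)).toL2) ∧
        MemAdjointGraph a b c α η (ζs η).toL2 (lam (-η) • (ζs η).toL2) ∧
        MemAdjointGraph a b c α η (ζs (-η)).toL2 (lam η • (ζs (-η)).toL2)) ∧
      -- expansion of the eigenvalue
      (∃ C : ℝ, ∀ η ∈ Icc (-η₀) η₀,
        ‖lam η - (Complex.I * lam₁ * η - lam₂ * η ^ 2)‖ ≤ C * |η| ^ 3) ∧
      -- expansion of the eigenfunction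
      (∃ Z₁ Z₂ : XSpace α k, Represents Z₁.toL2 (zeta1 a b c) ∧ Represents Z₂.toL2 (zeta2 a b c) ∧
        ∃ C : ℝ, ∀ η ∈ Icc (-η₀) η₀,
          ‖ζ η - (Z₁ + (Complex.I * lam₁ * η) • Z₂)‖ ≤ C * |η| ^ 2) ∧
      -- expansion of the adjoint eigenfunction
      (∃ Y₁ Y₂ : XSpace (-α) k,
        Represents Y₁.toL2 (zeta1Star a b c) ∧ Represents Y₂.toL2 (zeta2Star a b c) ∧
        ∃ C : ℝ, ∀ η ∈ Icc (-η₀) η₀,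
          ‖ζs η - (Y₂ - (Complex.I * lam₁ * η) • Y₁)‖ ≤ C * |η| ^ 2) ∧
      -- conjugation symmetry
      (∀ η ∈ Icc (-η₀) η₀, conj (lam η) = lam (-η) ∧
        IsConjOf (ζ η).toL2 (ζ (-η)).toL2 ∧ IsConjOf (ζs η).toL2 (ζs (-η)).toL2) := by
  have h : Admissible a b c := ⟨ha, hab, hc⟩
  have hw : WeightCond (theta a b c) α (min α (alphaC a b c - α) / 2) := by
    have h1 := min_le_left α (alphaC a b c - α)
    have h2 := min_le_right α (alphaC a b c - α)
    have h3 : 0 < min α (alphaC a b c - α) := lt_min hα (by linarith)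
    refine ⟨by linarith, by linarith, ?_⟩
    rw [theta]; linarith
  obtain ⟨η₁, hη₁, lam, μ, w, lam₁, lam₂, hl₁, hl₂, hμ, hl, ⟨C, hC⟩, hr, hd, hp, hcj⟩ :=
    exists_branch h hw
  -- From here on `v = q + λu - η²w`, see `eigJet`.
  have hI : ∀ η ∈ Icc (-η₁) η₁, -η ∈ Icc (-η₁) η₁ := fun η hη =>
    ⟨by linarith [hη.2], by linarith [hη.1]⟩
  have hlin : ContDiff ℝ ∞ fun η : ℝ => Complex.I * (η : ℂ) :=
    contDiff_const.mul Complex.ofRealCLM.contDiff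
  have hsq : ContDiffOn ℝ ∞ (fun η : ℝ => -(η : ℂ) ^ 2) (Icc (-η₁) η₁) :=
    (Complex.ofRealCLM.contDiff.pow 2).neg.contDiffOn
  have hls : ContDiffOn ℝ ∞ lam (Icc (-η₁) η₁) := by
    rw [funext hl]; exact hlin.contDiffOn.mul hμ
  have hls' : ContDiffOn ℝ ∞ (fun η => lam (-η)) (Icc (-η₁) η₁) := hls.comp contDiffOn_id.neg hI
  have hlam0 : lam 0 = 0 := by rw [hl]; simp
  have hlam : ∀ η ∈ Icc (-η₁) η₁, ‖lam η - Complex.I * lam₁ * η‖ ≤ (|C| * η₁ + lam₂) * |η| ^ 2 :=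
    fun η hη => by
      have e : lam η - Complex.I * lam₁ * η =
          lam η - (Complex.I * lam₁ * η - lam₂ * η ^ 2) + -((lam₂ : ℂ) * (η : ℂ) ^ 2) := by ring
      have e1 : ‖-((lam₂ : ℂ) * (η : ℂ) ^ 2)‖ = lam₂ * |η| ^ 2 := by
        rw [norm_neg, norm_mul, norm_pow, Complex.norm_real, Complex.norm_real, Real.norm_eq_abs,
          Real.norm_eq_abs, abs_of_pos hl₂]
      have e2 : C * |η| ^ 3 ≤ |C| * η₁ * |η| ^ 2 := by
        have := mul_le_mul (le_abs_self C) (abs_le.2 hη) (abs_nonneg η) (abs_nonneg C)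
        nlinarith [sq_nonneg |η|]
      rw [e]
      refine (norm_add_le _ _).trans ?_
      linarith [hC η hη]
  have hlam' : ∀ η ∈ Icc (-η₁) η₁,
      ‖lam (-η) - -(Complex.I * lam₁) * η‖ ≤ (|C| * η₁ + lam₂) * |η| ^ 2 := fun η hη => by
    have := hlam (-η) (hI η hη)
    rw [abs_neg] at this
    convert this using 3
    push_cast; ring
  have hp' : ∀ η ∈ Icc (-η₁) η₁, ∀ z, pencil a b c (-(η : ℂ) ^ 2) (lam η)
      (fun j => ev α (min α (alphaC a b c - α) / 2) (eigJet hw lam w j η) z) z = 0 :=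
    fun η hη z => by
      rw [← hp η hη z]
      congr 1; funext j
      simp only [eigJet, ev_add, ev_smul, ev_qE, ev_uE]
  obtain ⟨Z₁, Z₂, E, hE, eZ₁, eZ₂, eZ⟩ := exists_direct_family hw k hμ hl hls hr
  obtain ⟨Y₂, Y₁, F, hF, eY₂, eY₁, eY⟩ := exists_adjoint_family hw k hI hμ hl hls hr
  have hζ : ContDiffOn ℝ ∞ (fun η => Z₁ + lam η • Z₂ + (-(η : ℂ) ^ 2) • E η) (Icc (-η₁) η₁) :=
    (contDiffOn_const.add (hls.smul contDiffOn_const)).add (hsq.smul hE)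
  have hζs : ContDiffOn ℝ ∞ (fun η => Y₂ + lam (-η) • Y₁ + (-(η : ℂ) ^ 2) • F η)
      (Icc (-η₁) η₁) :=
    (contDiffOn_const.add (hls'.smul contDiffOn_const)).add (hsq.smul hF)
  have hκ : 0 < (c ^ 2 - 1) / c := div_pos h.sq_sub_pos h.c_pos
  -- The limits at `η = 0` are non-zero, because `q` and `(1 - b∂²)q` are non-zero at the origin.
  have hZ₁ : Z₁ ≠ 0 := by
    rintro rfl
    have e := eq_zero_of_toWL2_eq_zero hw.pos (Prod.ext_iff.1 eZ₁).1.symm 0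
    rw [ev_qE, Complex.ofReal_eq_zero, sol_zero_apply, mul_zero, Real.tanh_zero] at e
    exact hκ.ne' (by linarith)
  have hY₂ : Y₂ ≠ 0 := by
    rintro rfl
    have e := eq_zero_of_toWL2_eq_zero hw.pos (Prod.ext_iff.1 eY₂).2.symm 0
    rw [ev_opP2_dualJet_zero hw] at e
    exact (mul_pos (mul_pos h.c_pos hκ) (by have := h.theta_pos; have := ha.trans hab; positivity :
      0 < 1 + 2 * b * theta a b c ^ 2)).ne' (by exact_mod_cast e)
  obtain ⟨ε₁, hε₁, n1⟩ := exists_ne_zero_near hη₁ hζ.continuousOn (by simpa [hlam0] using hZ₁)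
  obtain ⟨ε₂, hε₂, n2⟩ := exists_ne_zero_near hη₁ hζs.continuousOn (by simpa [hlam0] using hY₂)
  have hsub : Icc (-min η₁ (min ε₁ ε₂)) (min η₁ (min ε₁ ε₂)) ⊆ Icc (-η₁) η₁ := fun η hη =>
    abs_le.1 ((abs_le.2 hη).trans (min_le_left _ _))
  have hG : ∀ η ∈ Icc (-η₁) η₁, MemGraph a b c α η
      (Z₁ + lam η • Z₂ + (-(η : ℂ) ^ 2) • E η).toL2
      (lam η • (Z₁ + lam η • Z₂ + (-(η : ℂ) ^ 2) • E η).toL2) := fun η hη => by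
    rw [eZ η hη]
    exact memGraph_of_pencil hw.pos (v := fun j => eigJet hw lam w j η)
      (fun j hj => hasDerivAt_eigJet hw lam (hd η hη j hj)) (hp' η hη) rfl
  have hA : ∀ η ∈ Icc (-η₁) η₁, MemAdjointGraph a b c α η
      (Y₂ + lam (-η) • Y₁ + (-(η : ℂ) ^ 2) • F η).toL2
      (lam (-η) • (Y₂ + lam (-η) • Y₁ + (-(η : ℂ) ^ 2) • F η).toL2) := fun η hη => by
    rw [eY η hη]
    exact memAdjointGraph_of_eigJet hw hI hr hd hp' hcj hη rfl
  refine ⟨min η₁ (min ε₁ ε₂), lt_min hη₁ (lt_min hε₁ hε₂), lam,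
    fun η => Z₁ + lam η • Z₂ + (-(η : ℂ) ^ 2) • E η,
    fun η => Y₂ + lam (-η) • Y₁ + (-(η : ℂ) ^ 2) • F η, lam₁, lam₂, hl₁, hl₂, hls.mono hsub,
    hζ.mono hsub, hζs.mono hsub, fun η hη => ?_, ⟨C, fun η hη => hC η (hsub hη)⟩, ?_, ?_,
    fun η hη => ?_⟩
  · have hle := (abs_le.2 hη).trans (min_le_right _ _)
    refine ⟨n1 η (hle.trans (min_le_left _ _)), n2 η (hle.trans (min_le_right _ _)), hG η (hsub hη),
      ?_, hA η (hsub hη), ?_⟩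
    · rw [← memGraph_neg]
      exact hG (-η) (hI η (hsub hη))
    · rw [← memAdjointGraph_neg]
      have := hA (-η) (hI η (hsub hη))
      simpa only [neg_neg] using this
  · obtain ⟨D, hD⟩ := exists_expansion_bound Z₁ Z₂ hE.continuousOn hlam
    exact ⟨Z₁, Z₂, eZ₁ ▸ represents_zeta1 hw, eZ₂ ▸ represents_zeta2 h hw, D,
      fun η hη => hD η (hsub hη)⟩
  · obtain ⟨D, hD⟩ := exists_expansion_bound Y₂ Y₁ hF.continuousOn hlam'
    refine ⟨Y₁, Y₂, eY₁ ▸ represents_zeta1Star h hw, eY₂ ▸ represents_zeta2Star h hw, D,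
      fun η hη => ?_⟩
    have e : Y₂ - (Complex.I * lam₁ * η) • Y₁ = Y₂ + (-(Complex.I * lam₁) * η) • Y₁ := by
      rw [neg_mul, neg_smul, sub_eq_add_neg]
    rw [e]
    exact hD η (hsub hη)
  · have hη' := hsub hη
    have hcη := hcj η hη'
    have hcn := hcj (-η) (hI η hη')
    have ej : ∀ j, star (eigJet hw lam w j η) = eigJet hw lam w j (-η) := fun j =>
      star_eigJet hw hcη.1 (hcη.2 j)
    have es : ∀ j, star (dualJet c (fun j => eigJet hw lam w j (-η)) j) =
        dualJet c (fun j => eigJet hw lam w j (- -η)) j := fun j => by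
      rw [star_dualJet, funext fun j => star_eigJet hw hcn.1 (hcn.2 j)]
    refine ⟨hcη.1, ?_, ?_⟩
    · beta_reduce
      rw [eZ η hη', eZ (-η) (hI η hη')]
      refine isConjOf_toWL2 hw.pos (ej 0) ?_
      rw [star_sub, star_smul, star_smul, ej, ej, Complex.star_def, hcη.1, Complex.conj_ofReal]
    · beta_reduce
      rw [eY η hη', eY (-η) (hI η hη')]
      refine isConjOf_toWL2 hw.pos ?_ ?_
      · rw [star_adjFst, funext es, hcn.1]
      · rw [star_adjSnd, funext es]
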